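/- **Setting.** An instance consists of a finite set $A=\{a_1,\dots,a_n\}$ of agents, a number $\ell\ge 1$ of layers, an integer $\alpha\in\{1,\dots,\ell\}$, and for every agent $a\in A$ and every layer $i\in\{1,\dots,\ell\}$ a set $T_a^i\subseteq A$ of agents that $a$ *approves* in layer $i$. Approvals are *symmetric* if, in every layer $i$, $b\in T_a^i$ if and only if $a\in T_b^i$. A matching $M$ is a set of two-element subsets of $A$ in which each agent occurs at most once; $M(a)$ is the partner of $a$, or $M(a)=\square$ if $a$ is unmatched. Agent $a$ is *happy* in layer $i$ if $M(a)\in T_a^i$. For $x,y\in A\cup\{\square\}$, in layer $i$ agent $a$ *prefers* $x$ to $y$ if $x\in T_a^i$ and $y\notin T_a^i$, and is *indifferent* between $x$ and $y$ if both or neither of them belong to $T_a^i$ (where $\square\notin T_a^i$). A pair $\{a,b\}\notin M$ of distinct agents *blocks* $M$ in layer $i$ - under *weak stability* if $a$ prefers $b$ to $M(a)$ and $b$ prefers $a$ to $M(b)$; - under *strong stability* if, possibly after exchanging the roles of $a$ and $b$, $a$ prefers $b$ to $M(a)$, and $b$ prefers $a$ to $M(b)$ or is indifferent between them; - under *super stability*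 if $a$ prefers $b$ to $M(a)$ or is indifferent between them, and $b$ prefers $a$ to $M(b)$ or is indifferent between them. For each of these three notions, $M$ is *stable in layer $i$* if no pair blocks $M$ in layer $i$. The matching $M$ is - *$\alpha$-globally weakly/strongly/super stable* if there are $\alpha$ layers in each of which $M$ is weakly/strongly/super stable; - *$\alpha$-pair weakly/strongly/super stable* if for each pair of distinct agents there are at least $\alpha$ layers in which the pair does not block $M$ under weak/strong/super stability; - *$\alpha$-individually weakly stable* if for each pair $\{a,a'\}\notin M$ of distinct agents there is a choice of $b\ne b'$ in $\{a,a'\}$ such that in at least $\alpha$ layers $b$ does not approve $b'$ or $b$ is happy; - *$\alpha$-individually super stable* if for each pair $\{a,a'\}\notin M$ of distinct agents there is a choice of $b\ne b'$ in $\{a,a'\}$ such that in at least $\alpha$ layers $b$ does not approve $b'$ and $b$ is happy. The decision problems Global Weak/Strong/Super Stability, Pair Weak/Strong/Super Stability and Individual Weak/Super Stability ask, for a given instance $\mathcal I$, whether there is a matching that is stable in the respective sense. **Theorem.** Let $\beta$ be the number of agents $a$ whose approval sets are not identical in all layers, that is, for which $T_a^1,\dots,T_a^\ell$ are not all equal.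 Each of these eight problems, restricted to instances with symmetric approvals, is fixed-parameter tractable with respect to $\beta$: there are an algorithm (a program of a random access machine with addition, subtraction and indirect addressing), a computable function $f$ and a constant $c$ such that the algorithm correctly decides every instance $\mathcal I$ with symmetric approvals in at most $f(\beta)\cdot|\mathcal I|^{c}$ steps, where $|\mathcal I|$ is the length in bits of an explicit encoding of $\mathcal I$ (the numbers $n,\ell,\alpha$ in binary, followed by the $0/1$ adjacency matrices of the approval graphs of the layers). -/

import Mathlib

namespace MultilayerMatching

/-! ### Random access machines with step counting

A program works on registers and on arrays of natural numbers with indirect addressing. Every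
instruction costs one step. The only arithmetic operations are addition and truncated subtraction,
so that this cost measure is polynomially related to Turing machine time. -/

/-- Programs of the random access machine. A program is a finite object and therefore mentions only
finitely many registers and arrays. -/
inductive Prog : Type
  /-- do nothing -/
  | skip : Prog
  /-- `reg x := c` -/
  | const (x c : ℕ) : Prog
  /-- `reg x := reg y` -/
  | copy (x y : ℕ) : Prog
  /-- `reg x := reg y + reg z` -/
  | add (x y z : ℕ) : Prog
  /-- `reg x := reg y - reg z` (truncated) -/
  | sub (x y z : ℕ) : Prog
  /-- `reg x := arr k [reg y]` -/
  | load (x k y : ℕ) : Prog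
  /-- `arr k [reg y] := reg x` -/
  | store (k y x : ℕ) : Prog
  /-- `p` followed by `q` -/
  | seq (p q : Prog) : Prog
  /-- if `reg x ≠ 0` then `p` else `q` -/
  | cond (x : ℕ) (p q : Prog) : Prog
  /-- while `reg x ≠ 0` do `p` -/
  | loop (x : ℕ) (p : Prog) : Prog

/-- Contents of the registers and of the arrays: `reg x` is register `x`, and `arr k j` is cell `j`
of array `k`. -/
structure Store : Type where
  reg : ℕ → ℕ
  arr : ℕ → ℕ → ℕ

/-- The store with register `x` set to `v`. -/
def Store.setReg (s : Store) (x v : ℕ) : Store :=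
  { s with reg := Function.update s.reg x v }

/-- The store with cell `j` of array `k` set to `v`. -/
def Store.setArr (s : Store) (k j v : ℕ) : Store :=
  { s with arr := Function.update s.arr k (Function.update (s.arr k) j v) }

/-- One step of the machine. A configuration consists of the list of program parts that are still
to be executed, in order, and of the store. The machine has halted when that list is empty. -/
def step : List Prog × Store → List Prog × Store
  | ([], s) => ([], s)
  | (Prog.skip :: K, s) => (K, s)
  | (Prog.const x c :: K, s) => (K, s.setReg x c)
  | (Prog.copy x y :: K, s) => (K, s.setReg x (s.reg y))
  | (Prog.add x y z :: K, s) => (K, s.setReg x (s.reg y + s.reg z))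
  | (Prog.sub x y z :: K, s) => (K, s.setReg x (s.reg y - s.reg z))
  | (Prog.load x k y :: K, s) => (K, s.setReg x (s.arr k (s.reg y)))
  | (Prog.store k y x :: K, s) => (K, s.setArr k (s.reg y) (s.reg x))
  | (Prog.seq p q :: K, s) => (p :: q :: K, s)
  | (Prog.cond x p q :: K, s) => (if s.reg x ≠ 0 then p :: K else q :: K, s)
  | (Prog.loop x p :: K, s) => (if s.reg x ≠ 0 then p :: Prog.loop x p :: K else K, s)

/-- The initial store: the input word is in array `0`, everything else is `0`. -/
def initStore (w : List ℕ) : Store where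
  reg := fun _ => 0
  arr := fun k j => if k = 0 then w.getD j 0 else 0

/-- Started on the input `w`, the program `P` halts after at most `t` steps, with the store `s`. -/
def HaltsWithin (P : Prog) (w : List ℕ) (t : ℕ) (s : Store) : Prop :=
  ∃ t' ≤ t, step^[t'] ([P], initStore w) = ([], s)

/-- The size of an input in bits: each number counts with the length of its binary representation,
plus one for a separator. -/
def inputSize (w : List ℕ) : ℕ :=
  (w.map fun x => Nat.size x + 1).sum

/-- Fixed-parameter tractability of the decision problem `yes` on the instances satisfying `dom`,
with respect to the parameter `κ`: there are one program, a computable function `f` and a constant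
`c` such that, on each instance `x` of the domain, the program halts after at most
`f (κ x) * |x| ^ c` steps and accepts (register `0` is nonzero) if and only if the answer is yes. -/
def IsFPT {ι : Type} (enc : ι → List ℕ) (dom yes : ι → Prop) (κ : ι → ℕ) : Prop :=
  ∃ (P : Prog) (f : ℕ → ℕ) (c : ℕ), Computable f ∧
    ∀ x : ι, dom x → ∃ s : Store,
      HaltsWithin P (enc x) (f (κ x) * inputSize (enc x) ^ c) s ∧ (s.reg 0 ≠ 0 ↔ yes x)

/-! ### Multilayer approval preferences -/

/-- An instance: `n` agents, `ℓ` layers, the sets `T i a` of the agents that agent `a` approves in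
layer `i`, and the desired degree of stability `α ∈ {1, …, ℓ}`. -/
structure Inst : Type where
  n : ℕ
  ℓ : ℕ
  α : ℕ
  one_le_α : 1 ≤ α
  α_le_ℓ : α ≤ ℓ
  T : Fin ℓ → Fin n → Finset (Fin n)

/-- A matching of `n` agents, given by its partner function. Here `M.partner a = some b` says that
the pair `{a, b}` belongs to the matching, and `M.partner a = none` that `a` is unmatched. -/
structure Matching (n : ℕ) : Type where
  partner : Fin n → Option (Fin n)
  symm : ∀ a b, partner a = some b → partner b = some a
  irrefl : ∀ a, partner a ≠ some a

namespace Inst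

variable (I : Inst)

/-- The input word: `n`, `ℓ`, `α`, and then, for each layer, the rows of the adjacency matrix of the
approval graph of that layer. -/
def encode : List ℕ :=
  [I.n, I.ℓ, I.α] ++
    (List.finRange I.ℓ).flatMap fun i =>
      (List.finRange I.n).flatMap fun a =>
        (List.finRange I.n).map fun b => if b ∈ I.T i a then 1 else 0

/-- Approvals are symmetric. -/
def Symmetric : Prop :=
  ∀ (i : Fin I.ℓ) (a b : Fin I.n), b ∈ I.T i a ↔ a ∈ I.T i b

/-- The number `β` of the agents whose approval sets are not identical in all layers. -/
def changing : ℕ :=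
  (Finset.univ.filter fun a : Fin I.n => ¬ ∀ i j : Fin I.ℓ, I.T i a = I.T j a).card

/-- In layer `i`, agent `a` approves the outcome `o`, which is an agent or `none` for being
unmatched. -/
def Approves (i : Fin I.ℓ) (a : Fin I.n) (o : Option (Fin I.n)) : Prop :=
  ∃ b ∈ I.T i a, o = some b

/-- In layer `i`, agent `a` prefers the outcome `o` to the outcome `o'`. -/
def Prefers (i : Fin I.ℓ) (a : Fin I.n) (o o' : Option (Fin I.n)) : Prop :=
  I.Approves i a o ∧ ¬ I.Approves i a o'

/-- In layer `i`, agent `a` is indifferent between the outcomes `o` and `o'`. -/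
def Indifferent (i : Fin I.ℓ) (a : Fin I.n) (o o' : Option (Fin I.n)) : Prop :=
  I.Approves i a o ↔ I.Approves i a o'

/-- Agent `a` is happy in the matching `M` in layer `i`. -/
def Happy (M : Matching I.n) (i : Fin I.ℓ) (a : Fin I.n) : Prop :=
  I.Approves i a (M.partner a)

end Inst

/-- The three single-layer stability notions. -/
inductive Base : Type
  | weak : Base
  | strong : Base
  | super : Base

namespace Inst

variable (I : Inst)

/-- The pair `{a, b}` of distinct agents, not matched to each other, blocks the matching `M` in
layer `i` under weak, strong or super stability. -/
def Blocks (M : Matching I.n) (i : Fin I.ℓ) (a b : Fin I.n) (σ : Base) : Prop :=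
  a ≠ b ∧ M.partner a ≠ some b ∧
    match σ with
    | Base.weak => I.Prefers i a (some b) (M.partner a) ∧ I.Prefers i b (some a) (M.partner b)
    | Base.strong =>
        (I.Prefers i a (some b) (M.partner a) ∧
          (I.Prefers i b (some a) (M.partner b) ∨ I.Indifferent i b (some a) (M.partner b))) ∨
        (I.Prefers i b (some a) (M.partner b) ∧
          (I.Prefers i a (some b) (M.partner a) ∨ I.Indifferent i a (some b) (M.partner a)))
    | Base.super =>
        (I.Prefers i a (some b) (M.partner a) ∨ I.Indifferent i a (some b) (M.partner a)) ∧
        (I.Prefers i b (some a) (M.partner b) ∨ I.Indifferent i b (some a) (M.partner b))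

/-- The matching `M` is weakly, strongly or super stable in layer `i`. -/
def StableInLayer (M : Matching I.n) (i : Fin I.ℓ) (σ : Base) : Prop :=
  ∀ a b : Fin I.n, ¬ I.Blocks M i a b σ

/-- There are `α` layers with the property `p`. -/
def HoldsInLayers (p : Fin I.ℓ → Prop) : Prop :=
  ∃ S : Finset (Fin I.ℓ), I.α ≤ S.card ∧ ∀ i ∈ S, p i

end Inst

/-- The multilayer stability notions: global and pair stability for each of the three single-layer
notions, individual stability for weak and super. -/
inductive Notion : Type
  | global (σ : Base) : Notion
  | pair (σ : Base) : Notion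
  | individualWeak : Notion
  | individualSuper : Notion

namespace Inst

variable (I : Inst)

/-- The matching `M` is `α`-globally, `α`-pair or `α`-individually stable, in the sense of `N`. -/
def Stable (M : Matching I.n) : Notion → Prop
  | Notion.global σ => I.HoldsInLayers fun i => I.StableInLayer M i σ
  | Notion.pair σ => ∀ a b : Fin I.n, a ≠ b → I.HoldsInLayers fun i => ¬ I.Blocks M i a b σ
  | Notion.individualWeak => ∀ a b : Fin I.n, a ≠ b → M.partner a ≠ some b →
      (I.HoldsInLayers fun i => b ∉ I.T i a ∨ I.Happy M i a) ∨
      (I.HoldsInLayers fun i => a ∉ I.T i b ∨ I.Happy M i b)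
  | Notion.individualSuper => ∀ a b : Fin I.n, a ≠ b → M.partner a ≠ some b →
      (I.HoldsInLayers fun i => b ∉ I.T i a ∧ I.Happy M i a) ∨
      (I.HoldsInLayers fun i => a ∉ I.T i b ∧ I.Happy M i b)

/-- The question of the decision problem: is there a stable matching? -/
def HasStableMatching (N : Notion) : Prop :=
  ∃ M : Matching I.n, I.Stable M N

end Inst

end MultilayerMatching

/-! The algorithm runs through guesses about an unknown stable matching `M`, rebuilds from each
guess a matching in polynomial time, and accepts if some rebuilt matching passes a direct stability
check. Soundness lies in the check. What has to be proved is that the right guess rebuilds a stable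
matching, not necessarily `M`, and that rebuilding is polynomial.

By symmetry, an approval between two agents of which at least one is unchanging does not depend on
the layer (`Sys.const'`). So a guess only has to treat the changing agents in detail. It has 2β+1
digits in base β+2: for each changing agent, which changing agent is its partner, or that it is
matched to an unchanging agent that it approves, or neither; for each changing agent, whether all
its unchanging neighbours are happy in `M`; and whether all unchanging agents that approve somebody
are happy in `M`. The pairs of changing agents are kept. Among the unchanging agents and the
changing agents matched outwards, one computes a matching along approved pairs that covers the
latter and those unchanging agents that the guess forces to be happy; `M` shows that there is one.
It is extended greedily by approved pairs of unchanging agents, and finally by arbitrary pairs.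

Stability of the result `m` is `Sys.nstable_of_rebuilt`. A changing agent that is happy in `M` in
some layer is happy in `m` in that layer. For the weak notions, a pair of unchanging agents is
settled by greediness, and a pair of changing agents is no worse than in `M`. For an unchanging `u`
and a changing `c` that approve each other, either `u` was forced to be happy, or `c` has an
unchanging neighbour `v` that is unhappy in `M`; then `{v, c}` takes the place of `{u, c}` in `M`,
in all layers alike. For the strong notions, α ≥ 1 makes every unchanging agent that approves
somebody happy, so all of them are forced. For the super notions `M` is so rigid that `m = M`.

A matching that covers prescribed vertices is a perfect matching of two copies of the graph in which
the copies of each optional vertex are joined (`doubled`). Perfect matchings are found by Edmonds'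
blossom search, used only to decide whether some matching covers the root and everything covered so
far (`searchCmd_spec`). Blossoms are recorded as factor-critical vertex sets (`Forest.critical`):
this yields augmentations (`aug_of_exposed`), survives contraction (`walk_step`, `forest_contract`),
and gives the parity obstruction when the search is stuck (`not_aug`). No augmenting path is traced:
unmatched edges are deleted as long as an augmentation survives, and then the new matching can be
read off (`read_augmented`).

For the running time, the algorithm is written with bounded loops only. `Cmd.compile_spec`
translates it to the machine with an exact step count, and `Cmd.cost_le_bound` with
`Cmd.exists_bound_le` gives a polynomial for everything except the loop over the (β+2)^(2β+1)
guesses.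

Memory: registers 1 to 4 hold n, ℓ, α and 2n, registers 5 to 8 hold β, β+2, 2β+1 and the number of
guesses, and register 0 the answer. Array 0 is the input; 1 and 2 hold the multiples of n and 2n; 3
lists the changing agents and 4 their positions plus one; 5 holds the digits; 6 the rebuilt
matching; 7 the doubled graph, 8 its working copy and 9 its matching; 10 to 14 the labels, bases,
parents, depths and marks of the search; 15 is a buffer; 16 to 18 mark the agents to be covered,
those that do not take part, and those whose neighbours must be happy. -/

namespace MultilayerMatching

/-! ### A language of bounded loops -/

/-- Arithmetic expressions over registers and arrays. -/
inductive Expr : Type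
  | var (x : ℕ) : Expr
  | lit (c : ℕ) : Expr
  | add (a b : Expr) : Expr
  | sub (a b : Expr) : Expr
  | get (k : ℕ) (e : Expr) : Expr

/-- Commands with bounded loops. -/
inductive Cmd : Type
  | assign (x : ℕ) (e : Expr) : Cmd
  | put (k : ℕ) (i e : Expr) : Cmd
  | seq (p q : Cmd) : Cmd
  | ite (e : Expr) (p q : Cmd) : Cmd
  | loop (x y : ℕ) (p : Cmd) : Cmd
  | skip : Cmd

/-- The value of an expression. -/
def Expr.eval (s : Store) : Expr → ℕ
  | var x => s.reg x
  | lit c => c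
  | add a b => a.eval s + b.eval s
  | sub a b => a.eval s - b.eval s
  | get k e => s.arr k (e.eval s)

/-- `m` rounds of an indexed transformation. -/
def iterLoop (f : ℕ → Store → Store) : ℕ → Store → Store
  | 0, s => s
  | m + 1, s => f m (iterLoop f m s)

/-- The effect of a command. -/
def Cmd.den : Cmd → Store → Store
  | assign x e, s => s.setReg x (e.eval s)
  | put k i e, s => s.setArr k (i.eval s) (e.eval s)
  | seq p q, s => q.den (p.den s)
  | ite e p q, s => if e.eval s ≠ 0 then p.den s else q.den s
  | .loop x y p, s => iterLoop (fun i s => p.den (s.setReg x i)) (s.reg y) s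
  | skip, s => s

/-- The number of steps to evaluate an expression. -/
def Expr.cost : Expr → ℕ
  | var _ => 1
  | lit _ => 1
  | add a b => 2 + a.cost + b.cost + 1
  | sub a b => 2 + a.cost + b.cost + 1
  | get _ e => 1 + e.cost + 1

/-- The total cost of the rounds of a loop. -/
def iterCost (f : ℕ → Store → Store) (c : ℕ → Store → ℕ) : ℕ → Store → ℕ
  | 0, _ => 0
  | m + 1, s => iterCost f c m s + c m (iterLoop f m s)

/-- The number of steps to run a command. -/
def Cmd.cost : Cmd → Store → ℕ
  | assign _ e, _ => 1 + e.cost + 1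
  | put _ i e, _ => 2 + i.cost + e.cost + 1
  | seq p q, s => 1 + p.cost s + q.cost (p.den s)
  | ite e p q, s => 1 + e.cost + 1 + if e.eval s ≠ 0 then p.cost s else q.cost s
  | .loop x y p, s => 5 + iterCost (fun i s => p.den (s.setReg x i))
      (fun i s => 9 + p.cost (s.setReg x i)) (s.reg y) s
  | skip, _ => 1

/-! ### Compilation -/

/-- Code that evaluates an expression into the auxiliary register `2 * o + 1`. -/
def Expr.compile : Expr → ℕ → Prog
  | var x, o => Prog.copy (2 * o + 1) (2 * x)
  | lit c, o => Prog.const (2 * o + 1) c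
  | add a b, o => Prog.seq (a.compile o) (Prog.seq (b.compile (o + 1))
      (Prog.add (2 * o + 1) (2 * o + 1) (2 * (o + 1) + 1)))
  | sub a b, o => Prog.seq (a.compile o) (Prog.seq (b.compile (o + 1))
      (Prog.sub (2 * o + 1) (2 * o + 1) (2 * (o + 1) + 1)))
  | get k e, o => Prog.seq (e.compile o) (Prog.load (2 * o + 1) k (2 * o + 1))

/-- Code for a command. Register `x` of the command is register `2 * x` of the machine, and the
odd registers from `2 * o + 1` on are auxiliary. -/
def Cmd.compile : Cmd → ℕ → Prog
  | assign x e, o => Prog.seq (e.compile o) (Prog.copy (2 * x) (2 * o + 1))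
  | put k i e, o => Prog.seq (i.compile o) (Prog.seq (e.compile (o + 1))
      (Prog.store k (2 * o + 1) (2 * (o + 1) + 1)))
  | seq p q, o => Prog.seq (p.compile o) (q.compile o)
  | ite e p q, o => Prog.seq (e.compile o) (Prog.cond (2 * o + 1) (p.compile o) (q.compile o))
  | .loop x y p, o => Prog.seq (Prog.copy (2 * o + 1) (2 * y))
      (Prog.seq (Prog.const (2 * (o + 1) + 1) 0)
        (Prog.loop (2 * o + 1)
          (Prog.seq (Prog.copy (2 * x) (2 * (o + 1) + 1)) (Prog.seq (p.compile (o + 3))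
            (Prog.seq (Prog.const (2 * (o + 2) + 1) 1)
              (Prog.seq (Prog.add (2 * (o + 1) + 1) (2 * (o + 1) + 1) (2 * (o + 2) + 1))
                (Prog.sub (2 * o + 1) (2 * o + 1) (2 * (o + 2) + 1))))))))
  | skip, _ => Prog.skip

/-- From the store `s`, the program `P` runs to completion in exactly `t` steps and leaves `s'`. -/
def Runs (P : Prog) (s : Store) (t : ℕ) (s' : Store) : Prop :=
  ∀ K : List Prog, step^[t] (P :: K, s) = (K, s')

/-- Composition is possible because `Runs` quantifies over the program parts that remain to be
executed. The extra step unpacks the sequence. -/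
theorem Runs.seq {P Q : Prog} {s s' s'' : Store} {t t' : ℕ} (h : Runs P s t s')
    (h' : Runs Q s' t' s'') : Runs (Prog.seq P Q) s (1 + t + t') s'' := by
  intro K
  have e : 1 + t + t' = t' + (t + 1) := by omega
  rw [e, Function.iterate_add_apply, Function.iterate_succ_apply]
  change step^[t'] (step^[t] (P :: Q :: K, s)) = _
  rw [h, h']

theorem Runs.congr {P : Prog} {s s' : Store} {t t' : ℕ} (h : Runs P s t s') (e : t = t') :
    Runs P s t' s' := e ▸ h

theorem Runs.one {P : Prog} {s s' : Store} (h : ∀ K, step (P :: K, s) = (K, s')) :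
    Runs P s 1 s' := fun K => h K

theorem Runs.cond_pos {P Q : Prog} {x t : ℕ} {s s' : Store} (hx : s.reg x ≠ 0)
    (h : Runs P s t s') : Runs (Prog.cond x P Q) s (1 + t) s' := by
  intro K
  rw [Nat.add_comm, Function.iterate_succ_apply]
  simp only [step, if_pos hx]
  exact h K

theorem Runs.cond_neg {P Q : Prog} {x t : ℕ} {s s' : Store} (hx : ¬ s.reg x ≠ 0)
    (h : Runs Q s t s') : Runs (Prog.cond x P Q) s (1 + t) s' := by
  intro K
  rw [Nat.add_comm, Function.iterate_succ_apply]
  simp only [step, if_neg hx]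
  exact h K

theorem Runs.loop_nil {P : Prog} {x : ℕ} {s : Store} (hx : s.reg x = 0) :
    Runs (Prog.loop x P) s 1 s := by
  intro K
  simp [step, hx]

theorem Runs.loop_cons {P : Prog} {x t t' : ℕ} {s s' s'' : Store} (hx : s.reg x ≠ 0)
    (h : Runs P s t s') (h' : Runs (Prog.loop x P) s' t' s'') :
    Runs (Prog.loop x P) s (1 + t + t') s'' := by
  intro K
  have e : 1 + t + t' = t' + (t + 1) := by omega
  rw [e, Function.iterate_add_apply, Function.iterate_succ_apply]
  simp only [step, if_pos hx]
  rw [h, h']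

/-- The machine store `m` represents the store `s`. -/
def Sim (s m : Store) : Prop :=
  (∀ x, m.reg (2 * x) = s.reg x) ∧ m.arr = s.arr

/-- The auxiliary registers below `o` agree. -/
def SameTemps (o : ℕ) (m m' : Store) : Prop :=
  ∀ j < o, m'.reg (2 * j + 1) = m.reg (2 * j + 1)

theorem setReg_reg (s : Store) (x v y : ℕ) :
    (s.setReg x v).reg y = if y = x then v else s.reg y := by
  simp [Store.setReg, Function.update_apply]

theorem setReg_arr (s : Store) (x v : ℕ) : (s.setReg x v).arr = s.arr := rfl

theorem setArr_reg (s : Store) (k j v : ℕ) : (s.setArr k j v).reg = s.reg := rfl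

theorem setArr_arr (s : Store) (k j v i : ℕ) :
    (s.setArr k j v).arr i = if i = k then Function.update (s.arr k) j v else s.arr i := by
  by_cases h : i = k
  · subst h; simp [Store.setArr]
  · simp [Store.setArr, h]

theorem Sim.setTemp {s m : Store} (h : Sim s m) (o v : ℕ) : Sim s (m.setReg (2 * o + 1) v) := by
  refine ⟨fun x => ?_, h.2⟩
  have : 2 * x ≠ 2 * o + 1 := by omega
  simp [Store.setReg, this, h.1]

theorem Sim.setVar {s m : Store} (h : Sim s m) (x v : ℕ) :
    Sim (s.setReg x v) (m.setReg (2 * x) v) := by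
  refine ⟨fun y => ?_, h.2⟩
  simp [setReg_reg, h.1]

theorem Sim.setArr {s m : Store} (h : Sim s m) (k j v : ℕ) :
    Sim (s.setArr k j v) (m.setArr k j v) := by
  refine ⟨h.1, ?_⟩
  simp [Store.setArr, h.2]

theorem SameTemps.refl (o : ℕ) (m : Store) : SameTemps o m m := fun _ _ => rfl

theorem SameTemps.trans {o o' : ℕ} {m m' m'' : Store} (h : SameTemps o m m')
    (h' : SameTemps o' m' m'') (ho : o ≤ o') : SameTemps o m m'' :=
  fun j hj => (h' j (by omega)).trans (h j hj)

theorem SameTemps.setTemp {o o' v : ℕ} {m m' : Store} (h : SameTemps o m m') (ho : o ≤ o') :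
    SameTemps o m (m'.setReg (2 * o' + 1) v) := by
  intro j hj
  have : j ≠ o' := by omega
  simp [Store.setReg, this, h j hj]

theorem SameTemps.setVar {o x v : ℕ} {m m' : Store} (h : SameTemps o m m') :
    SameTemps o m (m'.setReg (2 * x) v) := by
  intro j hj
  have : 2 * j + 1 ≠ 2 * x := by omega
  simp [Store.setReg, this, h j hj]

theorem setReg_reg_self (s : Store) (x v : ℕ) : (s.setReg x v).reg x = v := by
  simp [Store.setReg]

/-- The clause on temporaries belongs to the induction: the left operand waits in temporary `o`
while the right one is evaluated from `o + 1` on. -/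
theorem Expr.compile_spec (e : Expr) : ∀ (o : ℕ) (s m : Store), Sim s m → ∃ m',
    Runs (e.compile o) m e.cost m' ∧ Sim s m' ∧ SameTemps o m m' ∧
      m'.reg (2 * o + 1) = e.eval s := by
  induction e with
  | var x =>
    intro o s m h
    exact ⟨m.setReg (2 * o + 1) (m.reg (2 * x)), Runs.one fun K => rfl, h.setTemp _ _,
      (SameTemps.refl o m).setTemp le_rfl, by rw [setReg_reg_self, h.1]; rfl⟩
  | lit c =>
    intro o s m h
    exact ⟨m.setReg (2 * o + 1) c, Runs.one fun K => rfl, h.setTemp _ _,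
      (SameTemps.refl o m).setTemp le_rfl, by rw [setReg_reg_self]; rfl⟩
  | add a b iha ihb =>
    intro o s m h
    obtain ⟨m₁, r₁, h₁, t₁, v₁⟩ := iha o s m h
    obtain ⟨m₂, r₂, h₂, t₂, v₂⟩ := ihb (o + 1) s m₁ h₁
    refine ⟨m₂.setReg (2 * o + 1) (m₂.reg (2 * o + 1) + m₂.reg (2 * (o + 1) + 1)),
      (r₁.seq (r₂.seq (Runs.one fun K => rfl))).congr (by simp only [Expr.cost]; omega),
      h₂.setTemp _ _, (t₁.trans t₂ (by omega)).setTemp le_rfl, ?_⟩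
    rw [setReg_reg_self, t₂ o (by omega), v₁, v₂]
    rfl
  | sub a b iha ihb =>
    intro o s m h
    obtain ⟨m₁, r₁, h₁, t₁, v₁⟩ := iha o s m h
    obtain ⟨m₂, r₂, h₂, t₂, v₂⟩ := ihb (o + 1) s m₁ h₁
    refine ⟨m₂.setReg (2 * o + 1) (m₂.reg (2 * o + 1) - m₂.reg (2 * (o + 1) + 1)),
      (r₁.seq (r₂.seq (Runs.one fun K => rfl))).congr (by simp only [Expr.cost]; omega),
      h₂.setTemp _ _, (t₁.trans t₂ (by omega)).setTemp le_rfl, ?_⟩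
    rw [setReg_reg_self, t₂ o (by omega), v₁, v₂]
    rfl
  | get k e ih =>
    intro o s m h
    obtain ⟨m₁, r₁, h₁, t₁, v₁⟩ := ih o s m h
    refine ⟨m₁.setReg (2 * o + 1) (m₁.arr k (m₁.reg (2 * o + 1))),
      r₁.seq (Runs.one fun K => rfl), h₁.setTemp _ _, t₁.setTemp le_rfl, ?_⟩
    rw [setReg_reg_self, v₁, h₁.2]
    rfl

/-- Rounds of a loop from the round `i` on. -/
theorem loop_compile (x : ℕ) (o : ℕ) (p : Cmd)
    (ih : ∀ (s m : Store), Sim s m → ∃ m', Runs (p.compile (o + 3)) m (p.cost s) m' ∧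
      Sim (p.den s) m' ∧ SameTemps (o + 3) m m') (s₀ : Store) (n : ℕ) :
    ∀ (j i : ℕ) (m : Store), i + j = n →
      Sim (iterLoop (fun i s => p.den (s.setReg x i)) i s₀) m → m.reg (2 * o + 1) = j →
      m.reg (2 * (o + 1) + 1) = i → ∃ m' t,
      Runs (Prog.loop (2 * o + 1)
          (Prog.seq (Prog.copy (2 * x) (2 * (o + 1) + 1)) (Prog.seq (p.compile (o + 3))
            (Prog.seq (Prog.const (2 * (o + 2) + 1) 1)
              (Prog.seq (Prog.add (2 * (o + 1) + 1) (2 * (o + 1) + 1) (2 * (o + 2) + 1))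
                (Prog.sub (2 * o + 1) (2 * o + 1) (2 * (o + 2) + 1))))))) m (1 + t) m' ∧
      iterCost (fun i s => p.den (s.setReg x i)) (fun i s => 9 + p.cost (s.setReg x i)) i s₀ + t
        = iterCost (fun i s => p.den (s.setReg x i)) (fun i s => 9 + p.cost (s.setReg x i)) n s₀ ∧
      Sim (iterLoop (fun i s => p.den (s.setReg x i)) n s₀) m' ∧ SameTemps o m m' := by
  intro j
  -- Temporary `o` counts the rounds left, temporary `o + 1` the rounds done, and `o + 2` holds the
  -- constant 1. The loop variable is set afresh from `o + 1` in each round, so the body may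
  -- overwrite it.
  induction j with
  | zero =>
    intro i m hi hs hj _
    obtain rfl : i = n := by omega
    exact ⟨m, 0, Runs.loop_nil hj, by simp, hs, SameTemps.refl _ _⟩
  | succ j ihj =>
    intro i m hi hs hj hc
    set m₁ := m.setReg (2 * x) (m.reg (2 * (o + 1) + 1)) with hm₁
    have hs₁ : Sim ((iterLoop (fun i s => p.den (s.setReg x i)) i s₀).setReg x i) m₁ := by
      rw [hm₁, hc]; exact hs.setVar x i
    have ht₁ : SameTemps (o + 3) m m₁ := (SameTemps.refl _ _).setVar
    obtain ⟨m₂, r₂, hs₂, ht₂⟩ := ih _ _ hs₁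
    have hT : SameTemps (o + 3) m m₂ := ht₁.trans ht₂ le_rfl
    set m₃ := m₂.setReg (2 * (o + 2) + 1) 1 with hm₃
    set m₄ := m₃.setReg (2 * (o + 1) + 1) (m₃.reg (2 * (o + 1) + 1) + m₃.reg (2 * (o + 2) + 1))
      with hm₄
    set m₅ := m₄.setReg (2 * o + 1) (m₄.reg (2 * o + 1) - m₄.reg (2 * (o + 2) + 1)) with hm₅
    have hs₅ : Sim (iterLoop (fun i s => p.den (s.setReg x i)) (i + 1) s₀) m₅ :=
      ((hs₂.setTemp _ _).setTemp _ _).setTemp _ _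
    have ht₅ : SameTemps o m m₅ := by
      have h1 : SameTemps o m m₂ := fun k hk => hT k (by omega)
      exact ((h1.setTemp (by omega)).setTemp (by omega)).setTemp (by omega)
    have e0 := hT o (by omega)
    have e1 := hT (o + 1) (by omega)
    have v0 : m₅.reg (2 * o + 1) = j := by
      simp [hm₅, hm₄, hm₃, Store.setReg, e0, hj]
    have v1 : m₅.reg (2 * (o + 1) + 1) = i + 1 := by
      simp [hm₅, hm₄, hm₃, Store.setReg, e1, hc]
    obtain ⟨m', t, r', hc', hs', ht'⟩ := ihj (i + 1) m₅ (by omega) hs₅ v0 v1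
    have rb : Runs (Prog.seq (Prog.copy (2 * x) (2 * (o + 1) + 1)) (Prog.seq (p.compile (o + 3))
            (Prog.seq (Prog.const (2 * (o + 2) + 1) 1)
              (Prog.seq (Prog.add (2 * (o + 1) + 1) (2 * (o + 1) + 1) (2 * (o + 2) + 1))
                (Prog.sub (2 * o + 1) (2 * o + 1) (2 * (o + 2) + 1)))))) m _ m₅ :=
      Runs.seq (s' := m₁) (Runs.one fun K => rfl) (r₂.seq (Runs.seq (s' := m₃)
        (Runs.one fun K => rfl) (Runs.seq (s' := m₄) (Runs.one fun K => rfl)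
          (Runs.one fun K => rfl))))
    -- The 9 steps around the body are the loop test, four sequencing steps and the four
    -- instructions `copy`, `const`, `add`, `sub`.
    refine ⟨m', 9 + p.cost ((iterLoop (fun i s => p.den (s.setReg x i)) i s₀).setReg x i) + t,
      (Runs.loop_cons (by omega) rb r').congr (by omega), ?_, hs', ht₅.trans ht' le_rfl⟩
    rw [← hc']
    simp only [iterCost]
    omega

theorem Cmd.compile_spec (c : Cmd) : ∀ (o : ℕ) (s m : Store), Sim s m → ∃ m',
    Runs (c.compile o) m (c.cost s) m' ∧ Sim (c.den s) m' ∧ SameTemps o m m' := by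
  induction c with
  | skip => exact fun o s m h => ⟨m, Runs.one fun K => rfl, h, SameTemps.refl _ _⟩
  | assign x e =>
    intro o s m h
    obtain ⟨m₁, r₁, h₁, t₁, v₁⟩ := e.compile_spec o s m h
    refine ⟨m₁.setReg (2 * x) (m₁.reg (2 * o + 1)), r₁.seq (Runs.one fun K => rfl), ?_, t₁.setVar⟩
    rw [v₁]
    exact h₁.setVar _ _
  | put k i e =>
    intro o s m h
    obtain ⟨m₁, r₁, h₁, t₁, v₁⟩ := i.compile_spec o s m h
    obtain ⟨m₂, r₂, h₂, t₂, v₂⟩ := e.compile_spec (o + 1) s m₁ h₁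
    refine ⟨m₂.setArr k (m₂.reg (2 * o + 1)) (m₂.reg (2 * (o + 1) + 1)),
      (r₁.seq (r₂.seq (Runs.one fun K => rfl))).congr (by simp only [Cmd.cost]; omega), ?_,
      t₁.trans t₂ (by omega)⟩
    rw [v₂, t₂ o (by omega), v₁]
    exact h₂.setArr _ _ _
  | seq p q ihp ihq =>
    intro o s m h
    obtain ⟨m₁, r₁, h₁, t₁⟩ := ihp o s m h
    obtain ⟨m₂, r₂, h₂, t₂⟩ := ihq o _ m₁ h₁
    exact ⟨m₂, r₁.seq r₂, h₂, t₁.trans t₂ le_rfl⟩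
  | ite e p q ihp ihq =>
    intro o s m h
    obtain ⟨m₁, r₁, h₁, t₁, v₁⟩ := e.compile_spec o s m h
    by_cases hc : e.eval s ≠ 0
    · obtain ⟨m₂, r₂, h₂, t₂⟩ := ihp o _ m₁ h₁
      refine ⟨m₂, (r₁.seq (Runs.cond_pos (by rwa [v₁]) r₂)).congr ?_, ?_, t₁.trans t₂ le_rfl⟩
      · simp only [Cmd.cost, if_pos hc]; omega
      · simpa only [Cmd.den, if_pos hc] using h₂
    · obtain ⟨m₂, r₂, h₂, t₂⟩ := ihq o _ m₁ h₁
      refine ⟨m₂, (r₁.seq (Runs.cond_neg (by rwa [v₁]) r₂)).congr ?_, ?_, t₁.trans t₂ le_rfl⟩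
      · simp only [Cmd.cost, if_neg hc]; omega
      · simpa only [Cmd.den, if_neg hc] using h₂
  | loop x y p ih =>
    intro o s m h
    set m₁ := m.setReg (2 * o + 1) (m.reg (2 * y)) with hm₁
    set m₂ := m₁.setReg (2 * (o + 1) + 1) 0 with hm₂
    have h₂ : Sim s m₂ := (h.setTemp _ _).setTemp _ _
    have t₂ : SameTemps o m m₂ := ((SameTemps.refl o m).setTemp le_rfl).setTemp (by omega)
    obtain ⟨m', t, r', hc', hs', ht'⟩ := loop_compile x o p (ih (o + 3)) s (s.reg y) (s.reg y) 0 m₂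
      (by omega) h₂ (by simp [hm₂, hm₁, Store.setReg, h.1])
      (by simp [hm₂, Store.setReg])
    refine ⟨m', ((Runs.one (s' := m₁) fun K => rfl).seq ((Runs.one (s' := m₂) fun K => rfl).seq
      r')).congr ?_, hs', t₂.trans ht' le_rfl⟩
    -- The constant 5 of the loop cost consists of two initialisations, two sequencing steps and the
    -- final failing loop test.
    simp only [Cmd.cost]
    simp only [iterCost] at hc'
    omega

/-! ### Frame and cost -/

/-- The registers a command may write. -/
def Cmd.regs : Cmd → List ℕ
  | assign x _ => [x]
  | put _ _ _ => []
  | seq p q => p.regs ++ q.regs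
  | ite _ p q => p.regs ++ q.regs
  | .loop x _ p => x :: p.regs
  | skip => []

/-- The arrays a command may write. -/
def Cmd.arrs : Cmd → List ℕ
  | assign _ _ => []
  | put k _ _ => [k]
  | seq p q => p.arrs ++ q.arrs
  | ite _ p q => p.arrs ++ q.arrs
  | .loop _ _ p => p.arrs
  | skip => []

/-- The stores agree outside the registers and arrays that `c` may write. -/
def Frame (c : Cmd) (s s' : Store) : Prop :=
  (∀ x, x ∉ c.regs → s'.reg x = s.reg x) ∧ ∀ k, k ∉ c.arrs → s'.arr k = s.arr k

theorem iterLoop_frame (p : Cmd) (x y : ℕ) (ih : ∀ s, Frame p s (p.den s)) (s : Store) (n : ℕ) :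
    Frame (.loop x y p) s (iterLoop (fun i s => p.den (s.setReg x i)) n s) := by
  induction n with
  | zero => exact ⟨fun _ _ => rfl, fun _ _ => rfl⟩
  | succ n ihn =>
    refine ⟨fun z hz => ?_, fun k hk => ?_⟩
    · simp only [Cmd.regs, List.mem_cons, not_or] at hz
      rw [iterLoop, (ih _).1 z hz.2]
      simp only [Store.setReg, Function.update_apply, if_neg hz.1]
      exact ihn.1 z (by simp [Cmd.regs, hz])
    · rw [iterLoop, (ih _).2 k hk]
      exact ihn.2 k hk

theorem Cmd.frame (c : Cmd) : ∀ s, Frame c s (c.den s) := by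
  induction c with
  | skip => exact fun s => ⟨fun _ _ => rfl, fun _ _ => rfl⟩
  | assign x e =>
    intro s
    refine ⟨fun y hy => ?_, fun _ _ => rfl⟩
    simp only [regs, List.mem_singleton] at hy
    simp [den, Store.setReg, hy]
  | put k i e =>
    intro s
    refine ⟨fun _ _ => rfl, fun j hj => ?_⟩
    simp only [arrs, List.mem_singleton] at hj
    simp [den, Store.setArr, hj]
  | seq p q ihp ihq =>
    intro s
    refine ⟨fun x hx => ?_, fun k hk => ?_⟩
    · simp only [regs, List.mem_append, not_or] at hx
      rw [den, (ihq _).1 x hx.2, (ihp _).1 x hx.1]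
    · simp only [arrs, List.mem_append, not_or] at hk
      rw [den, (ihq _).2 k hk.2, (ihp _).2 k hk.1]
  | ite e p q ihp ihq =>
    intro s
    refine ⟨fun x hx => ?_, fun k hk => ?_⟩
    · simp only [regs, List.mem_append, not_or] at hx
      rw [den]
      split
      · exact (ihp _).1 x hx.1
      · exact (ihq _).1 x hx.2
    · simp only [arrs, List.mem_append, not_or] at hk
      rw [den]
      split
      · exact (ihp _).2 k hk.1
      · exact (ihq _).2 k hk.2
  | loop x y p ih => exact fun s => iterLoop_frame p x y ih s _

/-- The invariant rule for loops. -/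
theorem Cmd.loop_inv {x y : ℕ} {p : Cmd} {s₀ : Store} (Inv : ℕ → Store → Prop) (h0 : Inv 0 s₀)
    (hstep : ∀ i < s₀.reg y, ∀ s, Frame (.loop x y p) s₀ s → Inv i s →
      Inv (i + 1) (p.den (s.setReg x i))) :
    Inv (s₀.reg y) ((Cmd.loop x y p).den s₀) := by
  have : ∀ i ≤ s₀.reg y, Inv i (iterLoop (fun i s => p.den (s.setReg x i)) i s₀) := by
    intro i
    induction i with
    | zero => exact fun _ => h0
    | succ i ih =>
      intro hi
      exact hstep i (by omega) _ (iterLoop_frame p x y p.frame s₀ i) (ih (by omega))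
  exact this _ le_rfl

/-- The bounds of all loops are in the list `ys`, and no register in `ys` is written. -/
def Cmd.boundedBy (ys : List ℕ) : Cmd → Bool
  | assign x _ => !ys.contains x
  | put _ _ _ => true
  | seq p q => p.boundedBy ys && q.boundedBy ys
  | ite _ p q => p.boundedBy ys && q.boundedBy ys
  | .loop x y p => !ys.contains x && ys.contains y && p.boundedBy ys
  | skip => true

/-- A bound on the cost when all loops have at most `N` rounds. -/
def Cmd.bound (N : ℕ) : Cmd → ℕ
  | assign _ e => 1 + e.cost + 1
  | put _ i e => 2 + i.cost + e.cost + 1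
  | seq p q => 1 + p.bound N + q.bound N
  | ite e p q => 1 + e.cost + 1 + (p.bound N + q.bound N)
  | .loop _ _ p => 5 + N * (9 + p.bound N)
  | skip => 1

theorem Cmd.not_mem_regs {ys : List ℕ} {c : Cmd} (h : c.boundedBy ys = true) :
    ∀ y ∈ ys, y ∉ c.regs := by
  induction c with
  | skip => simp [regs]
  | put => simp [regs]
  | assign x e =>
    intro y hy hm
    simp only [regs, List.mem_singleton] at hm
    subst hm
    simp [boundedBy, hy] at h
  | seq p q ihp ihq =>
    simp only [boundedBy, Bool.and_eq_true] at h
    intro y hy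
    simp only [regs, List.mem_append, not_or]
    exact ⟨ihp h.1 y hy, ihq h.2 y hy⟩
  | ite e p q ihp ihq =>
    simp only [boundedBy, Bool.and_eq_true] at h
    intro y hy
    simp only [regs, List.mem_append, not_or]
    exact ⟨ihp h.1 y hy, ihq h.2 y hy⟩
  | loop x z p ih =>
    simp only [boundedBy, Bool.and_eq_true, Bool.not_eq_true', List.contains_eq_mem,
      decide_eq_false_iff_not, decide_eq_true_eq] at h
    intro y hy
    simp only [regs, List.mem_cons, not_or]
    exact ⟨fun e => h.1.1 (e ▸ hy), ih h.2 y hy⟩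

/-- The actual number of rounds is kept here, and `z` need not be among the bounded registers. The
loop over the guesses, which exceeds every polynomial bound, needs this form. -/
theorem Cmd.loop_cost_le {ys : List ℕ} {N x z : ℕ} {p : Cmd} (hx : x ∉ ys)
    (hp : p.boundedBy ys = true)
    (ih : ∀ s : Store, (∀ y ∈ ys, s.reg y ≤ N) → p.cost s ≤ p.bound N) (s : Store)
    (hs : ∀ y ∈ ys, s.reg y ≤ N) : (Cmd.loop x z p).cost s ≤ 5 + s.reg z * (9 + p.bound N) := by
  have key : ∀ n, iterCost (fun i s => p.den (s.setReg x i))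
      (fun i s => 9 + p.cost (s.setReg x i)) n s ≤ n * (9 + p.bound N) := by
    intro n
    induction n with
    | zero => simp [iterCost]
    | succ n ihn =>
      have := ih ((iterLoop (fun i s => p.den (s.setReg x i)) n s).setReg x n)
        fun y hy => by
          have hxy : y ≠ x := fun e => hx (e ▸ hy)
          rw [setReg_reg, if_neg hxy, (iterLoop_frame p x z p.frame s n).1 y
            (by simp [regs, hxy, not_mem_regs hp y hy])]
          exact hs y hy
      simp only [iterCost, Nat.add_mul, Nat.one_mul]
      omega
  exact Nat.add_le_add_left (key _) 5

theorem Cmd.cost_le_bound {ys : List ℕ} {N : ℕ} (c : Cmd) (h : c.boundedBy ys = true) :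
    ∀ s : Store, (∀ y ∈ ys, s.reg y ≤ N) → c.cost s ≤ c.bound N := by
  induction c with
  | skip => exact fun s _ => le_rfl
  | put => exact fun s _ => le_rfl
  | assign x e => exact fun s _ => le_rfl
  | seq p q ihp ihq =>
    simp only [boundedBy, Bool.and_eq_true] at h
    intro s hs
    have h1 := ihp h.1 s hs
    have h2 := ihq h.2 (p.den s) fun y hy => by
      rw [(p.frame s).1 y (not_mem_regs h.1 y hy)]; exact hs y hy
    simp only [cost, bound]
    omega
  | ite e p q ihp ihq =>
    simp only [boundedBy, Bool.and_eq_true] at h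
    intro s hs
    have h1 := ihp h.1 s hs
    have h2 := ihq h.2 s hs
    simp only [cost, bound]
    split <;> omega
  | loop x z p ih =>
    simp only [boundedBy, Bool.and_eq_true, Bool.not_eq_true', List.contains_eq_mem,
      decide_eq_false_iff_not, decide_eq_true_eq] at h
    intro s hs
    exact (loop_cost_le h.1.1 h.2 (ih h.2) s hs).trans
      (Nat.add_le_add_left (Nat.mul_le_mul_right _ (hs z h.1.2)) 5)

/-- Loops raise the degree by one. For sums the exponents are added, which is wasteful but avoids a
case distinction. -/
theorem Cmd.exists_bound_le (c : Cmd) : ∃ A d : ℕ, ∀ N, c.bound N ≤ A * (N + 1) ^ d := by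
  have hadd : ∀ (f g : ℕ → ℕ), (∃ A d : ℕ, ∀ N, f N ≤ A * (N + 1) ^ d) →
      (∃ A d : ℕ, ∀ N, g N ≤ A * (N + 1) ^ d) →
      ∃ A d : ℕ, ∀ N, f N + g N ≤ A * (N + 1) ^ d := by
    rintro f g ⟨A, d, h⟩ ⟨A', d', h'⟩
    refine ⟨A + A', d + d', fun N => ?_⟩
    have h1 : (N + 1) ^ d ≤ (N + 1) ^ (d + d') := Nat.pow_le_pow_right (by omega) (by omega)
    have h2 : (N + 1) ^ d' ≤ (N + 1) ^ (d + d') := Nat.pow_le_pow_right (by omega) (by omega)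
    have h3 := Nat.mul_le_mul_left A h1
    have h4 := Nat.mul_le_mul_left A' h2
    have := h N
    have := h' N
    rw [Nat.add_mul]
    omega
  have hc : ∀ k : ℕ, ∃ A d : ℕ, ∀ N, k ≤ A * (N + 1) ^ d := fun k => ⟨k, 0, by simp⟩
  induction c with
  | skip => exact hc 1
  | put => exact hc _
  | assign => exact hc _
  | seq p q ihp ihq => exact hadd _ _ (hadd _ _ (hc 1) ihp) ihq
  | ite e p q ihp ihq => exact hadd _ _ (hc _) (hadd _ _ ihp ihq)
  | loop x y p ih =>
    refine hadd _ _ (hc 5) ?_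
    obtain ⟨A, d, h⟩ := hadd _ _ (hc 9) ih
    refine ⟨A, d + 1, fun N => ?_⟩
    calc N * (9 + p.bound N) ≤ (N + 1) * (A * (N + 1) ^ d) := Nat.mul_le_mul (by omega) (h N)
      _ = A * (N + 1) ^ (d + 1) := by ring

/-! ### Augmenting matchings -/

/-- `pm` is (the partner function of) a matching of the graph `E` on the vertices below `N`;
unmatched vertices are fixed points. -/
def IsMat (N : ℕ) (E : ℕ → ℕ → Prop) (pm : ℕ → ℕ) : Prop :=
  ∀ u < N, pm u < N ∧ pm (pm u) = u ∧ (pm u ≠ u → E u (pm u))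

/-- Some matching covers the vertex `r` and all vertices that `pm` covers. -/
def Aug (N : ℕ) (E : ℕ → ℕ → Prop) (pm : ℕ → ℕ) (r : ℕ) : Prop :=
  ∃ f, IsMat N E f ∧ f r ≠ r ∧ ∀ u < N, pm u ≠ u → f u ≠ u

/-- The graph `E` has a matching that covers exactly the vertices in `S`, inside `S`. -/
def PM (E : ℕ → ℕ → Prop) (S : Finset ℕ) : Prop :=
  ∃ f : ℕ → ℕ, ∀ x ∈ S, f x ∈ S ∧ f x ≠ x ∧ f (f x) = x ∧ E x (f x)

theorem PM.union {E : ℕ → ℕ → Prop} {S T : Finset ℕ} (hS : PM E S) (hT : PM E T)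
    (h : Disjoint S T) : PM E (S ∪ T) := by
  obtain ⟨f, hf⟩ := hS
  obtain ⟨g, hg⟩ := hT
  refine ⟨fun x => if x ∈ S then f x else g x, fun x hx => ?_⟩
  by_cases hxS : x ∈ S
  · obtain ⟨h1, h2, h3, h4⟩ := hf x hxS
    simp [hxS, h1, h2, h3, h4]
  · have hxT : x ∈ T := (Finset.mem_union.1 hx).resolve_left hxS
    obtain ⟨h1, h2, h3, h4⟩ := hg x hxT
    have : g x ∉ S := fun h' => Finset.disjoint_left.1 h h' h1
    simp [hxS, h1, h2, h3, h4, this]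

theorem PM.pair {E : ℕ → ℕ → Prop} {u v : ℕ} (h : u ≠ v) (h1 : E u v) (h2 : E v u) :
    PM E {u, v} := by
  refine ⟨fun x => if x = u then v else u, fun x hx => ?_⟩
  rcases Finset.mem_insert.1 hx with rfl | hx
  · simp [h1, h.symm]
  · obtain rfl := Finset.mem_singleton.1 hx
    simp [h2, h, h.symm]

/-- A fixed-point-free involution of `S` pairs off the terms of the sum of ones over `S`, which
therefore vanishes modulo 2. -/
theorem PM.even_card {E : ℕ → ℕ → Prop} {S : Finset ℕ} (h : PM E S) : Even S.card := by
  obtain ⟨f, hf⟩ := h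
  have : ∑ x ∈ S, (1 : ZMod 2) = 0 :=
    Finset.sum_involution (fun x _ => f x) (fun _ _ => by decide)
      (fun x hx _ => (hf x hx).2.1) (fun x hx => (hf x hx).1) (fun x hx => (hf x hx).2.2.1)
  rw [Finset.sum_const, nsmul_one] at this
  exact (ZMod.natCast_eq_zero_iff_even).1 this

/-- The outer vertices with base `b`. -/
def blossom (N : ℕ) (lab base : ℕ → ℕ) (b : ℕ) : Finset ℕ :=
  (Finset.range N).filter fun z => lab z = 1 ∧ base z = b

theorem mem_blossom {N : ℕ} {lab base : ℕ → ℕ} {b z : ℕ} :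
    z ∈ blossom N lab base b ↔ z < N ∧ lab z = 1 ∧ base z = b := by
  simp [blossom]

/-- The invariant of the search for an augmenting path from the exposed vertex `r`. Outer vertices
have label `1`, inner vertices label `2`; `base` assigns to an outer vertex the base of its blossom,
`par` to an inner vertex an outer neighbour, its parent, and `dep` to a base its depth. -/
structure Forest (N r : ℕ) (E : ℕ → ℕ → Prop) (pm lab base par dep : ℕ → ℕ) : Prop where
  lab_root : lab r = 1
  base_root : base r = r
  lab_le : ∀ v < N, lab v ≤ 2
  base_lt : ∀ v < N, lab v = 1 → base v < N
  lab_base : ∀ v < N, lab v = 1 → lab (base v) = 1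
  base_base : ∀ v < N, lab v = 1 → base (base v) = base v
  covered : ∀ v < N, lab v ≠ 0 → v ≠ r → pm v ≠ v
  unlabelled : ∀ v < N, lab v = 0 → lab (pm v) = 0
  lab_mate : ∀ v < N, lab v = 1 → base v ≠ v → lab (pm v) = 1
  base_mate : ∀ v < N, lab v = 1 → base v ≠ v → base (pm v) = base v
  inner_mate : ∀ v < N, lab v = 2 → lab (pm v) = 1
  inner_base : ∀ v < N, lab v = 2 → base (pm v) = pm v
  par_lt : ∀ v < N, lab v = 2 → par v < N
  lab_par : ∀ v < N, lab v = 2 → lab (par v) = 1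
  edge_par : ∀ v < N, lab v = 2 → E v (par v)
  dep_par : ∀ v < N, lab v = 2 → dep (base (par v)) < dep (pm v)
  mate_base : ∀ v < N, lab v = 1 → base v = v → v ≠ r → lab (pm v) = 2
  -- Blossoms are factor-critical. This is the only trace that is kept of the alternating paths
  -- inside a blossom.
  critical : ∀ v < N, lab v = 1 → PM E ((blossom N lab base (base v)).erase v)

/-- What remains fixed during the search. -/
structure SearchData (N r : ℕ) (E : ℕ → ℕ → Prop) (pm : ℕ → ℕ) : Prop where
  symm : ∀ u v, E u v → E v u
  irrefl : ∀ u, ¬ E u u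
  mat : IsMat N E pm
  root_lt : r < N
  root : pm r = r

/-! ### Alternating forests: growth, paths to the root, and the parity obstruction. -/

namespace SearchData

variable {N r : ℕ} {E : ℕ → ℕ → Prop} {pm lab base par dep : ℕ → ℕ}

theorem mate_lt (D : SearchData N r E pm) {v : ℕ} (hv : v < N) : pm v < N := (D.mat v hv).1

theorem mate_mate (D : SearchData N r E pm) {v : ℕ} (hv : v < N) : pm (pm v) = v := (D.mat v hv).2.1

theorem edge_mate (D : SearchData N r E pm) {v : ℕ} (hv : v < N) (h : pm v ≠ v) : E v (pm v) :=
  (D.mat v hv).2.2 h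

theorem forest_init (D : SearchData N r E pm) (hl : ∀ v < N, lab v = if v = r then 1 else 0)
    (hb : base r = r) : Forest N r E pm lab base par dep := by
  have h1 : ∀ v < N, lab v = 1 → v = r := by
    intro v hv h
    by_contra hne
    rw [hl v hv, if_neg hne] at h
    omega
  have h2 : ∀ v < N, lab v ≠ 2 := by
    intro v hv h
    rw [hl v hv] at h
    split at h <;> omega
  have hr := hl r D.root_lt
  rw [if_pos rfl] at hr
  have hN := D.root_lt
  constructor
  · exact hr
  · exact hb
  · intro v hv; rw [hl v hv]; split <;> omega
  · intro v hv h; obtain rfl := h1 v hv h; rwa [hb]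
  · intro v hv h; obtain rfl := h1 v hv h; rwa [hb]
  · intro v hv h; obtain rfl := h1 v hv h; rw [hb, hb]
  · intro v hv h hne; rw [hl v hv, if_neg hne] at h; exact absurd rfl h
  · intro v hv h
    have hne : v ≠ r := by rintro rfl; omega
    rw [hl _ (D.mate_lt hv), if_neg]
    intro e
    exact hne (by rw [← D.mate_mate hv, e, D.root])
  · intro v hv h hne; obtain rfl := h1 v hv h; exact absurd hb hne
  · intro v hv h hne; obtain rfl := h1 v hv h; exact absurd hb hne
  · exact fun v hv h => absurd h (h2 v hv)
  · exact fun v hv h => absurd h (h2 v hv)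
  · exact fun v hv h => absurd h (h2 v hv)
  · exact fun v hv h => absurd h (h2 v hv)
  · exact fun v hv h => absurd h (h2 v hv)
  · exact fun v hv h => absurd h (h2 v hv)
  · intro v hv h _ hne; exact absurd (h1 v hv h) hne
  · intro v hv h
    refine ⟨id, fun x hx => ?_⟩
    rw [Finset.mem_erase, mem_blossom] at hx
    exact absurd ((h1 x hx.2.1 hx.2.2.1).trans (h1 v hv h).symm) hx.1

/-- Since `v` and its mate were both unlabelled, no old label, base or parent is touched, and the
old clauses survive. The mate becomes a blossom of one vertex, one level below the blossom of `u`,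
and is trivially critical. -/
theorem forest_grow (D : SearchData N r E pm) (F : Forest N r E pm lab base par dep) {u v : ℕ}
    (hu : u < N) (hv : v < N) (huv : E u v) (hlu : lab u = 1) (hlv : lab v = 0) (hpv : pm v ≠ v) :
    Forest N r E pm (Function.update (Function.update lab v 2) (pm v) 1)
      (Function.update base (pm v) (pm v)) (Function.update par v u)
      (Function.update dep (pm v) (dep (base u) + 1)) := by
  set w := pm v with hw
  have hwN : w < N := D.mate_lt hv
  have hwv : pm w = v := D.mate_mate hv
  have hlw : lab w = 0 := F.unlabelled v hv hlv
  have L : ∀ z, Function.update (Function.update lab v 2) w 1 z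
      = if z = w then 1 else if z = v then 2 else lab z := by
    intro z; simp [Function.update_apply]
  have Bs : ∀ z, Function.update base w w z = if z = w then w else base z := by
    intro z; simp [Function.update_apply]
  have hne : ∀ z, lab z ≠ 0 → z ≠ w ∧ z ≠ v :=
    fun z hz => ⟨fun e => hz (e ▸ hlw), fun e => hz (e ▸ hlv)⟩
  have old : ∀ z, lab z ≠ 0 → Function.update (Function.update lab v 2) w 1 z = lab z := by
    intro z hz; rw [L, if_neg (hne z hz).1, if_neg (hne z hz).2]
  have oldb : ∀ z, lab z ≠ 0 → Function.update base w w z = base z := by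
    intro z hz; rw [Bs, if_neg (hne z hz).1]
  have one : ∀ z, Function.update (Function.update lab v 2) w 1 z = 1 → z = w ∨ lab z = 1 := by
    intro z hz
    rw [L] at hz
    split_ifs at hz with h1 h2
    · exact Or.inl h1
    · omega
    · exact Or.inr hz
  have two : ∀ z, Function.update (Function.update lab v 2) w 1 z = 2 → z = v ∨ lab z = 2 := by
    intro z hz
    rw [L] at hz
    split_ifs at hz with h1 h2
    · omega
    · exact Or.inl h2
    · exact Or.inr hz
  have hLw : Function.update (Function.update lab v 2) w 1 w = 1 := by simp
  have hLv : Function.update (Function.update lab v 2) w 1 v = 2 := by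
    rw [L, if_neg (Ne.symm hpv), if_pos rfl]
  have hBw : Function.update base w w w = w := by simp
  have hrl := F.lab_root
  have hcl : ∀ b, b ≠ w → blossom N (Function.update (Function.update lab v 2) w 1)
      (Function.update base w w) b = blossom N lab base b := by
    intro b hb
    ext z
    rw [mem_blossom, mem_blossom]
    by_cases hz : z = w
    · subst hz
      simp only [hBw, hlw]
      exact ⟨fun h => absurd h.2.2.symm hb, fun h => by omega⟩
    · rw [L, Bs, if_neg hz, if_neg hz]
      by_cases hz' : z = v
      · subst hz'; simp [hlv]
      · rw [if_neg hz']
  constructor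
  · rw [old r (by omega), hrl]
  · rw [oldb r (by omega), F.base_root]
  · intro z hz; rw [L]; split_ifs <;> [omega; omega; exact F.lab_le z hz]
  · intro z hz h
    rcases one z h with rfl | h
    · rwa [hBw]
    · rw [oldb z (by omega)]; exact F.base_lt z hz h
  · intro z hz h
    rcases one z h with rfl | h
    · rw [hBw, hLw]
    · have := F.lab_base z hz h
      rw [oldb z (by omega), old _ (by omega), this]
  · intro z hz h
    rcases one z h with rfl | h
    · rw [hBw, hBw]
    · have := F.lab_base z hz h
      rw [oldb z (by omega), oldb _ (by omega), F.base_base z hz h]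
  · intro z hz h hr
    rw [L] at h
    split_ifs at h with h1 h2
    · subst h1; rw [hwv]; exact Ne.symm hpv
    · subst h2; exact hpv
    · exact F.covered z hz h hr
  · intro z hz h
    rw [L] at h
    split_ifs at h with h1 h2
    have h3 := F.unlabelled z hz h
    rw [L, if_neg, if_neg, h3]
    · intro e; exact h1 (by rw [hw, ← e, D.mate_mate hz])
    · intro e; exact h2 (by rw [← hwv, ← e, D.mate_mate hz])
  · intro z hz h hb
    rcases one z h with rfl | h
    · exact absurd hBw hb
    · rw [oldb z (by omega)] at hb
      have := F.lab_mate z hz h hb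
      rw [old _ (by omega), this]
  · intro z hz h hb
    rcases one z h with rfl | h
    · exact absurd hBw hb
    · rw [oldb z (by omega)] at hb ⊢
      have := F.lab_mate z hz h hb
      rw [oldb _ (by omega), F.base_mate z hz h hb]
  · intro z hz h
    rcases two z h with rfl | h
    · exact hLw
    · have := F.inner_mate z hz h
      rw [old _ (by omega), this]
  · intro z hz h
    rcases two z h with rfl | h
    · exact hBw
    · have := F.inner_mate z hz h
      rw [oldb _ (by omega), F.inner_base z hz h]
  · intro z hz h
    rcases two z h with rfl | h
    · simpa using hu
    · rw [Function.update_of_ne (hne z (by omega)).2]; exact F.par_lt z hz h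
  · intro z hz h
    rcases two z h with rfl | h
    · rw [Function.update_self, old u (by omega), hlu]
    · rw [Function.update_of_ne (hne z (by omega)).2]
      have := F.lab_par z hz h
      rw [old _ (by omega), this]
  · intro z hz h
    rcases two z h with rfl | h
    · rw [Function.update_self]; exact D.symm _ _ huv
    · rw [Function.update_of_ne (hne z (by omega)).2]; exact F.edge_par z hz h
  · intro z hz h
    rcases two z h with rfl | h
    · have h1 := F.lab_base u hu hlu
      rw [Function.update_self, oldb u (by omega), Function.update_self,
        Function.update_of_ne (hne _ (by omega)).1]
      omega
    · have h1 := F.lab_par z hz h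
      have h2 := F.lab_base _ (F.par_lt z hz h) h1
      have h3 := F.inner_mate z hz h
      rw [Function.update_of_ne (hne z (by omega)).2, oldb _ (by omega),
        Function.update_of_ne (hne _ (by omega)).1, Function.update_of_ne (hne _ (by omega)).1]
      exact F.dep_par z hz h
  · intro z hz h hb hr
    rcases one z h with rfl | h
    · rw [hwv, hLv]
    · rw [oldb z (by omega)] at hb
      have := F.mate_base z hz h hb hr
      rw [old _ (by omega), this]
  · intro z hz h
    rcases one z h with rfl | h
    · refine ⟨id, fun x hx => ?_⟩
      rw [Finset.mem_erase, mem_blossom, hBw] at hx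
      exfalso
      rcases one x hx.2.2.1 with e | e
      · exact hx.1 e
      · have := F.lab_base x hx.2.1 e
        rw [oldb x (by omega)] at hx
        rw [hx.2.2.2] at this
        omega
    · have h1 := F.lab_base z hz h
      rw [oldb z (by omega), hcl _ (hne _ (by omega)).1]
      exact F.critical z hz h

/-- The tree path from `u` to the root, with the blossoms it passes through. -/
theorem exists_path (D : SearchData N r E pm) (F : Forest N r E pm lab base par dep) :
    ∀ (k u : ℕ), u < N → lab u = 1 → dep (base u) = k → ∃ K : Finset ℕ, (∀ z ∈ K, z < N) ∧
      u ∈ K ∧ r ∈ K ∧ PM E (K.erase u) ∧ (∀ z ∈ K, z ≠ r → pm z ∈ K) ∧ (∀ z ∈ K, lab z ≠ 0) ∧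
      (∀ z ∈ K, lab z = 1 → dep (base z) ≤ k) ∧ ∀ z ∈ K, lab z = 2 → dep (pm z) ≤ k := by
  intro k
  induction k using Nat.strong_induction_on with
  | _ k ih =>
  intro u hu hlu hk
  set y := base u with hy
  have hyN : y < N := F.base_lt u hu hlu
  have hly : lab y = 1 := F.lab_base u hu hlu
  have hby : base y = y := F.base_base u hu hlu
  -- If the blossom of `u` contains the root, it is all of `K`. Otherwise the path leaves it through
  -- the base `y`, goes to the inner mate `t` of `y` and on to the parent `p` of `t`, whose blossom
  -- is less deep.
  by_cases hyr : y = r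
  · refine ⟨blossom N lab base y, fun z hz => (mem_blossom.1 hz).1, mem_blossom.2 ⟨hu, hlu, rfl⟩,
      mem_blossom.2 ⟨D.root_lt, F.lab_root, by rw [F.base_root, hyr]⟩, F.critical u hu hlu,
      fun z hz hr => ?_, fun z hz => ?_, fun z hz _ => ?_, fun z hz h => ?_⟩
    all_goals obtain ⟨h1, h2, h3⟩ := mem_blossom.1 hz
    · have hb : base z ≠ z := by rw [h3, hyr]; exact Ne.symm hr
      exact mem_blossom.2 ⟨D.mate_lt h1, F.lab_mate z h1 h2 hb, (F.base_mate z h1 h2 hb).trans h3⟩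
    · omega
    · rw [h3, hk]
    · omega
  · set t := pm y with ht
    have htN : t < N := D.mate_lt hyN
    have hlt : lab t = 2 := F.mate_base y hyN hly hby hyr
    have hpt : pm t = y := D.mate_mate hyN
    set p := par t with hp
    have hd := F.dep_par t htN hlt
    rw [hpt, ← hp] at hd
    have hpN := F.par_lt t htN hlt
    have hlp := F.lab_par t htN hlt
    obtain ⟨K, hKN, hpK, hrK, hPM, hcl, hl, hd1, hd2⟩ := ih (dep (base p)) (by omega) p hpN hlp rfl
    -- The depth bounds in the conclusion exist for this purpose: they keep `t` and the blossom of
    -- `y` disjoint from the path that the induction supplies.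
    have htK : t ∉ K := fun h => by have := hd2 t h hlt; rw [hpt] at this; omega
    have hyK : ∀ z ∈ blossom N lab base y, z ∉ K := fun z hz h => by
      obtain ⟨h1, h2, h3⟩ := mem_blossom.1 hz
      have := hd1 z h h2
      rw [h3] at this
      omega
    have htB : t ∉ blossom N lab base y := fun h => by
      have := (mem_blossom.1 h).2.1
      omega
    have huB : u ∈ blossom N lab base y := mem_blossom.2 ⟨hu, hlu, rfl⟩
    have hE := F.edge_par t htN hlt
    rw [← hp] at hE
    have hpt' : p ≠ t := fun e => htK (e ▸ hpK)
    refine ⟨K ∪ {t} ∪ blossom N lab base y, ?_, ?_, ?_, ?_, ?_, ?_, ?_, ?_⟩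
    · intro z hz
      simp only [Finset.mem_union, Finset.mem_singleton] at hz
      rcases hz with (hz | rfl) | hz
      · exact hKN z hz
      · exact htN
      · exact (mem_blossom.1 hz).1
    · exact Finset.mem_union_right _ huB
    · simp [hrK]
    -- The new perfect matching combines that of the old path without `p`, the edge `{p, t}`, and
    -- the critical matching of the blossom without `u`.
    · have e : (K ∪ {t} ∪ blossom N lab base y).erase u
          = (K.erase p ∪ {p, t}) ∪ (blossom N lab base y).erase u := by
        ext z
        have h1 := hyK u huB
        have h2 : t ≠ u := fun e => htB (e ▸ huB)
        simp only [Finset.mem_erase, Finset.mem_union, Finset.mem_singleton, Finset.mem_insert]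
        by_cases hzp : z = p
        · subst hzp; have : p ≠ u := fun e => h1 (e ▸ hpK)
          simp [hpK, this]
        · by_cases hzt : z = t
          · subst hzt; simp [h2]
          · by_cases hzu : z = u
            · subst hzu; simp [h1, hzp, hzt]
            · simp [hzp, hzt, hzu]
      rw [e]
      refine (hPM.union (PM.pair hpt' (D.symm _ _ hE) hE) ?_).union (F.critical u hu hlu) ?_
      · rw [Finset.disjoint_left]
        intro z hz
        rw [Finset.mem_erase] at hz
        simp only [Finset.mem_insert, Finset.mem_singleton, not_or]
        exact ⟨hz.1, fun e => htK (e ▸ hz.2)⟩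
      · rw [Finset.disjoint_right]
        intro z hz
        have hz := Finset.mem_of_mem_erase hz
        simp only [Finset.mem_union, Finset.mem_insert, Finset.mem_singleton, not_or,
          Finset.mem_erase]
        exact ⟨fun h => hyK z hz h.2, fun e => hyK z hz (e ▸ hpK), fun e => htB (e ▸ hz)⟩
    · intro z hz hr
      simp only [Finset.mem_union, Finset.mem_singleton] at hz ⊢
      rcases hz with (hz | rfl) | hz
      · exact Or.inl (Or.inl (hcl z hz hr))
      · rw [hpt]; exact Or.inr (mem_blossom.2 ⟨hyN, hly, hby⟩)
      · obtain ⟨h1, h2, h3⟩ := mem_blossom.1 hz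
        by_cases hzy : z = y
        · subst hzy; exact Or.inl (Or.inr ht.symm)
        · have hb : base z ≠ z := by rw [h3]; exact Ne.symm hzy
          exact Or.inr (mem_blossom.2
            ⟨D.mate_lt h1, F.lab_mate z h1 h2 hb, (F.base_mate z h1 h2 hb).trans h3⟩)
    · intro z hz
      simp only [Finset.mem_union, Finset.mem_singleton] at hz
      rcases hz with (hz | rfl) | hz
      · exact hl z hz
      · omega
      · have := (mem_blossom.1 hz).2.1; omega
    · intro z hz h
      simp only [Finset.mem_union, Finset.mem_singleton] at hz
      rcases hz with (hz | rfl) | hz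
      · have := hd1 z hz h; omega
      · omega
      · rw [(mem_blossom.1 hz).2.2, hk]
    · intro z hz h
      simp only [Finset.mem_union, Finset.mem_singleton] at hz
      rcases hz with (hz | rfl) | hz
      · have := hd2 z hz h; omega
      · rw [hpt, hk]
      · have := (mem_blossom.1 hz).2.1; omega

/-- Flip the path from `u` to the root: its vertices other than `u` are matched among themselves,
`u` is matched with `v`, and all others keep their mates. The last point is consistent because the
path is closed under `pm` except at the exposed root. -/
theorem aug_of_exposed (D : SearchData N r E pm) (F : Forest N r E pm lab base par dep) {u v : ℕ}
    (hu : u < N) (hv : v < N) (huv : E u v) (hlu : lab u = 1) (hlv : lab v = 0) (hpv : pm v = v) :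
    Aug N E pm r := by
  obtain ⟨K, hKN, huK, hrK, ⟨g, hg⟩, hcl, hl, -, -⟩ := D.exists_path F _ u hu hlu rfl
  have hvK : v ∉ K := fun h => hl v h hlv
  have hne : u ≠ v := fun e => hvK (e ▸ huK)
  set f : ℕ → ℕ := fun x => if x ∈ K.erase u then g x else if x = u then v else
    if x = v then u else pm x with hf
  have f1 : ∀ x ∈ K.erase u, f x = g x := fun x hx => by simp only [hf, if_pos hx]
  have f2 : f u = v := by simp [hf]
  have f3 : f v = u := by simp [hf, hvK, hne.symm]
  have f4 : ∀ x, x ∉ K → x ≠ v → f x = pm x := fun x h1 h2 => by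
    have : x ≠ u := fun e => h1 (e ▸ huK)
    simp [hf, h1, h2, this]
  have cases : ∀ x, x ∈ K.erase u ∨ x = u ∨ x = v ∨ (x ∉ K ∧ x ≠ v) := by
    intro x
    by_cases h1 : x = u
    · exact Or.inr (Or.inl h1)
    · by_cases h2 : x = v
      · exact Or.inr (Or.inr (Or.inl h2))
      · by_cases h3 : x ∈ K
        · exact Or.inl (Finset.mem_erase.2 ⟨h1, h3⟩)
        · exact Or.inr (Or.inr (Or.inr ⟨h3, h2⟩))
  have hm : ∀ x ∈ K, f x ≠ x := by
    intro x hx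
    by_cases h1 : x = u
    · rw [h1, f2]; exact hne.symm
    · have h : x ∈ K.erase u := Finset.mem_erase.2 ⟨h1, hx⟩
      rw [f1 x h]; exact (hg x h).2.1
  refine ⟨f, fun x hx => ?_, hm r hrK, fun x hx h => ?_⟩
  · rcases cases x with h | rfl | rfl | ⟨h1, h2⟩
    · obtain ⟨a, b, c, d⟩ := hg x h
      rw [f1 x h, f1 _ a]
      exact ⟨hKN _ (Finset.mem_of_mem_erase a), c, fun _ => d⟩
    · rw [f2, f3]; exact ⟨hv, rfl, fun _ => huv⟩
    · rw [f3, f2]; exact ⟨hu, rfl, fun _ => D.symm _ _ huv⟩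
    · have h3 : pm x ∉ K := by
        intro h
        by_cases e : pm x = r
        · have := D.mate_mate hx
          rw [e, D.root] at this
          exact h1 (this ▸ hrK)
        · exact h1 (D.mate_mate hx ▸ hcl _ h e)
      have h4 : pm x ≠ v := by
        intro e
        exact h2 (by rw [← D.mate_mate hx, e, hpv])
      rw [f4 x h1 h2, f4 _ h3 h4]
      exact D.mat x hx
  · by_cases h1 : x ∈ K
    · exact hm x h1
    · have : x ≠ v := fun e => h (by rw [e, hpv])
      rwa [f4 x h1 this]

/-- A matching `f` as in `Aug` covers all outer vertices. Every blossom is odd, so `f` sends one of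
its vertices out of it, and by closure into an inner vertex. But inner vertices are mates of bases
other than `r`, so there are fewer of them than blossoms. -/
theorem not_aug (D : SearchData N r E pm) (F : Forest N r E pm lab base par dep)
    (hcl : ∀ u < N, ∀ v < N, E u v → lab u = 1 → lab v = 2 ∨ (lab v = 1 ∧ base u = base v)) :
    ¬ Aug N E pm r := by
  rintro ⟨f, hf, hfr, hcov⟩
  have hout : ∀ u < N, lab u = 1 → f u ≠ u := by
    intro u hu hl
    by_cases e : u = r
    · rwa [e]
    · exact hcov u hu (F.covered u hu (by omega) e)
  set bases := (Finset.range N).filter fun b => lab b = 1 ∧ base b = b with hbases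
  have key : ∀ b ∈ bases, ∃ z < N, lab z = 1 ∧ base z = b ∧ lab (f z) = 2 := by
    intro b hb
    simp only [hbases, Finset.mem_filter, Finset.mem_range] at hb
    obtain ⟨hbN, hlb, hbb⟩ := hb
    have hbB : b ∈ blossom N lab base b := mem_blossom.2 ⟨hbN, hlb, hbb⟩
    by_contra hno
    push Not at hno
    -- If no vertex of the blossom were matched to an inner vertex, `f` would map the blossom to
    -- itself and its size would be even, while criticality makes it odd.
    have hpm : PM E (blossom N lab base b) := by
      refine ⟨f, fun z hz => ?_⟩
      obtain ⟨h1, h2, h3⟩ := mem_blossom.1 hz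
      have hfz := hout z h1 h2
      obtain ⟨a, c, d⟩ := hf z h1
      rcases hcl z h1 (f z) a (d hfz) h2 with h | ⟨h, h'⟩
      · exact absurd h (hno z h1 h2 h3)
      · exact ⟨mem_blossom.2 ⟨a, h, h' ▸ h3⟩, hfz, c, d hfz⟩
    have h1 := hpm.even_card
    have h2 := (F.critical b hbN hlb).even_card
    rw [hbb, Finset.card_erase_of_mem hbB] at h2
    have h3 := Finset.card_pos.2 ⟨b, hbB⟩
    rw [Nat.even_iff] at h1 h2
    omega
  choose! z hzN hlz hbz hfz using key
  have hrb : r ∈ bases := by simp [hbases, D.root_lt, F.lab_root, F.base_root]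
  -- Follow a blossom to the inner vertex chosen for it and on to the mate of that vertex. This is
  -- again a base, but not `r`, which is its own mate. All maps involved are injective.
  have hle : bases.card ≤ (bases.erase r).card := by
    refine Finset.card_le_card_of_injOn (fun b => pm (f (z b))) (fun b hb => ?_)
      (fun b hb b' hb' e => ?_)
    · have h1 := hzN b hb
      have h2 := (hf _ h1).1
      have h3 := hfz b hb
      have h4 := F.inner_mate _ h2 h3
      simp only [Finset.mem_coe, Finset.mem_erase, hbases, Finset.mem_filter, Finset.mem_range]
      refine ⟨fun e => ?_, D.mate_lt h2, h4, F.inner_base _ h2 h3⟩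
      have h5 := D.mate_mate h2
      rw [e, D.root] at h5
      rw [← h5, F.lab_root] at h3
      omega
    · have h1 := hzN b hb
      have h2 := hzN b' hb'
      have e1 : f (z b) = f (z b') := by
        rw [← D.mate_mate (hf _ h1).1, ← D.mate_mate (hf _ h2).1]
        exact congrArg pm e
      have e2 : z b = z b' := by rw [← (hf _ h1).2.1, ← (hf _ h2).2.1, e1]
      rw [← hbz b hb, ← hbz b' hb', e2]
  rw [Finset.card_erase_of_mem hrb] at hle
  have := Finset.card_pos.2 ⟨r, hrb⟩
  omega

end SearchData

/-! ### Contraction of blossoms by a walk of two bases towards the root. -/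

/-- The vertices in the marked blossoms, and the mates of the marked bases. -/
def swallowed (N : ℕ) (pm lab base mark : ℕ → ℕ) : Finset ℕ :=
  (Finset.range N).filter fun z => (lab z = 1 ∧ mark (base z) ≠ 0) ∨ (lab z = 2 ∧ mark (pm z) ≠ 0)

theorem mem_swallowed {N : ℕ} {pm lab base mark : ℕ → ℕ} {z : ℕ} :
    z ∈ swallowed N pm lab base mark ↔
      z < N ∧ ((lab z = 1 ∧ mark (base z) ≠ 0) ∨ (lab z = 2 ∧ mark (pm z) ≠ 0)) := by
  simp [swallowed]

/-- The invariant of the walk from two adjacent blossoms with bases `x` and `y` towards the root,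
which marks the bases that it leaves behind. -/
structure Walk (N r : ℕ) (E : ℕ → ℕ → Prop) (pm lab base dep mark : ℕ → ℕ) (x y : ℕ) : Prop where
  fst_lt : x < N
  lab_fst : lab x = 1
  base_fst : base x = x
  snd_lt : y < N
  lab_snd : lab y = 1
  base_snd : base y = y
  lab_mark : ∀ m < N, mark m ≠ 0 → lab m = 1
  base_mark : ∀ m < N, mark m ≠ 0 → base m = m
  mark_root : mark r = 0
  dep_fst : ∀ m < N, mark m ≠ 0 → dep x ≤ dep m
  dep_snd : ∀ m < N, mark m ≠ 0 → dep y ≤ dep m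
  mark_fst : mark x = 0
  mark_snd : mark y = 0
  -- The vertices `u` and `v` lie in the two current blossoms and end the alternating path through
  -- the swallowed part. Whichever swallowed vertex `z` is left out, one of the two ends can be
  -- matched in its stead.
  ends : ∃ u v, (u < N ∧ lab u = 1 ∧ base u = x) ∧ (v < N ∧ lab v = 1 ∧ base v = y) ∧
    (x ≠ y → PM E (swallowed N pm lab base mark ∪ {u, v})) ∧ ∀ z ∈ swallowed N pm lab base mark,
      PM E ((swallowed N pm lab base mark ∪ {u}).erase z) ∨
      PM E ((swallowed N pm lab base mark ∪ {v}).erase z)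

theorem Walk.swap {N r : ℕ} {E : ℕ → ℕ → Prop} {pm lab base dep mark : ℕ → ℕ} {x y : ℕ}
    (w : Walk N r E pm lab base dep mark x y) : Walk N r E pm lab base dep mark y x := by
  obtain ⟨u, v, hu, hv, h1, h2⟩ := w.ends
  exact ⟨w.snd_lt, w.lab_snd, w.base_snd, w.fst_lt, w.lab_fst, w.base_fst, w.lab_mark,
    w.base_mark, w.mark_root, w.dep_snd, w.dep_fst, w.mark_snd, w.mark_fst,
    v, u, hv, hu, fun h => by rw [Finset.pair_comm]; exact h1 h.symm, fun z hz => (h2 z hz).symm⟩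

namespace SearchData

variable {N r : ℕ} {E : ℕ → ℕ → Prop} {pm lab base par dep mark : ℕ → ℕ}

theorem walk_init (D : SearchData N r E pm) (F : Forest N r E pm lab base par dep) {u v : ℕ}
    (hu : u < N) (hv : v < N) (huv : E u v) (hlu : lab u = 1) (hlv : lab v = 1)
    (hm : ∀ m < N, mark m = 0) : Walk N r E pm lab base dep mark (base u) (base v) := by
  have he : swallowed N pm lab base mark = ∅ := by
    ext z
    simp only [mem_swallowed, Finset.notMem_empty, iff_false, not_and]
    rintro hz (⟨h1, h2⟩ | ⟨_, h2⟩)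
    · exact h2 (hm _ (F.base_lt z hz h1))
    · exact h2 (hm _ (D.mate_lt hz))
  refine ⟨F.base_lt u hu hlu, F.lab_base u hu hlu, F.base_base u hu hlu, F.base_lt v hv hlv,
    F.lab_base v hv hlv, F.base_base v hv hlv, fun m hN h => absurd (hm m hN) h,
    fun m hN h => absurd (hm m hN) h, hm r D.root_lt, fun m hN h => absurd (hm m hN) h,
    fun m hN h => absurd (hm m hN) h, hm _ (F.base_lt u hu hlu), hm _ (F.base_lt v hv hlv),
    u, v, ⟨hu, hlu, rfl⟩, ⟨hv, hlv, rfl⟩, ?_, ?_⟩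
  · intro _
    rw [he, Finset.empty_union]
    exact PM.pair (fun e => D.irrefl u (e ▸ huv)) huv (D.symm _ _ huv)
  · simp [he]

/-- Since the root is never marked, every marked base has an inner mate, and that mate is swallowed
with it. Hence `pm` itself is a perfect matching of the swallowed part, and it also preserves the
complement. -/
theorem mate_mem_swallowed (D : SearchData N r E pm) (F : Forest N r E pm lab base par dep)
    {x y : ℕ} (w : Walk N r E pm lab base dep mark x y) {z : ℕ}
    (hz : z ∈ swallowed N pm lab base mark) : pm z ∈ swallowed N pm lab base mark := by
  rw [mem_swallowed] at hz ⊢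
  obtain ⟨hzN, h⟩ := hz
  refine ⟨D.mate_lt hzN, ?_⟩
  rcases h with ⟨h1, h2⟩ | ⟨h1, h2⟩
  · by_cases hb : base z = z
    · rw [hb] at h2
      have hr : z ≠ r := fun e => h2 (e ▸ w.mark_root)
      exact Or.inr ⟨F.mate_base z hzN h1 hb hr, by rwa [D.mate_mate hzN]⟩
    · exact Or.inl ⟨F.lab_mate z hzN h1 hb, by rwa [F.base_mate z hzN h1 hb]⟩
  · exact Or.inl ⟨F.inner_mate z hzN h1, by rwa [F.inner_base z hzN h1]⟩

theorem _root_.MultilayerMatching.Walk.mate_ne {x y : ℕ} (w : Walk N r E pm lab base dep mark x y)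
    (F : Forest N r E pm lab base par dep) {z : ℕ}
    (hz : z ∈ swallowed N pm lab base mark) : pm z ≠ z := by
  rw [mem_swallowed] at hz
  refine F.covered z hz.1 (by omega) ?_
  rintro rfl
  rcases hz.2 with ⟨_, h⟩ | ⟨h, _⟩
  · rw [F.base_root] at h; exact h w.mark_root
  · rw [F.lab_root] at h; omega

theorem swallowed_pm (D : SearchData N r E pm) (F : Forest N r E pm lab base par dep)
    {x y : ℕ} (w : Walk N r E pm lab base dep mark x y) :
    PM E (swallowed N pm lab base mark) := by
  refine ⟨pm, fun z hz => ?_⟩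
  have hzN := (mem_swallowed.1 hz).1
  have := w.mate_ne F hz
  exact ⟨D.mate_mem_swallowed F w hz, this, D.mate_mate hzN, D.edge_mate hzN this⟩

theorem not_mem_swallowed {z : ℕ} (hl : lab z = 1)
    (hm : mark (base z) = 0) : z ∉ swallowed N pm lab base mark := by
  rw [mem_swallowed]
  rintro ⟨_, ⟨_, h⟩ | ⟨h, _⟩⟩
  · exact h hm
  · omega

/-- Of two distinct bases, one that is at least as deep as the other is therefore not the root and
can be moved. -/
theorem dep_root_lt (D : SearchData N r E pm) (F : Forest N r E pm lab base par dep) :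
    ∀ b < N, lab b = 1 → base b = b → b ≠ r → dep r < dep b := by
  have key : ∀ k, ∀ b < N, lab b = 1 → base b = b → b ≠ r → dep b = k → dep r < k := by
    intro k
    induction k using Nat.strong_induction_on with
    | _ k ih =>
    intro b hb hl hbb hr hk
    have h1 := F.mate_base b hb hl hbb hr
    have h2 := F.dep_par _ (D.mate_lt hb) h1
    have h3 := F.par_lt _ (D.mate_lt hb) h1
    have h4 := F.lab_par _ (D.mate_lt hb) h1
    rw [D.mate_mate hb] at h2
    by_cases e : base (par (pm b)) = r
    · rw [e] at h2; omega
    · have := ih _ (by omega) _ (F.base_lt _ h3 h4) (F.lab_base _ h3 h4) (F.base_base _ h3 h4) e rfl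
      omega
  exact fun b hb hl hbb hr => key _ b hb hl hbb hr rfl

set_option maxHeartbeats 2000000 in
/-- One step of the walk, on the side of `y`. -/
theorem walk_step (D : SearchData N r E pm) (F : Forest N r E pm lab base par dep)
    {x y : ℕ} (w : Walk N r E pm lab base dep mark x y) (hxy : x ≠ y) (hd : dep x ≤ dep y) :
    Walk N r E pm lab base dep (Function.update mark y 1) x (base (par (pm y))) ∧ mark y = 0 ∧
      y ≠ r := by
  -- If `y` were the root, the distinct base `x` would be strictly deeper, against `hd`.
  have hyr : y ≠ r := by
    rintro rfl
    have := D.dep_root_lt F x w.fst_lt w.lab_fst w.base_fst hxy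
    omega
  refine ⟨?_, w.mark_snd, hyr⟩
  have hyN := w.snd_lt
  have hly := w.lab_snd
  have hby := w.base_snd
  set t := pm y with ht
  have htN : t < N := D.mate_lt hyN
  have hlt : lab t = 2 := F.mate_base y hyN hly hby hyr
  have hpt : pm t = y := D.mate_mate hyN
  have hty : t ≠ y := fun e => by rw [e] at hlt; omega
  set p := par t with hp
  have hdp := F.dep_par t htN hlt
  rw [hpt, ← hp] at hdp
  have hpN := F.par_lt t htN hlt
  have hlp := F.lab_par t htN hlt
  have hE := F.edge_par t htN hlt
  rw [← hp] at hE
  set mark' := Function.update mark y 1 with hmark'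
  have hm' : ∀ m, mark' m = if m = y then 1 else mark m := by
    intro m; simp [hmark', Function.update_apply]
  have hcase : ∀ m, mark' m ≠ 0 → m = y ∨ mark m ≠ 0 := by
    intro m h
    rw [hm'] at h
    split_ifs at h with h1
    · exact Or.inl h1
    · exact Or.inr h
  have hpy : base p ≠ y := fun e => by rw [e] at hdp; omega
  -- Marked bases are at least as deep as `y`, whereas the base of `p` is strictly less deep. So the
  -- walk has not been there before.
  have hmp : mark (base p) = 0 := by
    by_contra h
    have := w.dep_snd _ (F.base_lt p hpN hlp) h
    omega
  set K := swallowed N pm lab base mark with hK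
  set B := blossom N lab base y with hB
  have hyB : y ∈ B := mem_blossom.2 ⟨hyN, hly, hby⟩
  have hK' : swallowed N pm lab base mark' = K ∪ {t} ∪ B := by
    ext z
    simp only [Finset.mem_union, Finset.mem_singleton, hK, hB, mem_swallowed, mem_blossom, hm']
    constructor
    · rintro ⟨hz, ⟨h1, h2⟩ | ⟨h1, h2⟩⟩
      · by_cases e : base z = y
        · exact Or.inr ⟨hz, h1, e⟩
        · rw [if_neg e] at h2; exact Or.inl (Or.inl ⟨hz, Or.inl ⟨h1, h2⟩⟩)
      · by_cases e : pm z = y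
        · exact Or.inl (Or.inr (by rw [ht, ← e, D.mate_mate hz]))
        · rw [if_neg e] at h2; exact Or.inl (Or.inl ⟨hz, Or.inr ⟨h1, h2⟩⟩)
    · rintro ((⟨hz, ⟨h1, h2⟩ | ⟨h1, h2⟩⟩ | rfl) | ⟨h1, h2, h3⟩)
      · refine ⟨hz, Or.inl ⟨h1, ?_⟩⟩
        split_ifs <;> omega
      · refine ⟨hz, Or.inr ⟨h1, ?_⟩⟩
        split_ifs <;> omega
      · exact ⟨htN, Or.inr ⟨hlt, by rw [if_pos hpt]; omega⟩⟩
      · exact ⟨h1, Or.inl ⟨h2, by rw [if_pos h3]; omega⟩⟩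
  have htK : t ∉ K := by
    rw [hK, mem_swallowed]
    rintro ⟨_, ⟨h, _⟩ | ⟨_, h⟩⟩
    · omega
    · rw [hpt] at h; exact h w.mark_snd
  have htB : t ∉ B := fun h => by have := (mem_blossom.1 h).2.1; omega
  have hBK : ∀ z ∈ B, z ∉ K := fun z hz => by
    obtain ⟨_, h2, h3⟩ := mem_blossom.1 hz
    exact not_mem_swallowed h2 (by rw [h3]; exact w.mark_snd)
  obtain ⟨u, v, ⟨huN, hlu, hbu⟩, ⟨hvN, hlv, hbv⟩, hPM, hcr⟩ := w.ends
  have hvB : v ∈ B := mem_blossom.2 ⟨hvN, hlv, hbv⟩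
  have huB : u ∉ B := fun h => hxy (hbu.symm.trans (mem_blossom.1 h).2.2)
  have huK : u ∉ K := not_mem_swallowed hlu (by rw [hbu]; exact w.mark_fst)
  have hut : u ≠ t := fun e => by rw [e] at hlu; omega
  have htv : t ≠ v := fun e => htB (e ▸ hvB)
  have hpB : p ∉ B := fun h => hpy (mem_blossom.1 h).2.2
  have hpK : p ∉ K := not_mem_swallowed hlp hmp
  have hpt' : p ≠ t := fun e => by rw [← hp, e] at hlp; omega
  have hKPM : PM E K := D.swallowed_pm F w
  have hcrB : ∀ z ∈ B, PM E (B.erase z) := fun z hz => by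
    obtain ⟨h1, h2, h3⟩ := mem_blossom.1 hz
    have := F.critical z h1 h2
    rwa [h3] at this
  have hpair : PM E {t, p} := PM.pair hpt'.symm hE (D.symm _ _ hE)
  have hside : ∀ z ∈ B, PM E ({t, p} ∪ B.erase z) := fun z hz => by
    refine hpair.union (hcrB z hz) ?_
    rw [Finset.disjoint_right]
    intro a ha
    have ha := Finset.mem_of_mem_erase ha
    simp only [Finset.mem_insert, Finset.mem_singleton, not_or]
    exact ⟨fun e => htB (e ▸ ha), fun e => hpB (e ▸ ha)⟩
  have hpairy : PM E {t, y} := PM.pair hty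
    (by have := D.edge_mate htN (by rw [hpt]; exact hty.symm); rwa [hpt] at this)
    (D.edge_mate hyN hty)
  refine ⟨w.fst_lt, w.lab_fst, w.base_fst, F.base_lt p hpN hlp, F.lab_base p hpN hlp,
    F.base_base p hpN hlp, ?_, ?_, ?_, ?_, ?_, ?_, ?_, ?_⟩
  · intro m hN h
    rcases hcase m h with rfl | h
    · exact hly
    · exact w.lab_mark m hN h
  · intro m hN h
    rcases hcase m h with rfl | h
    · exact hby
    · exact w.base_mark m hN h
  · rw [hm', if_neg (Ne.symm hyr), w.mark_root]
  · intro m hN h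
    rcases hcase m h with rfl | h
    · exact hd
    · exact w.dep_fst m hN h
  · intro m hN h
    rcases hcase m h with rfl | h
    · omega
    · have := w.dep_snd m hN h; omega
  · rw [hm', if_neg hxy, w.mark_fst]
  · rw [hm', if_neg hpy, hmp]
  refine ⟨u, p, ⟨huN, hlu, hbu⟩, ⟨hpN, hlp, rfl⟩, ?_, ?_⟩
  · intro hxp
    have hup : u ≠ p := fun e => hxp (by rw [← e, hbu])
    rw [hK']
    -- The end on this side moves from `v` to `p`. The old path keeps its matching, `v` is removed
    -- from its blossom `B` by criticality, and the edge `{t, p}` leads out.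
    have e : K ∪ {t} ∪ B ∪ {u, p} = (K ∪ {u, v}) ∪ ({t, p} ∪ B.erase v) := by
      ext z
      simp only [Finset.mem_union, Finset.mem_singleton, Finset.mem_insert, Finset.mem_erase]
      by_cases hzv : z = v
      · subst hzv; simp [hvB]
      · simp only [hzv]; tauto
    rw [e]
    refine (hPM hxy).union (hside v hvB) ?_
    rw [Finset.disjoint_left]
    intro z hz
    simp only [Finset.mem_union, Finset.mem_insert, Finset.mem_singleton, not_or,
      Finset.mem_erase, not_and] at hz ⊢
    rcases hz with hz | rfl | rfl
    · exact ⟨⟨fun e => htK (e ▸ hz), fun e => hpK (e ▸ hz)⟩, fun _ h => hBK z h hz⟩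
    · exact ⟨⟨hut, hup⟩, fun _ => huB⟩
    · exact ⟨⟨fun e => htB (e ▸ hvB), fun e => hpB (e ▸ hvB)⟩, fun h _ => h rfl⟩
  · intro z hz
    rw [hK'] at hz ⊢
    simp only [Finset.mem_union, Finset.mem_singleton] at hz
    rcases hz with (hz | rfl) | hz
    · have hzt : z ≠ t := fun e => htK (e ▸ hz)
      have hzB : z ∉ B := fun h => hBK z h hz
      have hzu : z ≠ u := fun e => huK (e ▸ hz)
      have hzp : z ≠ p := fun e => hpK (e ▸ hz)
      have hzv : z ≠ v := fun e => hzB (e ▸ hvB)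
      have hzy : z ≠ y := fun e => hzB (e ▸ hyB)
      -- For a vertex `z` swallowed earlier, the old alternative is continued. If `u` replaced `z`,
      -- the new vertices are matched among themselves by `{t, y}` and `B` without `y`. If `v`
      -- replaced it, then `p` takes over through `{t, p}` and `B` without `v`.
      rcases hcr z hz with h | h
      · left
        have e : (K ∪ {t} ∪ B ∪ {u}).erase z = (K ∪ {u}).erase z ∪ ({t, y} ∪ B.erase y) := by
          ext a
          simp only [Finset.mem_union, Finset.mem_singleton, Finset.mem_insert, Finset.mem_erase]
          by_cases ha : a = z
          · subst ha; simp [hzt, hzB, hzy]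
          · by_cases hay : a = y
            · subst hay; simp [hyB, ha]
            · simp only [hay]; tauto
        rw [e]
        refine h.union (hpairy.union (hcrB y hyB) ?_) ?_
        · rw [Finset.disjoint_right]
          intro a ha
          rw [Finset.mem_erase] at ha
          simp only [Finset.mem_insert, Finset.mem_singleton, not_or]
          exact ⟨fun e => htB (e ▸ ha.2), ha.1⟩
        · rw [Finset.disjoint_left]
          intro a ha
          have ha := Finset.mem_of_mem_erase ha
          simp only [Finset.mem_union, Finset.mem_insert, Finset.mem_singleton, not_or,
            Finset.mem_erase, not_and] at ha ⊢
          rcases ha with ha | rfl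
          · exact ⟨⟨fun e => htK (e ▸ ha), fun e => hBK a (e ▸ hyB) ha⟩, fun _ h => hBK a h ha⟩
          · exact ⟨⟨hut, fun e => huB (e ▸ hyB)⟩, fun _ => huB⟩
      · right
        have e : (K ∪ {t} ∪ B ∪ {p}).erase z = (K ∪ {v}).erase z ∪ ({t, p} ∪ B.erase v) := by
          ext a
          simp only [Finset.mem_union, Finset.mem_singleton, Finset.mem_insert, Finset.mem_erase]
          by_cases ha : a = z
          · subst ha; simp [hzt, hzB, hzp]
          · by_cases hav : a = v
            · subst hav; simp [hvB, ha]
            · simp only [hav]; tauto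
        rw [e]
        refine h.union (hside v hvB) ?_
        rw [Finset.disjoint_left]
        intro a ha
        have ha := Finset.mem_of_mem_erase ha
        simp only [Finset.mem_union, Finset.mem_insert, Finset.mem_singleton, not_or,
          Finset.mem_erase, not_and] at ha ⊢
        rcases ha with ha | rfl
        · exact ⟨⟨fun e => htK (e ▸ ha), fun e => hpK (e ▸ ha)⟩, fun _ h => hBK a h ha⟩
        · exact ⟨⟨fun e => htB (e ▸ hvB), fun e => hpB (e ▸ hvB)⟩, fun h _ => h rfl⟩
    -- Without `t` the new part is just `B`: the old path ending in `v` and the critical matching of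
    -- `B` without `v` suffice.
    · left
      have e : (K ∪ {t} ∪ B ∪ {u}).erase t = (K ∪ {u, v}) ∪ B.erase v := by
        ext a
        simp only [Finset.mem_union, Finset.mem_singleton, Finset.mem_insert, Finset.mem_erase]
        by_cases ha : a = t
        · subst ha; simp [htK, htB, hut.symm, htv]
        · by_cases hav : a = v
          · subst hav; simp [hvB, ha]
          · simp only [ha, hav]; tauto
      rw [e]
      refine (hPM hxy).union (hcrB v hvB) ?_
      rw [Finset.disjoint_left]
      intro a ha
      simp only [Finset.mem_union, Finset.mem_insert, Finset.mem_singleton,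
        Finset.mem_erase, not_and] at ha ⊢
      rcases ha with ha | rfl | rfl
      · exact fun _ h => hBK a h ha
      · exact fun _ => huB
      · exact fun h _ => h rfl
    -- For `z` in `B` the old swallowed part keeps `pm`, the edge `{t, p}` is used, and `B` without
    -- `z` is matched by criticality.
    · right
      have hzK := hBK z hz
      have hzt : z ≠ t := fun e => htB (e ▸ hz)
      have hzp : z ≠ p := fun e => hpB (e ▸ hz)
      have e : (K ∪ {t} ∪ B ∪ {p}).erase z = K ∪ ({t, p} ∪ B.erase z) := by
        ext a
        simp only [Finset.mem_union, Finset.mem_singleton, Finset.mem_insert, Finset.mem_erase]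
        by_cases ha : a = z
        · subst ha; simp [hzt, hzK, hzp]
        · tauto
      rw [e]
      refine hKPM.union (hside z hz) ?_
      rw [Finset.disjoint_left]
      intro a ha
      simp only [Finset.mem_union, Finset.mem_insert, Finset.mem_singleton, not_or,
        Finset.mem_erase, not_and]
      exact ⟨⟨fun e => htK (e ▸ ha), fun e => hpK (e ▸ ha)⟩, fun _ h => hBK a h ha⟩

/-- Contracting the blossom at the end of the walk. -/
theorem forest_contract (D : SearchData N r E pm) (F : Forest N r E pm lab base par dep) {x : ℕ}
    (w : Walk N r E pm lab base dep mark x x) {lab' base' : ℕ → ℕ}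
    (hl : ∀ z < N, lab' z = if z ∈ swallowed N pm lab base mark then 1 else lab z)
    (hb : ∀ z < N, base' z = if z ∈ swallowed N pm lab base mark then x else base z) :
    Forest N r E pm lab' base' par dep := by
  set K := swallowed N pm lab base mark with hK
  have hKlab : ∀ z ∈ K, lab z ≠ 0 := by
    intro z hz
    rcases (mem_swallowed.1 hz).2 with h | h <;> omega
  have hKN : ∀ z ∈ K, z < N := fun z hz => (mem_swallowed.1 hz).1
  have hK1 : ∀ z ∈ K, lab z = 1 → mark (base z) ≠ 0 := by
    intro z hz h1
    rcases (mem_swallowed.1 hz).2 with h | h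
    · exact h.2
    · omega
  have hmate : ∀ z ∈ K, pm z ∈ K := fun z hz => D.mate_mem_swallowed F w hz
  have hmate' : ∀ z < N, z ∉ K → pm z ∉ K := fun z hz h h' => h (D.mate_mate hz ▸ hmate _ h')
  have lin : ∀ z ∈ K, lab' z = 1 := fun z hz => by rw [hl z (hKN z hz), if_pos hz]
  have bin : ∀ z ∈ K, base' z = x := fun z hz => by rw [hb z (hKN z hz), if_pos hz]
  have lout : ∀ z < N, z ∉ K → lab' z = lab z := fun z hz h => by rw [hl z hz, if_neg h]
  have bout : ∀ z < N, z ∉ K → base' z = base z := fun z hz h => by rw [hb z hz, if_neg h]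
  -- Marks sit on bases, so a blossom is swallowed as a whole or not at all. Hence an outer vertex
  -- that is not swallowed has a base that is not swallowed.
  have hbK : ∀ z < N, lab z = 1 → z ∉ K → base z ∉ K := by
    intro z hz h1 h h'
    have h2 := hK1 _ h' (F.lab_base z hz h1)
    rw [F.base_base z hz h1] at h2
    exact h (mem_swallowed.2 ⟨hz, Or.inl ⟨h1, h2⟩⟩)
  have hxK : x ∉ K := not_mem_swallowed w.lab_fst (by rw [w.base_fst]; exact w.mark_fst)
  have hrK : r ∉ K := not_mem_swallowed F.lab_root (by rw [F.base_root]; exact w.mark_root)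
  have one : ∀ z < N, lab z = 1 → lab' z = 1 := by
    intro z hz h
    by_cases hk : z ∈ K
    · exact lin z hk
    · rw [lout z hz hk, h]
  have two : ∀ z < N, lab' z = 2 → z ∉ K ∧ lab z = 2 := by
    intro z hz h
    by_cases hk : z ∈ K
    · rw [lin z hk] at h; omega
    · exact ⟨hk, by rwa [lout z hz hk] at h⟩
  have hxb : ∀ z < N, lab' z = 1 → base' z = base z ∧ lab z = 1 ∧ z ∉ K ∨ base' z = x ∧ z ∈ K := by
    intro z hz h
    by_cases hk : z ∈ K
    · exact Or.inr ⟨bin z hk, hk⟩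
    · exact Or.inl ⟨bout z hz hk, by rwa [lout z hz hk] at h, hk⟩
  constructor
  · exact one r D.root_lt F.lab_root
  · rw [bout r D.root_lt hrK, F.base_root]
  · intro v hv
    by_cases hk : v ∈ K
    · rw [lin v hk]; omega
    · rw [lout v hv hk]; exact F.lab_le v hv
  · intro v hv h
    rcases hxb v hv h with ⟨e, h1, _⟩ | ⟨e, _⟩
    · rw [e]; exact F.base_lt v hv h1
    · rw [e]; exact w.fst_lt
  · intro v hv h
    rcases hxb v hv h with ⟨e, h1, _⟩ | ⟨e, _⟩
    · rw [e]; exact one _ (F.base_lt v hv h1) (F.lab_base v hv h1)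
    · rw [e]; exact one _ w.fst_lt w.lab_fst
  · intro v hv h
    rcases hxb v hv h with ⟨e, h1, hk⟩ | ⟨e, _⟩
    · rw [e, bout _ (F.base_lt v hv h1) (hbK v hv h1 hk), F.base_base v hv h1]
    · rw [e, bout _ w.fst_lt hxK, w.base_fst]
  · intro v hv h
    refine F.covered v hv ?_
    by_cases hk : v ∈ K
    · exact hKlab v hk
    · rwa [lout v hv hk] at h
  · intro v hv h
    by_cases hk : v ∈ K
    · rw [lin v hk] at h; omega
    · rw [lout v hv hk] at h
      rw [lout _ (D.mate_lt hv) (hmate' v hv hk)]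
      exact F.unlabelled v hv h
  · intro v hv h hne
    rcases hxb v hv h with ⟨e, h1, hk⟩ | ⟨e, hk⟩
    · rw [e] at hne; exact one _ (D.mate_lt hv) (F.lab_mate v hv h1 hne)
    · exact lin _ (hmate v hk)
  · intro v hv h hne
    rcases hxb v hv h with ⟨e, h1, hk⟩ | ⟨e, hk⟩
    · rw [e] at hne
      rw [e, bout _ (D.mate_lt hv) (hmate' v hv hk), F.base_mate v hv h1 hne]
    · rw [e, bin _ (hmate v hk)]
  · intro v hv h
    exact one _ (D.mate_lt hv) (F.inner_mate v hv (two v hv h).2)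
  · intro v hv h
    obtain ⟨hk, h2⟩ := two v hv h
    rw [bout _ (D.mate_lt hv) (hmate' v hv hk), F.inner_base v hv h2]
  · exact fun v hv h => F.par_lt v hv (two v hv h).2
  · exact fun v hv h => one _ (F.par_lt v hv (two v hv h).2) (F.lab_par v hv (two v hv h).2)
  · exact fun v hv h => F.edge_par v hv (two v hv h).2
  · intro v hv h
    obtain ⟨hk, h2⟩ := two v hv h
    have h3 := F.dep_par v hv h2
    -- The base of a swallowed parent becomes `x`, which is no deeper than the marked base that it
    -- replaces. So depths still drop.
    by_cases hp : par v ∈ K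
    · rw [bin _ hp]
      have := w.dep_fst _ (F.base_lt _ (F.par_lt v hv h2) (F.lab_par v hv h2)) (hK1 _ hp (F.lab_par v hv h2))
      omega
    · rwa [bout _ (F.par_lt v hv h2) hp]
  · intro v hv h hbv hr
    rcases hxb v hv h with ⟨e, h1, hk⟩ | ⟨e, hk⟩
    · rw [e] at hbv
      rw [lout _ (D.mate_lt hv) (hmate' v hv hk)]
      exact F.mate_base v hv h1 hbv hr
    · exact absurd hk (by rw [← hbv, e]; exact hxK)
  · intro v hv h
    set L := blossom N lab base x with hL
    -- The contracted blossom is the old blossom `L` of the meeting point together with everything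
    -- swallowed.
    have hLx : blossom N lab' base' x = L ∪ K := by
      ext z
      rw [Finset.mem_union, hL, mem_blossom, mem_blossom]
      by_cases hk : z ∈ K
      · simp [hk, hKN z hk, lin z hk, bin z hk]
      · constructor
        · rintro ⟨h1, h2, h3⟩
          rw [lout z h1 hk] at h2
          rw [bout z h1 hk] at h3
          exact Or.inl ⟨h1, h2, h3⟩
        · rintro (⟨h1, h2, h3⟩ | h')
          · exact ⟨h1, by rw [lout z h1 hk, h2], by rw [bout z h1 hk, h3]⟩
          · exact absurd h' hk
    have hLK : Disjoint L K := by
      rw [Finset.disjoint_left]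
      intro z hz
      obtain ⟨h1, h2, h3⟩ := mem_blossom.1 hz
      exact not_mem_swallowed h2 (by rw [h3]; exact w.mark_fst)
    have hLc : ∀ z ∈ L, PM E (L.erase z) := fun z hz => by
      obtain ⟨h1, h2, h3⟩ := mem_blossom.1 hz
      have := F.critical z h1 h2
      rwa [h3] at this
    rcases hxb v hv h with ⟨e, h1, hk⟩ | ⟨e, hk⟩
    · rw [e]
      by_cases hvx : base v = x
      · have hvL : v ∈ L := mem_blossom.2 ⟨hv, h1, hvx⟩
        rw [hvx, hLx, Finset.erase_union_distrib, Finset.erase_eq_of_notMem hk]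
        exact (hLc v hvL).union (D.swallowed_pm F w)
          (Finset.disjoint_of_subset_left (Finset.erase_subset _ _) hLK)
      · have : blossom N lab' base' (base v) = blossom N lab base (base v) := by
          ext z
          rw [mem_blossom, mem_blossom]
          by_cases hzk : z ∈ K
          · constructor
            · rintro ⟨_, _, h3⟩
              rw [bin z hzk] at h3
              exact absurd h3.symm hvx
            · rintro ⟨_, h2, h3⟩
              have := hK1 z hzk h2
              rw [h3] at this
              exact absurd (mem_swallowed.2 ⟨hv, Or.inl ⟨h1, this⟩⟩) hk
          · constructor
            · rintro ⟨h1, h2, h3⟩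
              exact ⟨h1, by rwa [lout z h1 hzk] at h2, by rwa [bout z h1 hzk] at h3⟩
            · rintro ⟨h1, h2, h3⟩
              exact ⟨h1, by rwa [lout z h1 hzk], by rwa [bout z h1 hzk]⟩
        rw [this]
        exact F.critical v hv h1
    -- If `v` was swallowed, an end of the walk in `L` takes its place, and the rest of `L` is
    -- matched by criticality.
    · rw [e, hLx]
      obtain ⟨u, u', ⟨huN, hlu, hbu⟩, ⟨huN', hlu', hbu'⟩, -, hcr⟩ := w.ends
      have side : ∀ u ∈ L, PM E ((K ∪ {u}).erase v) → PM E ((L ∪ K).erase v) := by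
        intro u hu hp
        have hvu : v ≠ u := fun e => Finset.disjoint_left.1 hLK hu (e ▸ hk)
        have hvL : v ∉ L := fun h' => Finset.disjoint_left.1 hLK h' hk
        have e : (L ∪ K).erase v = L.erase u ∪ (K ∪ {u}).erase v := by
          ext a
          simp only [Finset.mem_union, Finset.mem_singleton, Finset.mem_erase]
          by_cases ha : a = v
          · subst ha; simp [hvL]
          · by_cases hau : a = u
            · subst hau; simp [hu, ha]
            · simp only [hau]; tauto
        rw [e]
        refine (hLc u hu).union hp ?_
        rw [Finset.disjoint_left]
        intro a ha
        rw [Finset.mem_erase] at ha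
        simp only [Finset.mem_erase, Finset.mem_union, Finset.mem_singleton, not_and, not_or]
        exact fun _ => ⟨Finset.disjoint_left.1 hLK ha.2, ha.1⟩
      rcases hcr v hk with h' | h'
      · exact side u (mem_blossom.2 ⟨huN, hlu, hbu⟩) h'
      · exact side u' (mem_blossom.2 ⟨huN', hlu', hbu'⟩) h'

end SearchData

-- Evaluation rules for expressions and commands.

attribute [simp] setReg_reg setReg_arr setArr_reg setArr_arr

namespace Expr

variable (s : Store) (a b : Expr)

@[simp] theorem eval_var (x : ℕ) : (var x).eval s = s.reg x := rfl
@[simp] theorem eval_lit (c : ℕ) : (lit c).eval s = c := rfl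
@[simp] theorem eval_add : (add a b).eval s = a.eval s + b.eval s := rfl
@[simp] theorem eval_sub : (sub a b).eval s = a.eval s - b.eval s := rfl
@[simp] theorem eval_get (k : ℕ) : (get k a).eval s = s.arr k (a.eval s) := rfl

/-- The expression `a` is true, that is, nonzero. -/
def holds : Prop := a.eval s ≠ 0

/-- Negation. -/
def not : Expr := sub (lit 1) a

/-- Conjunction. -/
def and : Expr := not (add (not a) (not b))

/-- Disjunction. -/
def or : Expr := add a b

/-- Inequality. -/
def ne : Expr := add (sub a b) (sub b a)

/-- Equality. -/
def eq : Expr := not (ne a b)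

/-- Comparison. -/
def lt : Expr := sub b a

@[simp] theorem holds_var (x : ℕ) : (var x).holds s ↔ s.reg x ≠ 0 := Iff.rfl

@[simp] theorem holds_get (k : ℕ) : (get k a).holds s ↔ s.arr k (a.eval s) ≠ 0 := Iff.rfl

@[simp] theorem holds_not : a.not.holds s ↔ ¬ a.holds s := by
  simp only [not, holds, eval_sub, eval_lit]; omega

@[simp] theorem holds_or : (a.or b).holds s ↔ a.holds s ∨ b.holds s := by
  simp only [or, holds, eval_add]; omega

@[simp] theorem holds_and : (a.and b).holds s ↔ a.holds s ∧ b.holds s := by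
  rw [and, holds_not]
  change ¬ (a.not.or b.not).holds s ↔ _
  simp

@[simp] theorem holds_ne : (a.ne b).holds s ↔ a.eval s ≠ b.eval s := by
  simp only [ne, holds, eval_sub, eval_add]; omega

@[simp] theorem holds_eq : (a.eq b).holds s ↔ a.eval s = b.eval s := by
  simp [eq]

@[simp] theorem holds_lt : (a.lt b).holds s ↔ a.eval s < b.eval s := by
  simp only [lt, holds, eval_sub]; omega

end Expr

namespace Cmd

variable (s : Store)

@[simp] theorem den_assign (x : ℕ) (e : Expr) : (assign x e).den s = s.setReg x (e.eval s) := rfl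
@[simp] theorem den_put (k : ℕ) (i e : Expr) :
    (put k i e).den s = s.setArr k (i.eval s) (e.eval s) := rfl
@[simp] theorem den_seq (p q : Cmd) : (seq p q).den s = q.den (p.den s) := rfl
@[simp] theorem den_skip : skip.den s = s := rfl

theorem den_ite_pos {e : Expr} {p q : Cmd} (h : e.holds s) : (ite e p q).den s = p.den s :=
  if_pos h

theorem den_ite_neg {e : Expr} {p q : Cmd} (h : ¬ e.holds s) : (ite e p q).den s = q.den s :=
  if_neg h

end Cmd

open MultilayerMatching.Expr MultilayerMatching.Cmd

/-- `p` followed by `q` -/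
infixr:60 " ;; " => Cmd.seq

/-! ### The search for an augmenting path -/

/-- Entry `(a, b)` of a square matrix stored in array `k`, with row offsets in array `rows`. -/
def entry (k rows : ℕ) (a b : Expr) : Expr := get k (add (get rows a) b)

/-- Add `v` and its mate to the tree, below `u`. -/
def growCmd : Cmd :=
  assign 23 (get 9 (var 18)) ;;
  put 13 (var 23) (add (get 13 (get 11 (var 17))) (lit 1)) ;;
  put 10 (var 18) (lit 2) ;;
  put 12 (var 18) (var 17) ;;
  put 10 (var 23) (lit 1) ;;
  put 11 (var 23) (var 23)

/-- One step towards the root, from the deeper of the bases in registers 19 and 20. -/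
def walkCmd : Cmd :=
  ite (ne (var 19) (var 20))
    (ite (lt (get 13 (var 19)) (get 13 (var 20)))
      (put 14 (var 20) (lit 1) ;; assign 20 (get 11 (get 12 (get 9 (var 20)))))
      (put 14 (var 19) (lit 1) ;; assign 19 (get 11 (get 12 (get 9 (var 19))))))
    skip

/-- Move `z` to the new blossom. -/
def absorbCmd : Cmd :=
  ite (or (and (eq (get 10 (var 22)) (lit 1)) (get 14 (get 11 (var 22))))
      (and (eq (get 10 (var 22)) (lit 2)) (get 14 (get 9 (var 22)))))
    (put 10 (var 22) (lit 1) ;; put 11 (var 22) (var 19))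
    skip

/-- Contract the blossom closed by the edge from `u` to `v`. -/
def contractCmd : Cmd :=
  assign 19 (get 11 (var 17)) ;;
  assign 20 (get 11 (var 18)) ;;
  .loop 22 4 (put 14 (var 22) (lit 0)) ;;
  .loop 21 4 walkCmd ;;
  .loop 22 4 absorbCmd

/-- Scan the edge from `u` to `v`. -/
def scanCmd : Cmd :=
  ite (and (entry 8 2 (var 17) (var 18)) (eq (get 10 (var 17)) (lit 1)))
    (ite (eq (get 10 (var 18)) (lit 0))
      (ite (eq (get 9 (var 18)) (var 18)) (assign 15 (lit 1)) growCmd)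
      (ite (and (eq (get 10 (var 18)) (lit 1)) (ne (get 11 (var 17)) (get 11 (var 18))))
        contractCmd skip))
    skip

/-- Search for an augmenting path from the vertex in register 12. The graph is in array 8 and the
matching in array 9; register 15 tells whether there is one. -/
def searchCmd : Cmd :=
  .loop 18 4 (put 10 (var 18) (lit 0) ;; put 11 (var 18) (var 18)) ;;
  put 10 (var 12) (lit 1) ;;
  assign 15 (lit 0) ;;
  .loop 16 4 (.loop 17 4 (.loop 18 4 scanCmd))

/-- The graph on the vertices below `N` with the adjacency matrix `w`. -/
def edgeRel (N : ℕ) (w : ℕ → ℕ) (u v : ℕ) : Prop := u < N ∧ v < N ∧ w (u * N + v) ≠ 0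

/-- The loops of the search do not change its data. -/
structure SearchState (N r : ℕ) (w pm : ℕ → ℕ) (s : Store) : Prop where
  reg_size : s.reg 4 = N
  rows : ∀ u < N, s.arr 2 u = u * N
  graph : s.arr 8 = w
  mates : s.arr 9 = pm
  root : s.reg 12 = r

theorem SearchState.of_eq {N r : ℕ} {w pm : ℕ → ℕ} {s s' : Store} (h : SearchState N r w pm s)
    (h1 : s'.reg 4 = s.reg 4) (h2 : s'.arr 2 = s.arr 2) (h3 : s'.arr 8 = s.arr 8)
    (h4 : s'.arr 9 = s.arr 9) (h5 : s'.reg 12 = s.reg 12) : SearchState N r w pm s' :=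
  ⟨h1.trans h.1, fun u hu => by rw [h2, h.2 u hu], h3.trans h.3, h4.trans h.4, h5.trans h.5⟩

/-- The tree in the store `s` satisfies the invariant. -/
def ForestIn (N r : ℕ) (w pm : ℕ → ℕ) (s : Store) : Prop :=
  Forest N r (edgeRel N w) pm (s.arr 10) (s.arr 11) (s.arr 12) (s.arr 13)

/-- The number of outer vertices. -/
def outerCount (N : ℕ) (lab : ℕ → ℕ) : ℕ := ((Finset.range N).filter fun z => lab z = 1).card

theorem outerCount_lt {N z : ℕ} {lab lab' : ℕ → ℕ} (h : ∀ z < N, lab z = 1 → lab' z = 1)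
    (hz : z < N) (h1 : lab z ≠ 1) (h2 : lab' z = 1) : outerCount N lab < outerCount N lab' := by
  refine Finset.card_lt_card (Finset.ssubset_iff_subset_ne.2 ⟨fun x hx => ?_, fun e => ?_⟩)
  · rw [Finset.mem_filter, Finset.mem_range] at hx ⊢
    exact ⟨hx.1, h x hx.1 hx.2⟩
  · have : z ∈ (Finset.range N).filter fun z => lab' z = 1 := by simp [hz, h2]
    rw [← e] at this
    simp [h1] at this

theorem outerCount_le (N : ℕ) (lab : ℕ → ℕ) : outerCount N lab ≤ N :=
  (Finset.card_filter_le _ _).trans_eq (Finset.card_range N)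

theorem growCmd_spec {N r u v : ℕ} {w pm : ℕ → ℕ} {s : Store}
    (D : SearchData N r (edgeRel N w) pm) (hs : SearchState N r w pm s)
    (F : ForestIn N r w pm s) (hu : s.reg 17 = u) (hv : s.reg 18 = v) (huv : edgeRel N w u v)
    (hlu : s.arr 10 u = 1) (hlv : s.arr 10 v = 0) (hpv : pm v ≠ v) :
    ForestIn N r w pm (growCmd.den s) ∧
      outerCount N (s.arr 10) < outerCount N ((growCmd.den s).arr 10) := by
  have hF := D.forest_grow F huv.1 huv.2.1 huv hlu hlv hpv
  have e : (growCmd.den s).arr 10 = Function.update (Function.update (s.arr 10) v 2) (pm v) 1 := by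
    simp [growCmd, hv, hs.mates]
  refine ⟨?_, ?_⟩
  · unfold ForestIn
    rw [e]
    simpa [growCmd, hu, hv, hs.mates] using hF
  · rw [e]
    have hpl := F.unlabelled v huv.2.1 hlv
    refine outerCount_lt (z := pm v) (fun z hz h => ?_) (D.mate_lt huv.2.1) (by omega) (by simp)
    have h1 : z ≠ pm v := by rintro rfl; omega
    have h2 : z ≠ v := by rintro rfl; omega
    simp [h1, h2, h]

/-- The walk of a contraction, in the store. -/
def WalkIn (N r : ℕ) (w pm : ℕ → ℕ) (s : Store) : Prop :=
  Walk N r (edgeRel N w) pm (s.arr 10) (s.arr 11) (s.arr 13) (s.arr 14) (s.reg 19) (s.reg 20)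

/-- The number of marked vertices. -/
def markCount (N : ℕ) (mark : ℕ → ℕ) : ℕ := ((Finset.range N).filter fun z => mark z ≠ 0).card

theorem markCount_update {N y : ℕ} {mark : ℕ → ℕ} (hy : y < N) (h : mark y = 0) :
    markCount N (Function.update mark y 1) = markCount N mark + 1 := by
  have : (Finset.range N).filter (fun z => Function.update mark y 1 z ≠ 0)
      = insert y ((Finset.range N).filter fun z => mark z ≠ 0) := by
    ext z
    by_cases e : z = y
    · subst e; simp [hy]
    · simp [Function.update_apply, e]
  rw [markCount, this, Finset.card_insert_of_notMem (by simp [h])]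
  rfl

/-- Once the bases coincide nothing moves any more; until then every step marks a new base. The step
on the other side follows by `Walk.swap`. -/
theorem walkCmd_spec {N r : ℕ} {w pm : ℕ → ℕ} {s : Store}
    (D : SearchData N r (edgeRel N w) pm) (hs : SearchState N r w pm s)
    (F : ForestIn N r w pm s) (W : WalkIn N r w pm s) :
    WalkIn N r w pm (walkCmd.den s) ∧ ((s.reg 19 = s.reg 20 ∧ walkCmd.den s = s) ∨
      (s.reg 19 ≠ s.reg 20 ∧
        markCount N ((walkCmd.den s).arr 14) = markCount N (s.arr 14) + 1)) := by
  by_cases hxy : s.reg 19 = s.reg 20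
  · have e : walkCmd.den s = s := by
      rw [walkCmd, den_ite_neg _ (by simp [hxy])]; rfl
    rw [e]
    exact ⟨W, Or.inl ⟨hxy, rfl⟩⟩
  · have h0 : (ne (var 19) (var 20)).holds s := by simpa using hxy
    by_cases hd : s.arr 13 (s.reg 19) < s.arr 13 (s.reg 20)
    · obtain ⟨h1, h2, h3⟩ := D.walk_step F W hxy hd.le
      rw [walkCmd, den_ite_pos _ h0, den_ite_pos _ (by simpa using hd)]
      refine ⟨?_, Or.inr ⟨hxy, ?_⟩⟩
      · simpa [WalkIn, hs.mates] using h1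
      · simpa using markCount_update W.snd_lt h2
    · obtain ⟨h1, h2, h3⟩ := D.walk_step F W.swap (Ne.symm hxy) (not_lt.1 hd)
      rw [walkCmd, den_ite_pos _ h0, den_ite_neg _ (by simpa using hd)]
      refine ⟨?_, Or.inr ⟨hxy, ?_⟩⟩
      · simpa [WalkIn, hs.mates] using h1.swap
      · simpa using markCount_update W.fst_lt h2

/-- The update in place is harmless: the test for `z` reads the label and the base of `z` only,
which are still the old ones when `z` is reached, besides mates and marks, which do not change. -/
theorem absorb_loop {N : ℕ} {s : Store} (hN : s.reg 4 = N) :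
    ∀ z < N, ((Cmd.loop 22 4 absorbCmd).den s).arr 10 z
        = (if z ∈ swallowed N (s.arr 9) (s.arr 10) (s.arr 11) (s.arr 14) then 1 else s.arr 10 z) ∧
      ((Cmd.loop 22 4 absorbCmd).den s).arr 11 z
        = (if z ∈ swallowed N (s.arr 9) (s.arr 10) (s.arr 11) (s.arr 14) then s.reg 19
            else s.arr 11 z) := by
  have key := Cmd.loop_inv (x := 22) (y := 4) (p := absorbCmd) (s₀ := s) (fun i t =>
    (∀ z, t.arr 10 z = if z < i ∧ z ∈ swallowed N (s.arr 9) (s.arr 10) (s.arr 11) (s.arr 14)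
      then 1 else s.arr 10 z) ∧
    (∀ z, t.arr 11 z = if z < i ∧ z ∈ swallowed N (s.arr 9) (s.arr 10) (s.arr 11) (s.arr 14)
      then s.reg 19 else s.arr 11 z)) (by simp) ?_
  · intro z hz
    rw [hN] at key
    simpa [hz] using And.intro (key.1 z) (key.2 z)
  · rw [hN]
    rintro i hi t hF ⟨h1, h2⟩
    have e9 := hF.2 9 (by decide)
    have e14 := hF.2 14 (by decide)
    have e19 := hF.1 19 (by decide)
    have hmem : i ∈ swallowed N (s.arr 9) (s.arr 10) (s.arr 11) (s.arr 14) ↔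
        (or (and (eq (get 10 (var 22)) (lit 1)) (get 14 (get 11 (var 22))))
      (and (eq (get 10 (var 22)) (lit 2)) (get 14 (get 9 (var 22))))).holds (t.setReg 22 i) := by
      simp [mem_swallowed, hi, h1, h2, e9, e14]
    by_cases hm : i ∈ swallowed N (s.arr 9) (s.arr 10) (s.arr 11) (s.arr 14)
    · rw [absorbCmd, den_ite_pos _ (hmem.1 hm)]
      constructor <;> intro z <;> by_cases hz : z = i
      · subst hz; simp [hm]
      · have : z < i + 1 ↔ z < i := by omega
        simp [hz, this, h1]
      · subst hz; simp [hm, e19]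
      · have : z < i + 1 ↔ z < i := by omega
        simp [hz, this, h2]
    · rw [absorbCmd, den_ite_neg _ (fun h => hm (hmem.2 h))]
      constructor <;> intro z <;> by_cases hz : z = i
      · subst hz; simp [hm, h1]
      · have : z < i + 1 ↔ z < i := by omega
        simp [this, h1]
      · subst hz; simp [hm, h2]
      · have : z < i + 1 ↔ z < i := by omega
        simp [this, h2]

/-- If the bases had not met after `N` rounds, all `N` vertices would be marked, but the root never
is. Some base does get marked, and its mate turns from inner to outer, which is the progress
claimed. -/
theorem contractCmd_spec {N r u v : ℕ} {w pm : ℕ → ℕ} {s : Store}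
    (D : SearchData N r (edgeRel N w) pm) (hs : SearchState N r w pm s)
    (F : ForestIn N r w pm s) (hu : s.reg 17 = u) (hv : s.reg 18 = v) (huv : edgeRel N w u v)
    (hlu : s.arr 10 u = 1) (hlv : s.arr 10 v = 1) (hne : s.arr 11 u ≠ s.arr 11 v) :
    ForestIn N r w pm (contractCmd.den s) ∧
      outerCount N (s.arr 10) < outerCount N ((contractCmd.den s).arr 10) := by
  set s₁ := (s.setReg 19 (s.arr 11 u)).setReg 20 (s.arr 11 v) with hs₁
  set s₂ := (Cmd.loop 22 4 (put 14 (var 22) (lit 0))).den s₁ with hs₂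
  set s₃ := (Cmd.loop 21 4 walkCmd).den s₂ with hs₃
  have e : contractCmd.den s = (Cmd.loop 22 4 absorbCmd).den s₃ := by
    simp [contractCmd, hs₃, hs₂, hs₁, hu, hv]
  have f₂ : Frame (Cmd.loop 22 4 (put 14 (var 22) (lit 0))) s₁ s₂ := Cmd.frame _ _
  have f₃ : Frame (Cmd.loop 21 4 walkCmd) s₂ s₃ := Cmd.frame _ _
  have hN₁ : s₁.reg 4 = N := by simp [hs₁, hs.reg_size]
  have hN₂ : s₂.reg 4 = N := by rw [f₂.1 4 (by decide), hN₁]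
  have hmark : ∀ m < N, s₂.arr 14 m = 0 := by
    have := Cmd.loop_inv (x := 22) (y := 4) (p := put 14 (var 22) (lit 0)) (s₀ := s₁)
      (fun i t => ∀ m < i, t.arr 14 m = 0) (by simp) (by
        intro i _ t _ h m hm
        by_cases hmi : m = i
        · subst hmi; simp
        · simp [hmi, h m (by omega)])
    rwa [hN₁] at this
  have a₂ : ∀ k, k ≠ 14 → s₂.arr k = s.arr k := by
    intro k hk
    rw [f₂.2 k (by simpa [Cmd.arrs] using hk)]
    simp [hs₁]
  have r₂ : ∀ k, k ≠ 19 → k ≠ 20 → k ≠ 22 → s₂.reg k = s.reg k := by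
    intro k h1 h2 h3
    rw [f₂.1 k (by simpa [Cmd.regs] using h3)]
    simp [hs₁, h1, h2]
  have r19 : s₂.reg 19 = s.arr 11 u := by rw [f₂.1 19 (by decide)]; simp [hs₁]
  have r20 : s₂.reg 20 = s.arr 11 v := by rw [f₂.1 20 (by decide)]; simp [hs₁]
  have hs₂' : SearchState N r w pm s₂ := hs.of_eq (r₂ _ (by decide) (by decide) (by decide))
    (a₂ _ (by decide)) (a₂ _ (by decide)) (a₂ _ (by decide))
    (r₂ _ (by decide) (by decide) (by decide))
  have hF₂ : ForestIn N r w pm s₂ := by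
    unfold ForestIn
    rw [a₂ 10 (by decide), a₂ 11 (by decide), a₂ 12 (by decide), a₂ 13 (by decide)]
    exact F
  have hW₂ : WalkIn N r w pm s₂ := by
    unfold WalkIn
    rw [r19, r20, a₂ 10 (by decide), a₂ 11 (by decide), a₂ 13 (by decide)]
    exact D.walk_init F huv.1 huv.2.1 huv hlu hlv hmark
  -- While the bases differ, `i` rounds mark `i` vertices. The clause for `i = 0` remembers that
  -- they differed at the start, so that something is marked when they meet.
  have key := Cmd.loop_inv (x := 21) (y := 4) (p := walkCmd) (s₀ := s₂)
    (fun i t => WalkIn N r w pm t ∧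
      ((markCount N (t.arr 14) = i ∧ (i = 0 → t.reg 19 ≠ t.reg 20)) ∨
        (t.reg 19 = t.reg 20 ∧ markCount N (t.arr 14) ≠ 0))) ⟨hW₂, Or.inl ⟨?_, fun _ => ?_⟩⟩ (by
      rintro i hi t hF ⟨h1, h2⟩
      have hst : SearchState N r w pm (t.setReg 21 i) := hs₂'.of_eq
        (by simp [hF.1 4 (by decide)]) (by simp [hF.2 2 (by decide)]) (by simp [hF.2 8 (by decide)])
        (by simp [hF.2 9 (by decide)]) (by simp [hF.1 12 (by decide)])
      have hFt : ForestIn N r w pm (t.setReg 21 i) := by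
        unfold ForestIn
        rw [setReg_arr, hF.2 10 (by decide), hF.2 11 (by decide), hF.2 12 (by decide),
          hF.2 13 (by decide)]
        exact hF₂
      have hWt : WalkIn N r w pm (t.setReg 21 i) := by simpa [WalkIn] using h1
      obtain ⟨g1, g⟩ := walkCmd_spec D hst hFt hWt
      refine ⟨g1, ?_⟩
      simp only [setReg_reg, setReg_arr] at g
      rcases g with ⟨g2, g3⟩ | ⟨g2, g3⟩
      · right
        rw [g3]
        refine ⟨by simpa using g2, ?_⟩
        simp only [setReg_arr]
        rcases h2 with ⟨h2, h3⟩ | ⟨_, h3⟩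
        · intro h0
          exact h3 (by omega) (by simpa using g2)
        · exact h3
      · left
        rcases h2 with ⟨h2, h3⟩ | ⟨h3, _⟩
        · exact ⟨by omega, fun h => by omega⟩
        · exact absurd h3 (by simpa using g2))
  · rw [hN₂] at key
    obtain ⟨W, ⟨h1, _⟩ | ⟨h1, h2⟩⟩ := key
    · exfalso
      have : N = 0 ∨ 0 < N := by omega
      have hlt := D.root_lt
      have hall : (Finset.range N).filter (fun z => s₃.arr 14 z ≠ 0) = Finset.range N :=
        Finset.eq_of_subset_of_card_le (Finset.filter_subset _ _)
          (by rw [Finset.card_range]; exact h1.ge)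
      have hr : r ∈ (Finset.range N).filter (fun z => s₃.arr 14 z ≠ 0) := by
        rw [hall]; exact Finset.mem_range.2 hlt
      exact (Finset.mem_filter.1 hr).2 W.mark_root
    · have hN₃ : s₃.reg 4 = N := by rw [f₃.1 4 (by decide), hN₂]
      have a₃ : ∀ k, k ≠ 14 → s₃.arr k = s.arr k := by
        intro k hk
        rw [f₃.2 k (by simpa [Cmd.arrs, walkCmd] using hk), a₂ k hk]
      have hab := absorb_loop hN₃
      have f₄ : Frame (Cmd.loop 22 4 absorbCmd) s₃ (contractCmd.den s) := e ▸ Cmd.frame _ _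
      rw [← e, a₃ 9 (by decide), a₃ 10 (by decide), a₃ 11 (by decide), hs.mates] at hab
      unfold WalkIn at W
      rw [← h1, a₃ 10 (by decide), a₃ 11 (by decide), a₃ 13 (by decide)] at W
      have hF' := D.forest_contract F W (fun z hz => (hab z hz).1) (fun z hz => (hab z hz).2)
      refine ⟨?_, ?_⟩
      · unfold ForestIn
        rw [f₄.2 12 (by decide), f₄.2 13 (by decide), a₃ 12 (by decide), a₃ 13 (by decide)]
        exact hF'
      · obtain ⟨m, hm⟩ := Finset.card_ne_zero.1 h2
        rw [Finset.mem_filter, Finset.mem_range] at hm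
        obtain ⟨hmN, hm⟩ := hm
        have hlm := W.lab_mark m hmN hm
        have hbm := W.base_mark m hmN hm
        have hmr : m ≠ r := fun e => hm (e ▸ W.mark_root)
        have hl2 := F.mate_base m hmN hlm hbm hmr
        have hmem : pm m ∈ swallowed N pm (s.arr 10) (s.arr 11) (s₃.arr 14) :=
          mem_swallowed.2 ⟨D.mate_lt hmN, Or.inr ⟨hl2, by rwa [D.mate_mate hmN]⟩⟩
        refine outerCount_lt (z := pm m) (fun z hz h => ?_) (D.mate_lt hmN) (by omega) ?_
        · rw [(hab z hz).1, h]; simp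
        · rw [(hab _ (D.mate_lt hmN)).1, if_pos hmem]
  · rw [markCount, Finset.card_eq_zero, Finset.filter_eq_empty_iff]
    intro m hm
    simpa using hmark m (Finset.mem_range.1 hm)
  · rw [r19, r20]; exact hne

/-- The edge from `u` to `v` gives no more progress. -/
def Scanned (N : ℕ) (w : ℕ → ℕ) (s : Store) (u v : ℕ) : Prop :=
  edgeRel N w u v → s.arr 10 u = 1 →
    s.arr 10 v = 2 ∨ (s.arr 10 v = 1 ∧ s.arr 11 u = s.arr 11 v) ∨ s.reg 15 ≠ 0

/-- The invariant of the search. -/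
structure SearchInv (N r : ℕ) (w pm : ℕ → ℕ) (s : Store) : Prop where
  forest : ForestIn N r w pm s
  sound : s.reg 15 ≠ 0 → Aug N (edgeRel N w) pm r

/-- From `s` to `s'`, no vertex was labelled. -/
def Idle (s s' : Store) : Prop :=
  s'.arr 10 = s.arr 10 ∧ s'.arr 11 = s.arr 11 ∧ (s.reg 15 ≠ 0 → s'.reg 15 ≠ 0)

theorem Scanned.of_idle {N : ℕ} {w : ℕ → ℕ} {s s' : Store} {u v : ℕ} (h : Scanned N w s u v)
    (hi : Idle s s') : Scanned N w s' u v := by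
  intro h1 h2
  rw [hi.1] at h2 ⊢
  rw [hi.2.1]
  rcases h h1 h2 with h | h | h
  · exact Or.inl h
  · exact Or.inr (Or.inl h)
  · exact Or.inr (Or.inr (hi.2.2 h))

/-- Either nothing is relabelled and the edge is exhausted, or an outer vertex is gained. As long as
the flag is down, an edge that is already exhausted admits only the former, so a fully scanned
forest stays as it is. -/
theorem scanCmd_spec {N r u v : ℕ} {w pm : ℕ → ℕ} {s : Store}
    (D : SearchData N r (edgeRel N w) pm) (hs : SearchState N r w pm s)
    (I : SearchInv N r w pm s) (hu : s.reg 17 = u) (hv : s.reg 18 = v) (huN : u < N) (hvN : v < N) :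
    SearchInv N r w pm (scanCmd.den s) ∧ (s.reg 15 ≠ 0 → (scanCmd.den s).reg 15 ≠ 0) ∧
      ((Idle s (scanCmd.den s) ∧ Scanned N w (scanCmd.den s) u v) ∨
        ((Scanned N w s u v → s.reg 15 ≠ 0) ∧
          outerCount N (s.arr 10) < outerCount N ((scanCmd.den s).arr 10))) := by
  have idle : Idle s s := ⟨rfl, rfl, id⟩
  by_cases h0 : edgeRel N w u v ∧ s.arr 10 u = 1
  · have h0' : (and (entry 8 2 (var 17) (var 18)) (eq (get 10 (var 17)) (lit 1))).holds s := by
      simpa [entry, hu, hv, hs.rows u huN, hs.graph, h0.2] using h0.1.2.2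
    obtain ⟨huv, hlu⟩ := h0
    rw [scanCmd, den_ite_pos _ h0']
    by_cases h1 : s.arr 10 v = 0
    · rw [den_ite_pos _ (by simpa [hv] using h1)]
      by_cases h2 : pm v = v
      · rw [den_ite_pos _ (by simpa [hv, hs.mates] using h2), den_assign]
        refine ⟨⟨?_, fun _ => D.aug_of_exposed I.forest huN hvN huv hlu h1 h2⟩, fun _ => by simp,
          Or.inl ⟨⟨rfl, rfl, fun _ => by simp⟩, fun _ _ => by simp⟩⟩
        simpa [ForestIn] using I.forest
      · rw [den_ite_neg _ (by simpa [hv, hs.mates] using h2)]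
        obtain ⟨g1, g2⟩ := growCmd_spec D hs I.forest hu hv huv hlu h1 h2
        have e15 := (Cmd.frame growCmd s).1 15 (by decide)
        refine ⟨⟨g1, fun h => I.sound (by rwa [e15] at h)⟩, fun h => by rwa [e15],
          Or.inr ⟨fun h => ?_, g2⟩⟩
        rcases h huv hlu with h | h | h
        · omega
        · omega
        · exact h
    · rw [den_ite_neg _ (by simpa [hv] using h1)]
      by_cases h2 : s.arr 10 v = 1 ∧ s.arr 11 u ≠ s.arr 11 v
      · rw [den_ite_pos _ (by simpa [hv, hu] using h2)]
        obtain ⟨g1, g2⟩ := contractCmd_spec D hs I.forest hu hv huv hlu h2.1 h2.2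
        have e15 := (Cmd.frame contractCmd s).1 15 (by decide)
        refine ⟨⟨g1, fun h => I.sound (by rwa [e15] at h)⟩, fun h => by rwa [e15],
          Or.inr ⟨fun h => ?_, g2⟩⟩
        rcases h huv hlu with h | h | h
        · omega
        · exact absurd h.2 h2.2
        · exact h
      · rw [den_ite_neg _ (by simpa [hv, hu] using h2), den_skip]
        refine ⟨I, id, Or.inl ⟨idle, fun _ _ => ?_⟩⟩
        have := I.forest.lab_le v hvN
        by_cases h3 : s.arr 10 v = 1
        · exact Or.inr (Or.inl ⟨h3, not_not.1 fun h => h2 ⟨h3, h⟩⟩)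
        · exact Or.inl (by omega)
  · have h0' : ¬ (and (entry 8 2 (var 17) (var 18)) (eq (get 10 (var 17)) (lit 1))).holds s := by
      intro h
      simp only [entry, holds_and, holds_get, holds_eq, eval_add, eval_get, eval_var, eval_lit, hu,
        hv, hs.rows u huN, hs.graph] at h
      exact h0 ⟨⟨huN, hvN, h.1⟩, h.2⟩
    rw [scanCmd, den_ite_neg _ h0', den_skip]
    exact ⟨I, id, Or.inl ⟨idle, fun h1 h2 => absurd ⟨h1, h2⟩ h0⟩⟩

/-- Progress of the search: either more than `c` vertices are outer, or everything is scanned, or at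
least `c` vertices are outer and the edges in `P` are scanned. -/
def Progress (N : ℕ) (w : ℕ → ℕ) (c : ℕ) (P : ℕ → ℕ → Prop) (s : Store) : Prop :=
  c < outerCount N (s.arr 10) ∨ (∀ u v, Scanned N w s u v) ∨
    (c ≤ outerCount N (s.arr 10) ∧ ∀ u v, P u v → Scanned N w s u v)

/-- A round over all pairs that gains no outer vertex relabels nothing, so each pair is still
exhausted when the round ends. -/
theorem searchRound_spec {N r c : ℕ} {w pm : ℕ → ℕ} {s : Store}
    (D : SearchData N r (edgeRel N w) pm) (hs : SearchState N r w pm s)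
    (I : SearchInv N r w pm s) (hp : Progress N w c (fun _ _ => False) s) :
    SearchInv N r w pm ((Cmd.loop 17 4 (.loop 18 4 scanCmd)).den s) ∧
      Progress N w (c + 1) (fun _ _ => False) ((Cmd.loop 17 4 (.loop 18 4 scanCmd)).den s) := by
  have key := Cmd.loop_inv (x := 17) (y := 4) (p := .loop 18 4 scanCmd) (s₀ := s) (fun u t =>
    SearchInv N r w pm t ∧ Progress N w c (fun a _ => a < u) t) ⟨I, by simpa using hp⟩ (by
      rintro u hu t hF ⟨It, hpt⟩
      have ht : SearchState N r w pm (t.setReg 17 u) := hs.of_eq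
        (by simp [hF.1 4 (by decide)]) (by simp [hF.2 2 (by decide)]) (by simp [hF.2 8 (by decide)])
        (by simp [hF.2 9 (by decide)]) (by simp [hF.1 12 (by decide)])
      have key := Cmd.loop_inv (x := 18) (y := 4) (p := scanCmd) (s₀ := t.setReg 17 u)
        (fun v q => SearchInv N r w pm q ∧ Progress N w c (fun a b => a < u ∨ (a = u ∧ b < v)) q)
        ⟨⟨It.forest, It.sound⟩, by simpa [Progress, Scanned] using hpt⟩ (by
          rintro v hv q hG ⟨Iq, hpq⟩
          have hq : SearchState N r w pm (q.setReg 18 v) := ht.of_eq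
            (by simp [hG.1 4 (by decide)]) (by simp [hG.2 2 (by decide)])
            (by simp [hG.2 8 (by decide)]) (by simp [hG.2 9 (by decide)])
            (by simp [hG.1 12 (by decide)])
          rw [ht.reg_size] at hv
          rw [hs.reg_size] at hu
          have hid : Idle q (q.setReg 18 v) := ⟨rfl, rfl, by simp⟩
          obtain ⟨g1, g2, g⟩ := scanCmd_spec (u := u) (v := v) D hq
            ⟨Iq.forest, fun h => Iq.sound (by simpa using h)⟩
            (by simp [hG.1 17 (by decide)]) (by simp) hu hv
          refine ⟨g1, ?_⟩
          simp only [setReg_arr] at g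
          rcases g with ⟨g3, g4⟩ | ⟨g3, g4⟩
          · have e10 : (scanCmd.den (q.setReg 18 v)).arr 10 = q.arr 10 := g3.1
            unfold Progress
            rw [e10]
            rcases hpq with h | h | ⟨h1, h2⟩
            · exact Or.inl h
            · exact Or.inr (Or.inl fun a b => ((h a b).of_idle hid).of_idle g3)
            · refine Or.inr (Or.inr ⟨h1, fun a b hab => ?_⟩)
              by_cases hb : a = u ∧ b = v
              · rw [hb.1, hb.2]; exact g4
              · exact ((h2 a b (by omega)).of_idle hid).of_idle g3
          · rcases hpq with h | h | ⟨h1, h2⟩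
            · exact Or.inl (by omega)
            · have := g2 (g3 ((h u v).of_idle hid))
              exact Or.inr (Or.inl fun a b _ _ => Or.inr (Or.inr this))
            · exact Or.inl (by omega))
      rw [ht.reg_size] at key
      refine ⟨key.1, ?_⟩
      rcases key.2 with h | h | ⟨h1, h2⟩
      · exact Or.inl h
      · exact Or.inr (Or.inl h)
      · refine Or.inr (Or.inr ⟨h1, fun a b hab hE => ?_⟩)
        have := hE.2.1
        exact h2 a b (by omega) hE)
  rw [hs.reg_size] at key
  refine ⟨key.1, ?_⟩
  rcases key.2 with h | h | ⟨_, h⟩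
  · exact Or.inr (Or.inr ⟨h, by simp⟩)
  · exact Or.inr (Or.inl h)
  · exact Or.inr (Or.inl fun u v hE => h u v hE.1 hE)

/-- Each unfinished round gains an outer vertex, and the root already is one. As there are at most
`N`, everything is scanned after `N` rounds, and `not_aug` applies unless the flag was raised. -/
theorem searchCmd_spec {N r : ℕ} {w pm : ℕ → ℕ} {s : Store}
    (D : SearchData N r (edgeRel N w) pm) (hs : SearchState N r w pm s) :
    (searchCmd.den s).reg 15 ≠ 0 ↔ Aug N (edgeRel N w) pm r := by
  set s₁ := (Cmd.loop 18 4 (put 10 (var 18) (lit 0) ;; put 11 (var 18) (var 18))).den s with hs₁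
  set s₂ := (s₁.setArr 10 r 1).setReg 15 0 with hs₂
  have f₁ : Frame (Cmd.loop 18 4 (put 10 (var 18) (lit 0) ;; put 11 (var 18) (var 18))) s s₁ :=
    Cmd.frame _ _
  have hr₁ : s₁.reg 12 = r := by rw [f₁.1 12 (by decide), hs.root]
  have e : searchCmd.den s = (Cmd.loop 16 4 (.loop 17 4 (.loop 18 4 scanCmd))).den s₂ := by
    simp [searchCmd, hs₂, ← hs₁, hr₁]
  have key₁ := Cmd.loop_inv (x := 18) (y := 4)
    (p := put 10 (var 18) (lit 0) ;; put 11 (var 18) (var 18)) (s₀ := s)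
    (fun i t => ∀ z < i, t.arr 10 z = 0 ∧ t.arr 11 z = z) (by simp) (by
      intro i _ t _ h z hz
      by_cases hzi : z = i
      · subst hzi; simp
      · simp [hzi, h z (by omega)])
  rw [hs.reg_size, ← hs₁] at key₁
  have hs₂' : SearchState N r w pm s₂ := hs.of_eq
    (by simp [hs₂, f₁.1 4 (by decide)]) (by simp [hs₂, f₁.2 2 (by decide)])
    (by simp [hs₂, f₁.2 8 (by decide)]) (by simp [hs₂, f₁.2 9 (by decide)])
    (by simp [hs₂, f₁.1 12 (by decide)])
  have I₂ : SearchInv N r w pm s₂ := by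
    refine ⟨D.forest_init (fun v hv => ?_) ?_, by simp [hs₂]⟩
    · by_cases hvr : v = r
      · simp [hs₂, hvr]
      · simp [hs₂, hvr, (key₁ v hv).1]
    · simp [hs₂, (key₁ r D.root_lt).2]
  have key := Cmd.loop_inv (x := 16) (y := 4) (p := .loop 17 4 (.loop 18 4 scanCmd)) (s₀ := s₂)
    (fun k t => SearchInv N r w pm t ∧ Progress N w (k + 1) (fun _ _ => False) t)
    ⟨I₂, Or.inr (Or.inr ⟨?_, by simp⟩)⟩ (by
      rintro k _ t hF ⟨It, hp⟩
      have ht : SearchState N r w pm (t.setReg 16 k) := hs₂'.of_eq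
        (by simp [hF.1 4 (by decide)]) (by simp [hF.2 2 (by decide)]) (by simp [hF.2 8 (by decide)])
        (by simp [hF.2 9 (by decide)]) (by simp [hF.1 12 (by decide)])
      exact searchRound_spec D ht ⟨It.forest, fun h => It.sound (by simpa using h)⟩
        (by simpa [Progress, Scanned] using hp))
  · rw [hs₂'.reg_size, ← e] at key
    obtain ⟨I, hp⟩ := key
    refine ⟨I.sound, fun hA => ?_⟩
    by_contra h0
    have hle := outerCount_le N ((searchCmd.den s).arr 10)
    rcases hp with h | h | ⟨h, _⟩
    · omega
    · refine D.not_aug I.forest (fun u hu v hv huv hl => ?_) hA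
      rcases h u v huv hl with h | h | h
      · exact Or.inl h
      · exact Or.inr h
      · exact absurd h0 h
    · omega
  · have : 0 < outerCount N (s₂.arr 10) :=
      Finset.card_pos.2 ⟨r, by simp [hs₂, D.root_lt]⟩
    omega

/-! ### Perfect matchings -/

/-- Delete the edge `{u, v}` if the matching can still be augmented from the root without it. -/
def pruneCmd : Cmd :=
  ite (and (entry 8 2 (var 13) (var 14)) (ne (get 9 (var 13)) (var 14)))
    (put 8 (add (get 2 (var 13)) (var 14)) (lit 0) ;;
      put 8 (add (get 2 (var 14)) (var 13)) (lit 0) ;;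
      searchCmd ;;
      ite (var 15) skip
        (put 8 (add (get 2 (var 13)) (var 14)) (lit 1) ;;
          put 8 (add (get 2 (var 14)) (var 13)) (lit 1)))
    skip

/-- Copy the graph to array 8. -/
def copyCmd : Cmd :=
  .loop 13 4 (.loop 14 4 (put 8 (add (get 2 (var 13)) (var 14)) (entry 7 2 (var 13) (var 14))))

/-- Read off the augmented matching from the pruned graph. -/
def readCmd : Cmd :=
  .loop 13 4 (put 15 (var 13) (get 9 (var 13)) ;;
    .loop 14 4 (ite (and (entry 8 2 (var 13) (var 14)) (ne (get 9 (var 13)) (var 14)))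
      (put 15 (var 13) (var 14)) skip)) ;;
  .loop 13 4 (put 9 (var 13) (get 15 (var 13)))

/-- Augment the matching so that it covers the vertex in register 12. -/
def augmentCmd : Cmd :=
  ite (eq (get 9 (var 12)) (var 12))
    (copyCmd ;; .loop 13 4 (.loop 14 4 pruneCmd) ;; readCmd)
    skip

/-- Compute in array 9 a perfect matching of the graph in array 7, if there is one. -/
def matchCmd : Cmd :=
  .loop 13 4 (put 9 (var 13) (var 13)) ;; .loop 12 4 augmentCmd

theorem IsMat.congr {N : ℕ} {E : ℕ → ℕ → Prop} {f g : ℕ → ℕ} (h : IsMat N E f)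
    (e : ∀ u < N, g u = f u) : IsMat N E g := by
  intro u hu
  obtain ⟨h1, h2, h3⟩ := h u hu
  rw [e u hu, e _ h1]
  exact ⟨h1, h2, h3⟩

theorem IsMat.mono {N : ℕ} {E E' : ℕ → ℕ → Prop} {f : ℕ → ℕ} (h : IsMat N E f)
    (hE : ∀ u v, E u v → E' u v) : IsMat N E' f :=
  fun u hu => ⟨(h u hu).1, (h u hu).2.1, fun hne => hE _ _ ((h u hu).2.2 hne)⟩

theorem Aug.mono {N r : ℕ} {E E' : ℕ → ℕ → Prop} {pm : ℕ → ℕ} (h : Aug N E pm r)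
    (hE : ∀ u v, E u v → E' u v) : Aug N E' pm r := by
  obtain ⟨f, h1, h2⟩ := h
  exact ⟨f, h1.mono hE, h2⟩

/-- The graph without the edge `{a, b}`. -/
def delEdge (E : ℕ → ℕ → Prop) (a b x y : ℕ) : Prop :=
  E x y ∧ ¬ (x = a ∧ y = b) ∧ ¬ (x = b ∧ y = a)

/-- No unmatched edge can be deleted. -/
theorem read_augmented {N r : ℕ} {E : ℕ → ℕ → Prop} {pm ν : ℕ → ℕ}
    (hA : Aug N E pm r) (hmin : ∀ a b, a < N → E a b → pm a ≠ b → ¬ Aug N (delEdge E a b) pm r)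
    (hν : ∀ u < N, (E u (ν u) ∧ pm u ≠ ν u) ∨ ((∀ v, E u v → pm u = v) ∧ ν u = pm u)) :
    ∃ f, IsMat N E f ∧ f r ≠ r ∧ (∀ u < N, pm u ≠ u → f u ≠ u) ∧ ∀ u < N, ν u = f u := by
  obtain ⟨f, hf, hr, hcov⟩ := hA
  refine ⟨f, hf, hr, hcov, fun u hu => ?_⟩
  -- If `f` avoided a remaining unmatched edge, `f` would itself show that the edge can be deleted.
  -- So `f` uses all of them.
  have key : ∀ u < N, ∀ v, E u v → pm u ≠ v → f u = v := by
    intro u hu v huv hne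
    by_contra h
    refine hmin u v hu huv hne ⟨f, fun x hx => ⟨(hf x hx).1, (hf x hx).2.1, fun hx' =>
      ⟨(hf x hx).2.2 hx', ?_, ?_⟩⟩, hr, hcov⟩
    · rintro ⟨rfl, e⟩; exact h e
    · rintro ⟨rfl, e⟩
      exact h (by rw [← e, (hf x hx).2.1])
  rcases hν u hu with ⟨h1, h2⟩ | ⟨h1, h2⟩
  · exact (key u hu _ h1 h2).symm
  -- Here only the matching edge can remain at `u`. If `f` moves `u`, it does so along that edge; if
  -- not, `pm` does not cover `u` either.
  · rw [h2]
    by_cases hfu : f u = u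
    · by_contra h
      exact hcov u hu (fun e => h (by rw [e, hfu])) hfu
    · exact h1 _ ((hf u hu).2.2 hfu)

theorem index_inj {N u v u' v' : ℕ} (hv : v < N) (hv' : v' < N) (h : u * N + v = u' * N + v') :
    u = u' ∧ v = v' := by
  have hN : 0 < N := by omega
  have h1 : (u * N + v) / N = u := by
    rw [Nat.add_comm, Nat.add_mul_div_right _ _ hN, Nat.div_eq_of_lt hv, Nat.zero_add]
  have h2 : (u' * N + v') / N = u' := by
    rw [Nat.add_comm, Nat.add_mul_div_right _ _ hN, Nat.div_eq_of_lt hv', Nat.zero_add]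
  have : u = u' := by rw [← h1, ← h2, h]
  subst this
  exact ⟨rfl, by omega⟩

theorem edgeRel_update {N u v c : ℕ} {w : ℕ → ℕ} (hv : v < N) (x y : ℕ) :
    edgeRel N (Function.update w (u * N + v) c) x y ↔
      x < N ∧ y < N ∧ if x = u ∧ y = v then c ≠ 0 else w (x * N + y) ≠ 0 := by
  unfold edgeRel
  refine and_congr_right fun _ => and_congr_right fun hy => ?_
  by_cases h : x = u ∧ y = v
  · rw [if_pos h, h.1, h.2]; simp
  · rw [if_neg h, Function.update_of_ne]
    intro e
    exact h (index_inj hy hv e)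

theorem edgeRel_delete {N u v : ℕ} {w : ℕ → ℕ} (hu : u < N) (hv : v < N) :
    edgeRel N (Function.update (Function.update w (u * N + v) 0) (v * N + u) 0)
      = delEdge (edgeRel N w) u v := by
  ext x y
  rw [edgeRel_update hu]
  by_cases h2 : x = v ∧ y = u
  · rw [if_pos h2]; exact ⟨fun h => absurd rfl h.2.2, fun h => absurd h2 h.2.2⟩
  rw [if_neg h2]
  change edgeRel N _ x y ↔ _
  rw [edgeRel_update hv]
  by_cases h1 : x = u ∧ y = v
  · rw [if_pos h1]; exact ⟨fun h => absurd rfl h.2.2, fun h => absurd h1 h.2.1⟩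
  rw [if_neg h1]
  exact ⟨fun h => ⟨h, h1, h2⟩, fun h => h.1⟩

/-- The entries come back as 1, whatever they were before. Only whether an entry vanishes matters,
so the relation is recovered even if the matrix is not. -/
theorem edgeRel_restore {N u v : ℕ} {w : ℕ → ℕ} (hu : u < N) (hv : v < N) (h : edgeRel N w u v)
    (h' : edgeRel N w v u) :
    edgeRel N (Function.update (Function.update
      (Function.update (Function.update w (u * N + v) 0) (v * N + u) 0) (u * N + v) 1)
      (v * N + u) 1) = edgeRel N w := by
  ext x y
  rw [edgeRel_update hu]
  by_cases h2 : x = v ∧ y = u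
  · rw [if_pos h2, h2.1, h2.2]; exact ⟨fun _ => h', fun _ => ⟨hv, hu, by decide⟩⟩
  rw [if_neg h2]
  change edgeRel N _ x y ↔ _
  rw [edgeRel_update hv]
  by_cases h1 : x = u ∧ y = v
  · rw [if_pos h1, h1.1, h1.2]; exact ⟨fun _ => h, fun _ => ⟨hu, hv, by decide⟩⟩
  rw [if_neg h1]
  change edgeRel N _ x y ↔ _
  rw [edgeRel_delete hu hv]
  exact ⟨fun h => h.1, fun h => ⟨h, h1, h2⟩⟩

/-- Searches keep these parts of the store. -/
structure MatchState (N : ℕ) (A : ℕ → ℕ) (s : Store) : Prop where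
  reg_size : s.reg 4 = N
  rows : ∀ u < N, s.arr 2 u = u * N
  graph : s.arr 7 = A

theorem MatchState.of_eq {N : ℕ} {A : ℕ → ℕ} {s s' : Store} (h : MatchState N A s)
    (h1 : s'.reg 4 = s.reg 4) (h2 : s'.arr 2 = s.arr 2) (h3 : s'.arr 7 = s.arr 7) :
    MatchState N A s' :=
  ⟨h1.trans h.1, fun u hu => by rw [h2, h.2 u hu], h3.trans h.3⟩

theorem MatchState.of_frame {N : ℕ} {A : ℕ → ℕ} {s s' : Store} {c : Cmd} (h : MatchState N A s)
    (hF : Frame c s s') (h1 : 4 ∉ c.regs) (h2 : 2 ∉ c.arrs) (h3 : 7 ∉ c.arrs) :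
    MatchState N A s' :=
  h.of_eq (hF.1 4 h1) (hF.2 2 h2) (hF.2 7 h3)

/-- The invariant of pruning; the edges in `P` have been considered. -/
structure PruneInv (N r : ℕ) (E : ℕ → ℕ → Prop) (pm : ℕ → ℕ) (P : ℕ → ℕ → Prop) (s : Store) :
    Prop where
  symm : ∀ u v, edgeRel N (s.arr 8) u v → edgeRel N (s.arr 8) v u
  le : ∀ u v, edgeRel N (s.arr 8) u v → E u v
  mates : s.arr 9 = pm
  root : s.reg 12 = r
  mat : IsMat N (edgeRel N (s.arr 8)) pm
  aug : Aug N (edgeRel N (s.arr 8)) pm r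
  minimal : ∀ a b, P a b → edgeRel N (s.arr 8) a b → pm a ≠ b →
    ¬ Aug N (delEdge (edgeRel N (s.arr 8)) a b) pm r

/-- One pass over the edges is enough, because an edge that cannot be spared once cannot be spared
later, when even fewer edges are left. -/
theorem pruneCmd_spec {N r u v : ℕ} {A pm : ℕ → ℕ} {P : ℕ → ℕ → Prop} {s : Store}
    (hirr : ∀ u, ¬ edgeRel N A u u)
    (hs : MatchState N A s) (hr : r < N) (hpr : pm r = r)
    (I : PruneInv N r (edgeRel N A) pm P s) (hu : s.reg 13 = u) (hv : s.reg 14 = v) (huN : u < N)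
    (hvN : v < N) :
    PruneInv N r (edgeRel N A) pm (fun a b => P a b ∨ (a = u ∧ b = v)) (pruneCmd.den s) := by
  by_cases h0 : edgeRel N (s.arr 8) u v ∧ pm u ≠ v
  · obtain ⟨huv, hne⟩ := h0
    have h0' : (and (entry 8 2 (var 13) (var 14)) (ne (get 9 (var 13)) (var 14))).holds s := by
      simpa [entry, hu, hv, hs.rows u huN, I.mates, hne] using huv.2.2
    set w' := Function.update (Function.update (s.arr 8) (u * N + v) 0) (v * N + u) 0 with hw'
    set s₁ := (s.setArr 8 (u * N + v) 0).setArr 8 (v * N + u) 0 with hs₁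
    set s₂ := searchCmd.den s₁ with hs₂
    have e₁ : s₁.arr 8 = w' := by simp [hs₁, hw']
    have f₂ : Frame searchCmd s₁ s₂ := Cmd.frame _ _
    have hdel := edgeRel_delete (w := s.arr 8) huN hvN
    rw [← hw'] at hdel
    have hmat : IsMat N (delEdge (edgeRel N (s.arr 8)) u v) pm := by
      intro x hx
      obtain ⟨g1, g2, g3⟩ := I.mat x hx
      refine ⟨g1, g2, fun h => ⟨g3 h, ?_, ?_⟩⟩
      · rintro ⟨rfl, e⟩; exact hne e
      · rintro ⟨rfl, e⟩
        exact hne (by rw [← e, g2])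
    have hsym : ∀ a b, delEdge (edgeRel N (s.arr 8)) u v a b →
        delEdge (edgeRel N (s.arr 8)) u v b a := by
      rintro a b ⟨h1, h2, h3⟩
      exact ⟨I.symm _ _ h1, fun h => h3 ⟨h.2, h.1⟩, fun h => h2 ⟨h.2, h.1⟩⟩
    have D : SearchData N r (edgeRel N w') pm := by
      rw [hdel]
      exact ⟨hsym, fun a h => hirr a (I.le _ _ h.1), hmat, hr, hpr⟩
    have hst : SearchState N r w' pm s₁ := by
      refine ⟨by simp [hs₁, hs.reg_size], fun a ha => ?_, e₁, ?_, ?_⟩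
      · simp [hs₁, hs.rows a ha]
      · simp [hs₁, I.mates]
      · simp [hs₁, I.root]
    have hsp := searchCmd_spec D hst
    rw [hdel, ← hs₂] at hsp
    have e₂ : s₂.arr 8 = w' := by rw [f₂.2 8 (by decide), e₁]
    have m₂ : s₂.arr 9 = pm := by rw [f₂.2 9 (by decide)]; simp [hs₁, I.mates]
    have r₂ : s₂.reg 12 = r := by rw [f₂.1 12 (by decide)]; simp [hs₁, I.root]
    have u₂ : s₂.reg 13 = u := by rw [f₂.1 13 (by decide)]; simp [hs₁, hu]
    have v₂ : s₂.reg 14 = v := by rw [f₂.1 14 (by decide)]; simp [hs₁, hv]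
    have rows₂ : ∀ a < N, s₂.arr 2 a = a * N := by
      intro a ha; rw [f₂.2 2 (by decide)]; simp [hs₁, hs.rows a ha]
    have e : pruneCmd.den s = (ite (var 15) skip
        (put 8 (add (get 2 (var 13)) (var 14)) (lit 1) ;;
          put 8 (add (get 2 (var 14)) (var 13)) (lit 1))).den s₂ := by
      rw [pruneCmd, den_ite_pos _ h0']
      simp [hs₂, hs₁, hu, hv, hs.rows u huN, hs.rows v hvN]
    rw [e]
    by_cases h15 : s₂.reg 15 ≠ 0
    · rw [den_ite_pos _ (by simpa using h15), den_skip]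
      refine ⟨?_, ?_, m₂, r₂, ?_, ?_, ?_⟩ <;> rw [e₂, hdel]
      · exact hsym
      · exact fun a b h => I.le a b h.1
      · exact hmat
      · exact hsp.1 h15
      · rintro a b (h | ⟨rfl, rfl⟩) hE hab
        · intro hA
          -- An augmentation in the smaller graph without `{a, b}` would be one in the earlier graph
          -- without `{a, b}`.
          refine I.minimal a b h hE.1 hab (hA.mono ?_)
          rintro x y ⟨h1, h2⟩
          exact ⟨h1.1, h2⟩
        · exact absurd ⟨rfl, rfl⟩ hE.2.1
    · have hres : edgeRel N (((s₂.setArr 8 (u * N + v) 1).setArr 8 (v * N + u) 1).arr 8)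
          = edgeRel N (s.arr 8) := by
        have := edgeRel_restore huN hvN huv (I.symm _ _ huv)
        rw [← hw'] at this
        simpa [e₂] using this
      have e' : (ite (var 15) skip (put 8 (add (get 2 (var 13)) (var 14)) (lit 1) ;;
          put 8 (add (get 2 (var 14)) (var 13)) (lit 1))).den s₂
          = (s₂.setArr 8 (u * N + v) 1).setArr 8 (v * N + u) 1 := by
        rw [den_ite_neg _ (by simpa using h15)]
        simp [u₂, v₂, rows₂ u huN, rows₂ v hvN]
      rw [e']
      refine ⟨?_, ?_, by simp [m₂], by simp [r₂], ?_, ?_, ?_⟩ <;> rw [hres]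
      · exact I.symm
      · exact I.le
      · exact I.mat
      · exact I.aug
      · rintro a b (h | ⟨rfl, rfl⟩)
        · exact I.minimal a b h
        · exact fun _ _ hA => h15 (hsp.2 hA)
  · have h0' : ¬ (and (entry 8 2 (var 13) (var 14)) (ne (get 9 (var 13)) (var 14))).holds s := by
      intro h
      simp only [entry, holds_and, holds_get, holds_ne, eval_add, eval_get, eval_var, hu,
        hv, hs.rows u huN, I.mates] at h
      exact h0 ⟨⟨huN, hvN, h.1⟩, h.2⟩
    rw [pruneCmd, den_ite_neg _ h0', den_skip]
    refine ⟨I.symm, I.le, I.mates, I.root, I.mat, I.aug, ?_⟩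
    rintro a b (h | ⟨rfl, rfl⟩)
    · exact I.minimal a b h
    · exact fun h1 h2 => absurd ⟨h1, h2⟩ h0

theorem copyCmd_spec {N : ℕ} {A : ℕ → ℕ} {s : Store} (hs : MatchState N A s) :
    edgeRel N ((copyCmd.den s).arr 8) = edgeRel N A := by
  have key := Cmd.loop_inv (x := 13) (y := 4) (p := .loop 14 4
      (put 8 (add (get 2 (var 13)) (var 14)) (entry 7 2 (var 13) (var 14)))) (s₀ := s)
    (fun u t => ∀ a < u, ∀ b < N, t.arr 8 (a * N + b) = A (a * N + b)) (by simp) (by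
      rintro u hu t hF It
      rw [hs.reg_size] at hu
      have ht : MatchState N A t := hs.of_frame hF (by decide) (by decide) (by decide)
      have key := Cmd.loop_inv (x := 14) (y := 4)
        (p := put 8 (add (get 2 (var 13)) (var 14)) (entry 7 2 (var 13) (var 14)))
        (s₀ := t.setReg 13 u)
        (fun v q => (∀ a < u, ∀ b < N, q.arr 8 (a * N + b) = A (a * N + b)) ∧
          ∀ b < v, q.arr 8 (u * N + b) = A (u * N + b)) (by simpa using It) (by
          rintro v hv q hG ⟨h1, h2⟩
          have hv : v < N := by simpa [ht.reg_size] using hv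
          have e13 : q.reg 13 = u := by rw [hG.1 13 (by decide)]; simp
          have e2 : q.arr 2 u = u * N := by rw [hG.2 2 (by decide)]; simp [ht.rows u hu]
          have e7 : q.arr 7 = A := by rw [hG.2 7 (by decide)]; simp [ht.graph]
          refine ⟨fun a ha b hb => ?_, fun b hb => ?_⟩
          · have : a * N + b ≠ u * N + v := fun e => by have := index_inj hb hv e; omega
            simp [e13, e2, this, h1 a ha b hb]
          · by_cases hbv : b = v
            · simp [entry, e13, e2, e7, hbv]
            · have : u * N + b ≠ u * N + v := by omega
              simp [e13, e2, hbv, h2 b (by omega)])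
      have hN : (t.setReg 13 u).reg 4 = N := by simp [ht.reg_size]
      rw [hN] at key
      intro a ha b hb
      by_cases hau : a = u
      · rw [hau]; exact key.2 b hb
      · exact key.1 a (by omega) b hb)
  rw [hs.reg_size] at key
  ext a b
  unfold edgeRel
  refine and_congr_right fun ha => and_congr_right fun hb => ?_
  rw [copyCmd, key a ha b hb]

/-- The new mates are collected in array 15 because the tests compare with the old mate throughout.
-/
theorem readCmd_spec {N : ℕ} {A : ℕ → ℕ} {s : Store} (hs : MatchState N A s) : ∀ u < N,
    (edgeRel N (s.arr 8) u ((readCmd.den s).arr 9 u) ∧ s.arr 9 u ≠ (readCmd.den s).arr 9 u) ∨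
      ((∀ v, edgeRel N (s.arr 8) u v → s.arr 9 u = v) ∧ (readCmd.den s).arr 9 u = s.arr 9 u) := by
  set c := Cmd.loop 13 4 (put 15 (var 13) (get 9 (var 13)) ;;
    .loop 14 4 (ite (and (entry 8 2 (var 13) (var 14)) (ne (get 9 (var 13)) (var 14)))
      (put 15 (var 13) (var 14)) skip)) with hc
  have f₁ : Frame c s (c.den s) := Cmd.frame _ _
  have key := Cmd.loop_inv (x := 13) (y := 4) (p := put 15 (var 13) (get 9 (var 13)) ;;
    .loop 14 4 (ite (and (entry 8 2 (var 13) (var 14)) (ne (get 9 (var 13)) (var 14)))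
      (put 15 (var 13) (var 14)) skip)) (s₀ := s)
    (fun u t => ∀ a < u, (edgeRel N (s.arr 8) a (t.arr 15 a) ∧ s.arr 9 a ≠ t.arr 15 a) ∨
      ((∀ v, edgeRel N (s.arr 8) a v → s.arr 9 a = v) ∧ t.arr 15 a = s.arr 9 a)) (by simp) (by
      rintro u hu t hF It
      rw [hs.reg_size] at hu
      have ht : MatchState N A t := hs.of_frame hF (by decide) (by decide) (by decide)
      have e8 := hF.2 8 (by decide)
      have e9 := hF.2 9 (by decide)
      set t₁ := (t.setReg 13 u).setArr 15 u (s.arr 9 u) with ht₁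
      have key := Cmd.loop_inv (x := 14) (y := 4)
        (p := ite (and (entry 8 2 (var 13) (var 14)) (ne (get 9 (var 13)) (var 14)))
          (put 15 (var 13) (var 14)) skip) (s₀ := t₁)
        (fun v q => (∀ a, a ≠ u → q.arr 15 a = t.arr 15 a) ∧
          ((edgeRel N (s.arr 8) u (q.arr 15 u) ∧ s.arr 9 u ≠ q.arr 15 u) ∨
      ((∀ b < v, edgeRel N (s.arr 8) u b → s.arr 9 u = b) ∧ q.arr 15 u = s.arr 9 u))) (by
          refine ⟨fun a ha => ?_, Or.inr ⟨by simp, ?_⟩⟩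
          · simp [ht₁, ha]
          · simp [ht₁]) (by
          rintro v hv q hG ⟨h1, h2⟩
          have hv : v < N := by simpa [ht₁, ht.reg_size] using hv
          have g13 : q.reg 13 = u := by rw [hG.1 13 (by decide)]; simp [ht₁]
          have g2 : q.arr 2 u = u * N := by rw [hG.2 2 (by decide)]; simp [ht₁, ht.rows u hu]
          have g8 : q.arr 8 = s.arr 8 := by rw [hG.2 8 (by decide)]; simp [ht₁, e8]
          have g9 : q.arr 9 = s.arr 9 := by rw [hG.2 9 (by decide)]; simp [ht₁, e9]
          have hiff : (and (entry 8 2 (var 13) (var 14)) (ne (get 9 (var 13)) (var 14))).holds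
              (q.setReg 14 v) ↔ edgeRel N (s.arr 8) u v ∧ s.arr 9 u ≠ v := by
            simp [entry, g13, g2, g8, g9, edgeRel, hu, hv]
          by_cases h : edgeRel N (s.arr 8) u v ∧ s.arr 9 u ≠ v
          · rw [den_ite_pos _ (hiff.2 h)]
            refine ⟨fun a ha => ?_, Or.inl ?_⟩
            · simp [g13, ha, h1 a ha]
            · simpa [g13] using h
          · rw [den_ite_neg _ (fun h' => h (hiff.1 h')), den_skip]
            refine ⟨fun a ha => by simp [h1 a ha], ?_⟩
            rcases h2 with h2 | ⟨h2, h3⟩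
            · exact Or.inl (by simpa using h2)
            · refine Or.inr ⟨fun b hb hE => ?_, by simpa using h3⟩
              by_cases hbv : b = v
              · subst hbv; exact not_not.1 fun hne => h ⟨hE, hne⟩
              · exact h2 b (by omega) hE)
      have hN : t₁.reg 4 = N := by simp [ht₁, ht.reg_size]
      rw [hN] at key
      have e : (put 15 (var 13) (get 9 (var 13)) ;;
    .loop 14 4 (ite (and (entry 8 2 (var 13) (var 14)) (ne (get 9 (var 13)) (var 14)))
      (put 15 (var 13) (var 14)) skip)).den (t.setReg 13 u) =
        (Cmd.loop 14 4 (ite (and (entry 8 2 (var 13) (var 14)) (ne (get 9 (var 13)) (var 14)))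
      (put 15 (var 13) (var 14)) skip)).den t₁ := by
        simp [ht₁, e9]
      rw [e]
      intro a ha
      by_cases hau : a = u
      · rw [hau]
        rcases key.2 with h | ⟨h, h'⟩
        · exact Or.inl h
        · exact Or.inr ⟨fun v hE => h v hE.2.1 hE, h'⟩
      · rw [key.1 a hau]; exact It a (by omega))
  rw [hs.reg_size, ← hc] at key
  have hN₁ : (c.den s).reg 4 = N := by rw [f₁.1 4 (by decide), hs.reg_size]
  have key₂ := Cmd.loop_inv (x := 13) (y := 4) (p := put 9 (var 13) (get 15 (var 13)))
    (s₀ := c.den s) (fun u t => ∀ a < u, t.arr 9 a = (c.den s).arr 15 a) (by simp) (by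
      rintro u _ t hF It a ha
      have e15 := hF.2 15 (by decide)
      by_cases hau : a = u
      · subst hau; simp [e15]
      · simp [hau, It a (by omega)])
  rw [hN₁] at key₂
  have e : readCmd.den s = (Cmd.loop 13 4 (put 9 (var 13) (get 15 (var 13)))).den (c.den s) := by
    simp [readCmd, hc]
  intro u hu
  rw [e, key₂ u hu]
  exact key u hu

/-- The hypothesis of a perfect matching makes every exposed vertex coverable at once: the perfect
matching itself witnesses `Aug`. Hence Berge's theorem is not needed. -/
theorem augmentCmd_spec {N r : ℕ} {A : ℕ → ℕ} {s : Store} (hs : MatchState N A s)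
    (hsymm : ∀ u v, edgeRel N A u v → edgeRel N A v u) (hirr : ∀ u, ¬ edgeRel N A u u)
    (hr : s.reg 12 = r) (hrN : r < N) (hm : IsMat N (edgeRel N A) (s.arr 9))
    (hperf : ∃ f, IsMat N (edgeRel N A) f ∧ ∀ u < N, f u ≠ u) :
    IsMat N (edgeRel N A) ((augmentCmd.den s).arr 9) ∧ (augmentCmd.den s).arr 9 r ≠ r ∧
      ∀ u < N, s.arr 9 u ≠ u → (augmentCmd.den s).arr 9 u ≠ u := by
  by_cases h0 : s.arr 9 r = r
  · set s₁ := copyCmd.den s with hs₁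
    set s₂ := (Cmd.loop 13 4 (.loop 14 4 pruneCmd)).den s₁ with hs₂
    have e : augmentCmd.den s = readCmd.den s₂ := by
      rw [augmentCmd, den_ite_pos _ (by simpa [hr] using h0)]
      simp [hs₂, hs₁]
    have f₁ : Frame copyCmd s s₁ := Cmd.frame _ _
    have f₂ : Frame (Cmd.loop 13 4 (.loop 14 4 pruneCmd)) s₁ s₂ := Cmd.frame _ _
    have hs₁' : MatchState N A s₁ := hs.of_frame f₁ (by decide) (by decide) (by decide)
    have hs₂' : MatchState N A s₂ := hs₁'.of_frame f₂ (by decide) (by decide) (by decide)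
    have e8 : edgeRel N (s₁.arr 8) = edgeRel N A := copyCmd_spec hs
    have I₁ : PruneInv N r (edgeRel N A) (s.arr 9) (fun _ _ => False) s₁ := by
      obtain ⟨f, hf, hf'⟩ := hperf
      refine ⟨by rwa [e8], fun u v h => by rwa [e8] at h, f₁.2 9 (by decide),
        by rw [f₁.1 12 (by decide), hr], by rwa [e8], ?_, fun _ _ h => h.elim⟩
      rw [e8]
      exact ⟨f, hf, hf' r hrN, fun u hu _ => hf' u hu⟩
    have congrP : ∀ {P Q : ℕ → ℕ → Prop} {t t' : Store},
        PruneInv N r (edgeRel N A) (s.arr 9) P t → t'.arr 8 = t.arr 8 → t'.arr 9 = t.arr 9 →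
        t'.reg 12 = t.reg 12 → (∀ a b, a < N → b < N → Q a b → P a b) →
        PruneInv N r (edgeRel N A) (s.arr 9) Q t' := by
      rintro P Q t t' I h8 h9 h12 hPQ
      refine ⟨by rw [h8]; exact I.symm, by rw [h8]; exact I.le, h9.trans I.mates,
        h12.trans I.root, by rw [h8]; exact I.mat, by rw [h8]; exact I.aug, ?_⟩
      rw [h8]
      exact fun a b hab hE => I.minimal a b (hPQ a b hE.1 hE.2.1 hab) hE
    have key := Cmd.loop_inv (x := 13) (y := 4) (p := .loop 14 4 pruneCmd) (s₀ := s₁)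
      (fun u t => PruneInv N r (edgeRel N A) (s.arr 9) (fun a _ => a < u) t)
      (congrP I₁ rfl rfl rfl (by simp)) (by
        rintro u hu t hF It
        rw [hs₁'.reg_size] at hu
        have ht : MatchState N A (t.setReg 13 u) :=
          (hs₁'.of_frame hF (by decide) (by decide) (by decide)).of_eq (by simp) rfl rfl
        have key := Cmd.loop_inv (x := 14) (y := 4) (p := pruneCmd) (s₀ := t.setReg 13 u)
          (fun v q => PruneInv N r (edgeRel N A) (s.arr 9) (fun a b => a < u ∨ (a = u ∧ b < v)) q)
          (congrP It rfl rfl (by simp) (by simp)) (by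
            rintro v hv q hG Iq
            rw [ht.reg_size] at hv
            have hq : MatchState N A (q.setReg 14 v) :=
              (ht.of_frame hG (by decide) (by decide) (by decide)).of_eq (by simp) rfl rfl
            have := pruneCmd_spec (u := u) (v := v) hirr hq hrN h0
              (congrP (Q := fun a b => a < u ∨ (a = u ∧ b < v)) Iq rfl rfl (by simp)
                (fun _ _ _ _ h => h))
              (by simp [hG.1 13 (by decide)]) (by simp) hu hv
            exact congrP this rfl rfl rfl (fun a b _ _ h => by omega))
        rw [ht.reg_size] at key
        exact congrP key rfl rfl rfl (fun a b _ hb h => by omega))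
    rw [hs₁'.reg_size, ← hs₂] at key
    have hν := readCmd_spec hs₂'
    rw [← e, key.mates] at hν
    obtain ⟨f, h1, h2, h3, h4⟩ := read_augmented key.aug
      (fun a b ha hE hab => key.minimal a b ha hE hab) hν
    refine ⟨(h1.mono key.le).congr h4, ?_, fun u hu hne => ?_⟩
    · rw [h4 r hrN]; exact h2
    · rw [h4 u hu]; exact h3 u hu hne
  · rw [augmentCmd, den_ite_neg _ (by simpa [hr] using h0), den_skip]
    exact ⟨hm, h0, fun _ _ h => h⟩

theorem matchCmd_spec {N : ℕ} {A : ℕ → ℕ} {s : Store} (hs : MatchState N A s)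
    (hsymm : ∀ u v, edgeRel N A u v → edgeRel N A v u) (hirr : ∀ u, ¬ edgeRel N A u u)
    (hperf : ∃ f, IsMat N (edgeRel N A) f ∧ ∀ u < N, f u ≠ u) :
    IsMat N (edgeRel N A) ((matchCmd.den s).arr 9) ∧ ∀ u < N, (matchCmd.den s).arr 9 u ≠ u := by
  set s₁ := (Cmd.loop 13 4 (put 9 (var 13) (var 13))).den s with hs₁
  have f₁ : Frame (Cmd.loop 13 4 (put 9 (var 13) (var 13))) s s₁ := Cmd.frame _ _
  have hs₁' : MatchState N A s₁ := hs.of_frame f₁ (by decide) (by decide) (by decide)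
  have key₁ := Cmd.loop_inv (x := 13) (y := 4) (p := put 9 (var 13) (var 13)) (s₀ := s)
    (fun u t => ∀ a < u, t.arr 9 a = a) (by simp) (by
      rintro u _ t _ It a ha
      by_cases hau : a = u
      · subst hau; simp
      · simp [hau, It a (by omega)])
  rw [hs.reg_size, ← hs₁] at key₁
  have key := Cmd.loop_inv (x := 12) (y := 4) (p := augmentCmd) (s₀ := s₁)
    (fun r t => IsMat N (edgeRel N A) (t.arr 9) ∧ ∀ u < r, t.arr 9 u ≠ u)
    ⟨fun u hu => ?_, by simp⟩ (by
      rintro r hr t hF ⟨h1, h2⟩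
      rw [hs₁'.reg_size] at hr
      have ht : MatchState N A (t.setReg 12 r) :=
        (hs₁'.of_frame hF (by decide) (by decide) (by decide)).of_eq (by simp) rfl rfl
      obtain ⟨g1, g2, g3⟩ := augmentCmd_spec (r := r) ht hsymm hirr (by simp) hr h1 hperf
      refine ⟨g1, fun u hu => ?_⟩
      by_cases hur : u = r
      · rw [hur]; exact g2
      · exact g3 u (by omega) (h2 u (by omega)))
  · rw [hs₁'.reg_size] at key
    exact key
  · rw [key₁ u hu, key₁ u hu]
    exact ⟨hu, rfl, fun h => absurd rfl h⟩

/-! ### Instances over the natural numbers -/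

open Classical in
/-- The number of layers with the property `p`. -/
noncomputable def layerCount (ℓ : ℕ) (p : ℕ → Prop) : ℕ := ((Finset.range ℓ).filter p).card

theorem layerCount_zero (p : ℕ → Prop) : layerCount 0 p = 0 := by simp [layerCount]

theorem layerCount_succ_of_pos {ℓ : ℕ} {p : ℕ → Prop} (h : p ℓ) :
    layerCount (ℓ + 1) p = layerCount ℓ p + 1 := by
  classical
  rw [layerCount, Finset.range_add_one, Finset.filter_insert, if_pos h,
    Finset.card_insert_of_notMem (by simp)]
  rfl

theorem layerCount_succ_of_neg {ℓ : ℕ} {p : ℕ → Prop} (h : ¬ p ℓ) :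
    layerCount (ℓ + 1) p = layerCount ℓ p := by
  classical
  rw [layerCount, Finset.range_add_one, Finset.filter_insert, if_neg h]
  rfl

theorem layerCount_mono {ℓ : ℕ} {p q : ℕ → Prop} (h : ∀ i < ℓ, p i → q i) :
    layerCount ℓ p ≤ layerCount ℓ q := by
  classical
  refine Finset.card_le_card fun i hi => ?_
  simp only [Finset.mem_filter, Finset.mem_range] at hi ⊢
  exact ⟨hi.1, h i hi.1 hi.2⟩

theorem layerCount_of_forall {ℓ : ℕ} {p : ℕ → Prop} (h : ∀ i < ℓ, p i) : layerCount ℓ p = ℓ := by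
  classical
  rw [layerCount, Finset.filter_true_of_mem (by simpa using h), Finset.card_range]

theorem exists_of_layerCount {ℓ : ℕ} {p : ℕ → Prop} (h : 1 ≤ layerCount ℓ p) : ∃ i < ℓ, p i := by
  classical
  obtain ⟨i, hi⟩ := Finset.card_pos.1 h
  simp only [Finset.mem_filter, Finset.mem_range] at hi
  exact ⟨i, hi⟩

/-- A matching of the agents below `n`, as an involution. -/
def Invol (n : ℕ) (m : ℕ → ℕ) : Prop := ∀ a < n, m a < n ∧ m (m a) = a

/-- Agent `a` is happy in layer `i`. -/
def hap (app : ℕ → ℕ → ℕ → Prop) (m : ℕ → ℕ) (i a : ℕ) : Prop := m a ≠ a ∧ app i a (m a)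

/-- The pair `{a, b}` blocks in layer `i`, for symmetric approvals. -/
def blk (σ : Base) (app : ℕ → ℕ → ℕ → Prop) (m : ℕ → ℕ) (i a b : ℕ) : Prop :=
  a ≠ b ∧ m a ≠ b ∧
    match σ with
    | Base.weak => app i a b ∧ ¬ hap app m i a ∧ ¬ hap app m i b
    | Base.strong => app i a b ∧ ¬ (hap app m i a ∧ hap app m i b)
    | Base.super => app i a b ∨ (¬ hap app m i a ∧ ¬ hap app m i b)

/-- The multilayer stability notions, for symmetric approvals. -/
def nstable (n ℓ α : ℕ) (app : ℕ → ℕ → ℕ → Prop) (m : ℕ → ℕ) : Notion → Prop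
  | Notion.global σ => α ≤ layerCount ℓ fun i => ∀ a < n, ∀ b < n, ¬ blk σ app m i a b
  | Notion.pair σ => ∀ a < n, ∀ b < n, a ≠ b → α ≤ layerCount ℓ fun i => ¬ blk σ app m i a b
  | Notion.individualWeak => ∀ a < n, ∀ b < n, a ≠ b → m a ≠ b →
      (α ≤ layerCount ℓ fun i => ¬ app i a b ∨ hap app m i a) ∨
      (α ≤ layerCount ℓ fun i => ¬ app i b a ∨ hap app m i b)
  | Notion.individualSuper => ∀ a < n, ∀ b < n, a ≠ b → m a ≠ b →
      (α ≤ layerCount ℓ fun i => ¬ app i a b ∧ hap app m i a) ∨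
      (α ≤ layerCount ℓ fun i => ¬ app i b a ∧ hap app m i b)

theorem blk_congr {σ : Base} {n i a b : ℕ} {app : ℕ → ℕ → ℕ → Prop} {m m' : ℕ → ℕ}
    (h : ∀ a < n, m' a = m a) (ha : a < n) (hb : b < n) :
    blk σ app m' i a b ↔ blk σ app m i a b := by
  unfold blk hap
  rw [h a ha, h b hb]

theorem nstable_congr {n ℓ α : ℕ} {app : ℕ → ℕ → ℕ → Prop} {m m' : ℕ → ℕ}
    (h : ∀ a < n, m' a = m a) {N : Notion} (hN : nstable n ℓ α app m N) :
    nstable n ℓ α app m' N := by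
  cases N with
  | global σ =>
    refine le_trans hN (layerCount_mono fun i _ hi a ha b hb => ?_)
    rw [blk_congr h ha hb]; exact hi a ha b hb
  | pair σ =>
    intro a ha b hb hab
    refine le_trans (hN a ha b hb hab) (layerCount_mono fun i _ hi => ?_)
    rwa [blk_congr h ha hb]
  | individualWeak =>
    intro a ha b hb hab hm
    have := hN a ha b hb hab (by rwa [h a ha] at hm)
    simpa only [hap, h a ha, h b hb] using this
  | individualSuper =>
    intro a ha b hb hab hm
    have := hN a ha b hb hab (by rwa [h a ha] at hm)
    simpa only [hap, h a ha, h b hb] using this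

/-- Symmetric approvals, the same in all layers for the agents that do not satisfy `chg`. -/
structure Sys (n ℓ : ℕ) (app : ℕ → ℕ → ℕ → Prop) (chg : ℕ → Prop) : Prop where
  pos : 0 < ℓ
  symm : ∀ i < ℓ, ∀ a < n, ∀ b < n, app i a b → app i b a
  const : ∀ a < n, ¬ chg a → ∀ i < ℓ, ∀ b < n, (app i a b ↔ app 0 a b)

/-- The changing agent `c` is matched to an unchanging agent that it approves. -/
def isOut (app : ℕ → ℕ → ℕ → Prop) (chg : ℕ → Prop) (m : ℕ → ℕ) (c : ℕ) : Prop :=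
  chg c ∧ m c ≠ c ∧ ¬ chg (m c) ∧ app 0 c (m c)

/-- All unchanging agents that `c` approves are happy. -/
def nbrsHappy (n : ℕ) (app : ℕ → ℕ → ℕ → Prop) (chg : ℕ → Prop) (m : ℕ → ℕ) (c : ℕ) : Prop :=
  ∀ u < n, ¬ chg u → u ≠ c → app 0 u c → hap app m 0 u

/-- All unchanging agents that approve somebody are happy. -/
def allHappy (n : ℕ) (app : ℕ → ℕ → ℕ → Prop) (chg : ℕ → Prop) (m : ℕ → ℕ) : Prop :=
  ∀ u < n, ¬ chg u → (∃ b < n, b ≠ u ∧ app 0 u b) → hap app m 0 u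

/-- The unchanging agent `u` has to be happy. -/
def isNeeded (n : ℕ) (app : ℕ → ℕ → ℕ → Prop) (chg : ℕ → Prop) (m : ℕ → ℕ) (u : ℕ) : Prop :=
  ∃ b < n, b ≠ u ∧ app 0 u b ∧ (allHappy n app chg m ∨ (chg b ∧ nbrsHappy n app chg m b))

/-- The marking demands only what `M` already satisfies, which is why the matching problem posed
later has a solution. -/
theorem hap_of_isNeeded {n : ℕ} {app : ℕ → ℕ → ℕ → Prop} {chg : ℕ → Prop} {m : ℕ → ℕ} {u : ℕ}
    (hu : u < n) (hc : ¬ chg u) (h : isNeeded n app chg m u) : hap app m 0 u := by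
  obtain ⟨b, hb, hbu, hab, h | ⟨_, h⟩⟩ := h
  · exact h u hu hc ⟨b, hb, hbu, hab⟩
  · exact h u hu hc (Ne.symm hbu) hab

/-- What the reconstruction of a matching from the right guess about the stable matching `M`
provides: `m₂` is the matching before arbitrary agents are paired up, and `m` the result. -/
structure Rebuilt (n : ℕ) (app : ℕ → ℕ → ℕ → Prop) (chg : ℕ → Prop) (M m₂ m : ℕ → ℕ) : Prop where
  invol_mid : Invol n m₂
  invol : Invol n m
  extends_mid : ∀ a < n, m₂ a ≠ a → m a = m₂ a
  maximal : ∀ a < n, ∀ b < n, a ≠ b → m a ≠ a ∨ m b ≠ b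
  source : ∀ a < n, m₂ a ≠ a → (chg a ∧ chg (m₂ a) ∧ m₂ a = M a) ∨
    (app 0 a (m₂ a) ∧ ¬ (chg a ∧ chg (m₂ a)))
  out : ∀ c < n, isOut app chg M c → m₂ c ≠ c
  inside : ∀ c < n, chg c → chg (M c) → m₂ c = M c
  needed : ∀ u < n, ¬ chg u → isNeeded n app chg M u → m₂ u ≠ u
  cover : ∀ u < n, ∀ v < n, ¬ chg u → ¬ chg v → u ≠ v → app 0 u v → m₂ u ≠ u ∨ m₂ v ≠ v

/-! ### Stability of the rebuilt matching. -/

namespace Sys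

variable {n ℓ α : ℕ} {app : ℕ → ℕ → ℕ → Prop} {chg : ℕ → Prop} {M m₂ m : ℕ → ℕ}

/-- If `a` is changing, then `b` is not, and symmetry lets the approval be read from the side of
`b`. -/
theorem const' (S : Sys n ℓ app chg) {a b i : ℕ} (ha : a < n) (hb : b < n) (hi : i < ℓ)
    (h : ¬ (chg a ∧ chg b)) : app i a b ↔ app 0 a b := by
  by_cases hc : chg a
  · have hcb : ¬ chg b := fun h' => h ⟨hc, h'⟩
    constructor
    · exact fun h' => S.symm 0 S.pos _ hb _ ha ((S.const b hb hcb i hi a ha).1 (S.symm i hi _ ha _ hb h'))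
    · exact fun h' => S.symm i hi _ hb _ ha
        ((S.const b hb hcb i hi a ha).2 (S.symm 0 S.pos _ ha _ hb h'))
  · exact S.const a ha hc i hi b hb

theorem hap_const (S : Sys n ℓ app chg) (hM : Invol n M) {u i : ℕ} (hu : u < n) (hi : i < ℓ)
    (hc : ¬ chg u) : hap app M i u ↔ hap app M 0 u :=
  and_congr_right fun _ => S.const u hu hc i hi _ (hM u hu).1

/-- A changing partner is kept. An unchanging partner is approved in all layers alike, so `c` counts
as matched outwards and is covered by an approved pair, again in all layers. -/
theorem hap_changing (S : Sys n ℓ app chg) (hM : Invol n M) (R : Rebuilt n app chg M m₂ m)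
    {c i : ℕ} (hc : c < n) (hcc : chg c) (hi : i < ℓ) (h : hap app M i c) : hap app m i c := by
  by_cases hp : chg (M c)
  · have e := R.inside c hc hcc hp
    have hne : m₂ c ≠ c := by rw [e]; exact h.1
    have := R.extends_mid c hc hne
    unfold hap
    rw [this, e]
    exact h
  · have h0 : app 0 c (M c) := (S.const' hc (hM c hc).1 hi (fun h => hp h.2)).1 h.2
    have hne := R.out c hc ⟨hcc, h.1, hp, h0⟩
    unfold hap
    rw [R.extends_mid c hc hne]
    refine ⟨hne, ?_⟩
    rcases R.source c hc hne with ⟨_, h1, h2⟩ | ⟨h1, h2⟩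
    · exact absurd (h2 ▸ h1) hp
    · exact (S.const' hc (R.invol_mid c hc).1 hi h2).2 h1

/-- Before arbitrary pairs are added, an unchanging agent is only ever matched along an approved
pair, whose approval holds in all layers. -/
theorem hap_unchanging (S : Sys n ℓ app chg) (R : Rebuilt n app chg M m₂ m) {u i : ℕ} (hu : u < n)
    (huc : ¬ chg u) (hi : i < ℓ) (h : m₂ u ≠ u) : hap app m i u := by
  unfold hap
  rw [R.extends_mid u hu h]
  refine ⟨h, ?_⟩
  rcases R.source u hu h with ⟨h1, _⟩ | ⟨h1, h2⟩
  · exact absurd h1 huc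
  · exact (S.const' hu (R.invol_mid u hu).1 hi h2).2 h1

/-- An edge between an unchanging and a changing agent: either the unchanging agent is always happy,
or the changing agent has an unhappy unchanging neighbour in `M`. -/
theorem mixed_edge (S : Sys n ℓ app chg) (R : Rebuilt n app chg M m₂ m) {u c : ℕ}
    (hu : u < n) (huc : ¬ chg u) (hc : c < n) (hcc : chg c) (h : app 0 u c) :
    (∀ i < ℓ, hap app m i u) ∨
      ∃ v < n, ¬ chg v ∧ v ≠ c ∧ app 0 v c ∧ ¬ hap app M 0 v := by
  have hne : c ≠ u := fun e => huc (e ▸ hcc)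
  by_cases hq : nbrsHappy n app chg M c
  · exact Or.inl fun i hi => S.hap_unchanging R hu huc hi
      (R.needed u hu huc ⟨c, hc, hne, h, Or.inr ⟨hcc, hq⟩⟩)
  · right
    unfold nbrsHappy at hq
    push Not at hq
    obtain ⟨v, h1, h2, h3, h4, h5⟩ := hq
    exact ⟨v, h1, h2, h3, h4, h5⟩

theorem both_edge (S : Sys n ℓ app chg) (R : Rebuilt n app chg M m₂ m) {u v : ℕ}
    (hu : u < n) (huc : ¬ chg u) (hv : v < n) (hvc : ¬ chg v) (hne : u ≠ v) (h : app 0 u v) :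
    (∀ i < ℓ, hap app m i u) ∨ ∀ i < ℓ, hap app m i v := by
  rcases R.cover u hu v hv huc hvc hne h with h | h
  · exact Or.inl fun i hi => S.hap_unchanging R hu huc hi h
  · exact Or.inr fun i hi => S.hap_unchanging R hv hvc hi h

theorem mate_ne_of_not_hap {i a b : ℕ} (hab : a ≠ b) (h : app i a b) (hh : ¬ hap app M i a) :
    M a ≠ b := by
  rintro rfl
  exact hh ⟨Ne.symm hab, h⟩

/-- A layer that is stable for `M` is stable for `m`. For a mixed pair `{u, c}` blocking `m`, the
agent `v` of `mixed_edge` is unhappy in `M` and approves `c` in every layer, and `c` is unhappy in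
`M` since it is unhappy in `m`; so `{v, c}` blocks `M`. -/
theorem global_weak (S : Sys n ℓ app chg) (hM : Invol n M) (R : Rebuilt n app chg M m₂ m)
    (h : nstable n ℓ α app M (Notion.global Base.weak)) :
    nstable n ℓ α app m (Notion.global Base.weak) := by
  refine le_trans h (layerCount_mono fun i hi hst => ?_)
  have mixed : ∀ u < n, ¬ chg u → ∀ c < n, chg c → app i u c → ¬ hap app m i u →
      ¬ hap app m i c → False := by
    intro u hu huc c hc hcc hE h1 h2
    rcases S.mixed_edge R hu huc hc hcc ((S.const u hu huc i hi c hc).1 hE) with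
      h | ⟨v, hv, hvc, hne, hE', hh⟩
    · exact h1 (h i hi)
    · have h3 : ¬ hap app M i v := fun h => hh ((S.hap_const hM hv hi hvc).1 h)
      have h4 : app i v c := (S.const v hv hvc i hi c hc).2 hE'
      exact hst v hv c hc ⟨hne, mate_ne_of_not_hap hne h4 h3, h4, h3,
        fun h => h2 (S.hap_changing hM R hc hcc hi h)⟩
  rintro a ha b hb ⟨hab, _, hE, h1, h2⟩
  by_cases hca : chg a <;> by_cases hcb : chg b
  · have h1' : ¬ hap app M i a := fun h => h1 (S.hap_changing hM R ha hca hi h)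
    exact hst a ha b hb ⟨hab, mate_ne_of_not_hap hab hE h1', hE, h1',
      fun h => h2 (S.hap_changing hM R hb hcb hi h)⟩
  · exact mixed b hb hcb a ha hca (S.symm i hi _ ha _ hb hE) h2 h1
  · exact mixed a ha hca b hb hcb hE h1 h2
  · rcases S.both_edge R ha hca hb hcb hab ((S.const a ha hca i hi b hb).1 hE) with h | h
    · exact h1 (h i hi)
    · exact h2 (h i hi)

/-- The substitute `v` for `u` does not depend on the layer, so the layers in which `{v, c}` does
not block `M` are layers in which `{u, c}` does not block `m`, and their number carries over. -/
theorem pair_weak (S : Sys n ℓ app chg) (hα : α ≤ ℓ) (hM : Invol n M)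
    (R : Rebuilt n app chg M m₂ m) (h : nstable n ℓ α app M (Notion.pair Base.weak)) :
    nstable n ℓ α app m (Notion.pair Base.weak) := by
  have all : ∀ p : ℕ → Prop, (∀ i < ℓ, p i) → α ≤ layerCount ℓ p := fun p hp => by
    rwa [layerCount_of_forall hp]
  have mixed : ∀ u < n, ¬ chg u → ∀ c < n, chg c →
      α ≤ layerCount ℓ fun i => ¬ (app i u c ∧ ¬ hap app m i u ∧ ¬ hap app m i c) := by
    intro u hu huc c hc hcc
    by_cases hE : app 0 u c
    · rcases S.mixed_edge R hu huc hc hcc hE with h' | ⟨v, hv, hvc, hne, hE', hh⟩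
      · exact all _ fun i hi hb => hb.2.1 (h' i hi)
      · refine le_trans (h v hv c hc hne) (layerCount_mono fun i hi hst hb => hst ?_)
        have h3 : ¬ hap app M i v := fun h => hh ((S.hap_const hM hv hi hvc).1 h)
        have h4 : app i v c := (S.const v hv hvc i hi c hc).2 hE'
        exact ⟨hne, mate_ne_of_not_hap hne h4 h3, h4, h3,
          fun h => hb.2.2 (S.hap_changing hM R hc hcc hi h)⟩
    · exact all _ fun i hi hb => hE ((S.const u hu huc i hi c hc).1 hb.1)
  intro a ha b hb hab
  by_cases hca : chg a <;> by_cases hcb : chg b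
  · refine le_trans (h a ha b hb hab) (layerCount_mono fun i hi hst => ?_)
    rintro ⟨_, _, hE, h1, h2⟩
    have h1' : ¬ hap app M i a := fun h => h1 (S.hap_changing hM R ha hca hi h)
    exact hst ⟨hab, mate_ne_of_not_hap hab hE h1', hE, h1',
      fun h => h2 (S.hap_changing hM R hb hcb hi h)⟩
  · refine le_trans (mixed b hb hcb a ha hca) (layerCount_mono fun i hi hst => ?_)
    rintro ⟨_, _, hE, h1, h2⟩
    exact hst ⟨S.symm i hi _ ha _ hb hE, h2, h1⟩
  · refine le_trans (mixed a ha hca b hb hcb) (layerCount_mono fun i hi hst => ?_)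
    rintro ⟨_, _, hE, h1, h2⟩
    exact hst ⟨hE, h1, h2⟩
  · refine all _ fun i hi => ?_
    rintro ⟨_, _, hE, h1, h2⟩
    rcases S.both_edge R ha hca hb hcb hab ((S.const a ha hca i hi b hb).1 hE) with h | h
    · exact h1 (h i hi)
    · exact h2 (h i hi)

/-- The substitute `v` approves `c` and is unhappy in every layer, so by α ≥ 1 it cannot be the
agent chosen for the pair `{v, c}`. Hence `c` is, and as `c` approves `v` everywhere, it is happy in
α layers of `M`, and so of `m`. -/
theorem individual_weak (S : Sys n ℓ app chg) (hα : α ≤ ℓ) (hα1 : 1 ≤ α) (hM : Invol n M)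
    (R : Rebuilt n app chg M m₂ m) (h : nstable n ℓ α app M Notion.individualWeak) :
    nstable n ℓ α app m Notion.individualWeak := by
  have all : ∀ p : ℕ → Prop, (∀ i < ℓ, p i) → α ≤ layerCount ℓ p := fun p hp => by
    rwa [layerCount_of_forall hp]
  have h' : ∀ a < n, ∀ b < n, a ≠ b →
      (α ≤ layerCount ℓ fun i => ¬ app i a b ∨ hap app M i a) ∨
      (α ≤ layerCount ℓ fun i => ¬ app i b a ∨ hap app M i b) := by
    intro a ha b hb hab
    by_cases hm : M a = b
    · subst hm
      exact Or.inl (all _ fun i _ => or_iff_not_imp_left.2 fun h =>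
        ⟨Ne.symm hab, not_not.1 h⟩)
    · exact h a ha b hb hab hm
  have chgd : ∀ a < n, ∀ b, chg a → (α ≤ layerCount ℓ fun i => ¬ app i a b ∨ hap app M i a) →
      α ≤ layerCount ℓ fun i => ¬ app i a b ∨ hap app m i a := by
    intro a ha b hca hle
    exact le_trans hle (layerCount_mono fun i hi hst =>
      hst.imp id fun h => S.hap_changing hM R ha hca hi h)
  have mixed : ∀ u < n, ¬ chg u → ∀ c < n, chg c →
      (α ≤ layerCount ℓ fun i => ¬ app i u c ∨ hap app m i u) ∨
      (α ≤ layerCount ℓ fun i => ¬ app i c u ∨ hap app m i c) := by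
    intro u hu huc c hc hcc
    by_cases hE : app 0 u c
    · rcases S.mixed_edge R hu huc hc hcc hE with h1 | ⟨v, hv, hvc, hne, hE', hh⟩
      · exact Or.inl (all _ fun i hi => Or.inr (h1 i hi))
      · right
        rcases h' v hv c hc hne with h1 | h1
        · obtain ⟨i, hi, h2⟩ := exists_of_layerCount (hα1.trans h1)
          rcases h2 with h2 | h2
          · exact absurd ((S.const v hv hvc i hi c hc).2 hE') h2
          · exact absurd ((S.hap_const hM hv hi hvc).1 h2) hh
        · refine le_trans h1 (layerCount_mono fun i hi hst => Or.inr ?_)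
          refine S.hap_changing hM R hc hcc hi (hst.resolve_left fun h2 => h2 ?_)
          exact S.symm i hi _ hv _ hc ((S.const v hv hvc i hi c hc).2 hE')
    · exact Or.inl (all _ fun i hi => Or.inl fun h => hE ((S.const u hu huc i hi c hc).1 h))
  intro a ha b hb hab _
  by_cases hca : chg a <;> by_cases hcb : chg b
  · exact (h' a ha b hb hab).imp (chgd a ha b hca) (chgd b hb a hcb)
  · exact (mixed b hb hcb a ha hca).symm
  · exact mixed a ha hca b hb hcb
  · by_cases hE : app 0 a b
    · rcases S.both_edge R ha hca hb hcb hab hE with h1 | h1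
      · exact Or.inl (all _ fun i hi => Or.inr (h1 i hi))
      · exact Or.inr (all _ fun i hi => Or.inr (h1 i hi))
    · exact Or.inl (all _ fun i hi => Or.inl fun h => hE ((S.const a ha hca i hi b hb).1 h))

/-- If all unchanging agents that approve somebody are happy in `M`, then they are happy in `m`. -/
theorem hap_of_allHappy (S : Sys n ℓ app chg) (R : Rebuilt n app chg M m₂ m)
    (h : allHappy n app chg M) {u b i : ℕ} (hu : u < n) (huc : ¬ chg u) (hb : b < n) (hne : b ≠ u)
    (hi : i < ℓ) (hE : app i u b) : hap app m i u :=
  S.hap_unchanging R hu huc hi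
    (R.needed u hu huc ⟨b, hb, hne, (S.const u hu huc i hi b hb).1 hE, Or.inl h⟩)

theorem hap_of_strong {i a b : ℕ} (hM : Invol n M) (ha : a < n) (hab : a ≠ b) (hE : app i a b)
    (hE' : app i b a) (h : ¬ blk Base.strong app M i a b) : hap app M i a ∧ hap app M i b := by
  by_cases hm : M a = b
  · have : M b = a := by rw [← hm, (hM a ha).2]
    refine ⟨⟨by rw [hm]; exact Ne.symm hab, by rwa [hm]⟩, by rw [this]; exact hab, by rwa [this]⟩
  · by_contra hh
    exact h ⟨hab, hm, hE, hh⟩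

/-- Some layer is stable because α ≥ 1. There each agent with an approved agent is happy, and for
unchanging agents this spreads to all layers. So the guess forces all of them to be happy. -/
theorem global_strong (S : Sys n ℓ app chg) (hα1 : 1 ≤ α) (hM : Invol n M)
    (R : Rebuilt n app chg M m₂ m) (h : nstable n ℓ α app M (Notion.global Base.strong)) :
    nstable n ℓ α app m (Notion.global Base.strong) := by
  have hz : allHappy n app chg M := by
    obtain ⟨i, hi, hst⟩ := exists_of_layerCount (hα1.trans h)
    rintro u hu huc ⟨b, hb, hne, hE⟩
    have hE' := (S.const u hu huc i hi b hb).2 hE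
    exact (S.hap_const hM hu hi huc).1 (hap_of_strong hM hu hne.symm hE'
      (S.symm i hi _ hu _ hb hE') (hst u hu b hb)).1
  refine le_trans h (layerCount_mono fun i hi hst => ?_)
  rintro a ha b hb ⟨hab, _, hE, hh⟩
  have hE' := S.symm i hi _ ha _ hb hE
  obtain ⟨g1, g2⟩ := hap_of_strong hM ha hab hE hE' (hst a ha b hb)
  refine hh ⟨?_, ?_⟩
  · by_cases hca : chg a
    · exact S.hap_changing hM R ha hca hi g1
    · exact S.hap_of_allHappy R hz ha hca hb hab.symm hi hE
  · by_cases hcb : chg b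
    · exact S.hap_changing hM R hb hcb hi g2
    · exact S.hap_of_allHappy R hz hb hcb ha hab hi hE'

/-- As in the global case, except that the layer which shows an unchanging agent to be happy depends
on the approved pair. -/
theorem pair_strong (S : Sys n ℓ app chg) (hα1 : 1 ≤ α) (hM : Invol n M)
    (R : Rebuilt n app chg M m₂ m) (h : nstable n ℓ α app M (Notion.pair Base.strong)) :
    nstable n ℓ α app m (Notion.pair Base.strong) := by
  have hz : allHappy n app chg M := by
    rintro u hu huc ⟨b, hb, hne, hE⟩
    obtain ⟨i, hi, hst⟩ := exists_of_layerCount (hα1.trans (h u hu b hb hne.symm))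
    have hE' := (S.const u hu huc i hi b hb).2 hE
    exact (S.hap_const hM hu hi huc).1 (hap_of_strong hM hu hne.symm hE'
      (S.symm i hi _ hu _ hb hE') hst).1
  intro a ha b hb hab
  refine le_trans (h a ha b hb hab) (layerCount_mono fun i hi hst => ?_)
  rintro ⟨_, _, hE, hh⟩
  have hE' := S.symm i hi _ ha _ hb hE
  obtain ⟨g1, g2⟩ := hap_of_strong hM ha hab hE hE' hst
  refine hh ⟨?_, ?_⟩
  · by_cases hca : chg a
    · exact S.hap_changing hM R ha hca hi g1
    · exact S.hap_of_allHappy R hz ha hca hb hab.symm hi hE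
  · by_cases hcb : chg b
    · exact S.hap_changing hM R hb hcb hi g2
    · exact S.hap_of_allHappy R hz hb hcb ha hab hi hE'

/-- Under super stability the matching is determined. -/
theorem eq_of_super (S : Sys n ℓ app chg) (hM : Invol n M) (R : Rebuilt n app chg M m₂ m)
    (h1 : ∀ a < n, ∀ b < n, a ≠ b → ¬ chg a → app 0 a b → M a = b)
    (h2 : ∀ a < n, ∀ b < n, a ≠ b → (∀ i < ℓ, ¬ hap app M i a) → (∀ i < ℓ, ¬ hap app M i b) →
      M a = b) : ∀ a < n, m a = M a := by
  have hz : allHappy n app chg M := by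
    rintro u hu huc ⟨b, hb, hne, hE⟩
    have := h1 u hu b hb hne.symm huc hE
    exact ⟨by rw [this]; exact hne, by rwa [this]⟩
  -- By `h1` an unchanging agent approves nobody in layer 0 except its partner in `M`, so every
  -- approved pair with an unchanging member is a pair of `M`.
  have mid : ∀ a < n, m₂ a ≠ a → m₂ a = M a := by
    intro a ha hne
    rcases R.source a ha hne with ⟨_, _, h⟩ | ⟨hE, hc⟩
    · exact h
    · have hb := (R.invol_mid a ha).1
      by_cases hca : chg a
      · have := h1 _ hb a ha hne (fun h => hc ⟨hca, h⟩) (S.symm 0 S.pos _ ha _ hb hE)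
        rw [← (hM _ hb).2, this]
      · exact (h1 a ha _ hb (Ne.symm hne) hca hE).symm
  -- Whoever is happy in `M` in some layer is covered by `m₂`: through its changing partner, as
  -- matched outwards, or as needed. Hence agents left over by `m₂` are never happy, and `h2`
  -- applies to them.
  have never : ∀ a < n, m₂ a = a → ∀ i < ℓ, ¬ hap app M i a := by
    rintro a ha he i hi ⟨hne, hE⟩
    have hb := (hM a ha).1
    by_cases hca : chg a
    · by_cases hcb : chg (M a)
      · exact hne (by rw [← R.inside a ha hca hcb, he])
      · exact R.out a ha ⟨hca, hne, hcb, (S.const' ha hb hi fun h => hcb h.2).1 hE⟩ he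
    · exact R.needed a ha hca ⟨M a, hb, hne, (S.const a ha hca i hi _ hb).1 hE, Or.inl hz⟩ he
  have sub : ∀ a < n, m a ≠ a → m a = M a := by
    intro a ha hne
    by_cases he : m₂ a = a
    · have hb := (R.invol a ha).1
      -- The partner of `a` was left over by `m₂` as well, because `m` keeps the pairs of `m₂`.
      have hbe : m₂ (m a) = m a := by
        by_contra hb'
        have e := R.extends_mid _ hb hb'
        rw [(R.invol a ha).2] at e
        have := (R.invol_mid _ hb).2
        rw [← e, he] at this
        exact hne this.symm
      exact (h2 a ha _ hb (Ne.symm hne) (never a ha he) (never _ hb hbe)).symm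
    · rw [R.extends_mid a ha he]; exact mid a ha he
  intro a ha
  by_cases hne : m a = a
  -- If only `M` matched `a`, then `a` and its partner in `M` would both be single in `m`, against
  -- maximality. This is what the final arbitrary pairs are for.
  · by_contra hMa
    have hb := (hM a ha).1
    have hab : a ≠ M a := fun e => hMa (by rw [← e, hne])
    have hmb : m (M a) = M a := by
      by_contra hb'
      have e := sub _ hb hb'
      rw [(hM a ha).2] at e
      have := (R.invol _ hb).2
      rw [e, hne] at this
      exact hab this
    rcases R.maximal a ha _ hb hab with h | h
    · exact h hne
    · exact h hmb
  · exact sub a ha hne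

/-- The common consequence of the three super notions when α ≥ 1: each unmatched pair has a layer
without approval in which one of the two is happy. It makes unchanging agents approve only their
partners, and pairs up agents that are never happy. -/
theorem super_pair {σ : Prop} (S : Sys n ℓ app chg)
    (h : ∀ a < n, ∀ b < n, a ≠ b → M a ≠ b → ∃ i < ℓ, ¬ app i a b ∧
      (hap app M i a ∨ hap app M i b)) (hM : Invol n M) (R : Rebuilt n app chg M m₂ m)
    (hσ : (∀ a < n, m a = M a) → σ) : σ := by
  refine hσ (S.eq_of_super hM R (fun a ha b hb hab hc hE => ?_) fun a ha b hb hab h1 h2 => ?_)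
  · by_contra hm
    obtain ⟨i, hi, h3, _⟩ := h a ha b hb hab hm
    exact h3 ((S.const a ha hc i hi b hb).2 hE)
  · by_contra hm
    obtain ⟨i, hi, _, h3 | h3⟩ := h a ha b hb hab hm
    · exact h1 i hi h3
    · exact h2 i hi h3

theorem exists_of_not_blk {i a b : ℕ} (hab : a ≠ b) (hm : M a ≠ b)
    (h : ¬ blk Base.super app M i a b) : ¬ app i a b ∧ (hap app M i a ∨ hap app M i b) := by
  constructor
  · exact fun hE => h ⟨hab, hm, Or.inl hE⟩
  · by_contra hh
    push Not at hh
    exact h ⟨hab, hm, Or.inr hh⟩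

/-- The matching rebuilt from a stable matching is stable. -/
theorem nstable_of_rebuilt (S : Sys n ℓ app chg) (hα : α ≤ ℓ) (hα1 : 1 ≤ α) (hM : Invol n M)
    (R : Rebuilt n app chg M m₂ m) {N : Notion} (h : nstable n ℓ α app M N) :
    nstable n ℓ α app m N := by
  cases N with
  | global σ =>
    cases σ with
    | weak => exact S.global_weak hM R h
    | strong => exact S.global_strong hα1 hM R h
    | super =>
      refine S.super_pair (fun a ha b hb hab hm => ?_) hM R fun e => nstable_congr e h
      obtain ⟨i, hi, hst⟩ := exists_of_layerCount (hα1.trans h)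
      exact ⟨i, hi, exists_of_not_blk hab hm (hst a ha b hb)⟩
  | pair σ =>
    cases σ with
    | weak => exact S.pair_weak hα hM R h
    | strong => exact S.pair_strong hα1 hM R h
    | super =>
      refine S.super_pair (fun a ha b hb hab hm => ?_) hM R fun e => nstable_congr e h
      obtain ⟨i, hi, hst⟩ := exists_of_layerCount (hα1.trans (h a ha b hb hab))
      exact ⟨i, hi, exists_of_not_blk hab hm hst⟩
  | individualWeak => exact S.individual_weak hα hα1 hM R h
  | individualSuper =>
    refine S.super_pair (fun a ha b hb hab hm => ?_) hM R fun e => nstable_congr e h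
    rcases h a ha b hb hab hm with h | h
    · obtain ⟨i, hi, h3, h4⟩ := exists_of_layerCount (hα1.trans h)
      exact ⟨i, hi, h3, Or.inl h4⟩
    · obtain ⟨i, hi, h3, h4⟩ := exists_of_layerCount (hα1.trans h)
      exact ⟨i, hi, fun h => h3 (S.symm i hi _ ha _ hb h), Or.inr h4⟩

end Sys

/-! ### Passage to natural numbers -/

namespace Inst

variable (I : Inst)

/-- In layer `i`, agent `a` approves agent `b`. -/
def app (i a b : ℕ) : Prop :=
  ∃ (hi : i < I.ℓ) (ha : a < I.n) (hb : b < I.n), (⟨b, hb⟩ : Fin I.n) ∈ I.T ⟨i, hi⟩ ⟨a, ha⟩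

theorem app_iff (i : Fin I.ℓ) (a b : Fin I.n) : I.app i a b ↔ b ∈ I.T i a :=
  ⟨fun ⟨_, _, _, h⟩ => h, fun h => ⟨i.2, a.2, b.2, h⟩⟩

theorem app_symm (h : I.Symmetric) {i a b : ℕ} (hE : I.app i a b) : I.app i b a := by
  obtain ⟨hi, ha, hb, hE⟩ := hE
  exact ⟨hi, hb, ha, (h _ _ _).1 hE⟩

theorem holdsInLayers_iff (p : Fin I.ℓ → Prop) (q : ℕ → Prop) (h : ∀ i : Fin I.ℓ, p i ↔ q i) :
    I.HoldsInLayers p ↔ I.α ≤ layerCount I.ℓ q := by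
  classical
  constructor
  · rintro ⟨S, hS, hp⟩
    refine hS.trans ?_
    rw [← Finset.card_map Fin.valEmbedding]
    refine Finset.card_le_card fun i hi => ?_
    rw [Finset.mem_map] at hi
    obtain ⟨j, hj, rfl⟩ := hi
    simp only [Finset.mem_filter, Finset.mem_range]
    exact ⟨j.2, (h j).1 (hp j hj)⟩
  · intro hle
    refine ⟨Finset.univ.filter fun i : Fin I.ℓ => q i, hle.trans ?_, fun i hi => ?_⟩
    · rw [← Finset.card_map Fin.valEmbedding]
      refine Finset.card_le_card fun i hi => ?_
      simp only [Finset.mem_filter, Finset.mem_range] at hi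
      rw [Finset.mem_map]
      exact ⟨⟨i, hi.1⟩, by simpa using hi.2, rfl⟩
    · exact (h i).2 (Finset.mem_filter.1 hi).2

end Inst

/-- The matching `M` is represented by the involution `m`. -/
def Represents {n : ℕ} (M : Matching n) (m : ℕ → ℕ) : Prop :=
  ∀ a b : Fin n, a ≠ b → (M.partner a = some b ↔ m a = b)

/-- Unmatched agents become fixed points, which is why `Represents` speaks of distinct agents only.
-/
theorem exists_involution {n : ℕ} (M : Matching n) : ∃ m, Invol n m ∧ Represents M m := by
  set g : Fin n → Fin n := fun a => (M.partner a).getD a with hg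
  have hs : ∀ a b, M.partner a = some b → g a = b := fun a b h => by simp [hg, h]
  have hgg : ∀ a, g (g a) = a := by
    intro a
    cases h : M.partner a with
    | none => simp [hg, h]
    | some b => rw [hs a b h]; exact hs b a (M.symm a b h)
  refine ⟨fun a => if h : a < n then g ⟨a, h⟩ else a, fun a ha => ?_, fun a b hab => ?_⟩
  · simp [ha, hgg]
  · simp only [Fin.is_lt, dif_pos, Fin.eta]
    constructor
    · intro h; rw [hs a b h]
    · intro h
      have h : g a = b := Fin.ext h
      cases h' : M.partner a with
      | none => simp [hg, h'] at h; exact absurd h hab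
      | some c => rw [← h, hs a c h']

theorem exists_matching {n : ℕ} {m : ℕ → ℕ} (hm : Invol n m) :
    ∃ M : Matching n, Represents M m := by
  refine ⟨⟨fun a => if m a = a then none else some ⟨m a, (hm a a.2).1⟩, ?_, ?_⟩, ?_⟩
  · intro a b h
    split_ifs at h with h1
    obtain rfl := Option.some.inj h
    have := (hm a a.2).2
    simp only [this]
    rw [if_neg (Ne.symm h1)]
  · intro a h
    split_ifs at h with h1
    exact h1 (congrArg Fin.val (Option.some.inj h))
  · intro a b hab
    simp only
    split_ifs with h1
    · simp only [false_iff]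
      intro h
      exact hab (Fin.ext (h1.symm.trans h))
    · simp [Fin.ext_iff]

namespace Inst

variable {I : Inst}

theorem happy_iff {M : Matching I.n} {m : ℕ → ℕ} (hr : Represents M m) (hm : Invol I.n m)
    (i : Fin I.ℓ) (a : Fin I.n) : I.Happy M i a ↔ hap I.app m i a := by
  unfold Happy Approves hap
  constructor
  · rintro ⟨b, hb, e⟩
    have hab : a ≠ b := fun h => M.irrefl a (by rw [e, ← h])
    have := (hr a b hab).1 e
    rw [this]
    exact ⟨fun h => hab (Fin.ext h).symm, (I.app_iff i a b).2 hb⟩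
  · rintro ⟨h1, h2⟩
    have hab : a ≠ ⟨m a, (hm a a.2).1⟩ := fun h => h1 (congrArg Fin.val h).symm
    exact ⟨⟨m a, (hm a a.2).1⟩, (I.app_iff i a ⟨m a, _⟩).1 h2, (hr a _ hab).2 rfl⟩

theorem approves_some (i : Fin I.ℓ) (a b : Fin I.n) : I.Approves i a (some b) ↔ I.app i a b := by
  rw [app_iff]
  constructor
  · rintro ⟨c, hc, e⟩; rwa [Option.some.inj e]
  · exact fun h => ⟨b, h, rfl⟩

/-- By symmetry one approval stands for both directions. What remains is propositional logic in this
approval and the happiness of the two agents. -/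
theorem blocks_iff (hs : I.Symmetric) {M : Matching I.n} {m : ℕ → ℕ} (hr : Represents M m)
    (hm : Invol I.n m) (i : Fin I.ℓ) (a b : Fin I.n) (σ : Base) :
    I.Blocks M i a b σ ↔ blk σ I.app m i a b := by
  unfold Blocks blk
  rw [ne_eq, ne_eq, Fin.ext_iff]
  refine and_congr_right fun hab => ?_
  have hab' : a ≠ b := fun h => hab (congrArg Fin.val h)
  rw [not_congr (hr a b hab')]
  refine and_congr_right fun _ => ?_
  have h1 := approves_some (I := I) i a b
  have h2 := approves_some (I := I) i b a
  have h3 := happy_iff hr hm i a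
  have h4 := happy_iff hr hm i b
  have h5 : I.app i a b ↔ I.app i b a := ⟨I.app_symm hs, I.app_symm hs⟩
  unfold Happy at h3 h4
  cases σ <;> simp only [Prefers, Indifferent, h1, h2, h3, h4, ← h5] <;> tauto

theorem stable_iff (hs : I.Symmetric) {M : Matching I.n} {m : ℕ → ℕ} (hr : Represents M m)
    (hm : Invol I.n m) (N : Notion) : I.Stable M N ↔ nstable I.n I.ℓ I.α I.app m N := by
  have fa : ∀ p : ℕ → Prop, (∀ a : Fin I.n, p a) ↔ ∀ a < I.n, p a :=
    fun p => ⟨fun h a ha => h ⟨a, ha⟩, fun h a => h a a.2⟩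
  have hne : ∀ a b : Fin I.n, a ≠ b ↔ (a : ℕ) ≠ b := fun a b => by rw [ne_eq, ne_eq, Fin.ext_iff]
  cases N with
  | global σ =>
    refine I.holdsInLayers_iff _ _ fun i => ?_
    unfold StableInLayer
    simp only [blocks_iff hs hr hm]
    rw [← fa fun a => ∀ b < I.n, ¬ blk σ I.app m i a b]
    exact forall_congr' fun a => fa fun b => ¬ blk σ I.app m i a b
  | pair σ =>
    simp only [Stable, nstable]
    rw [← fa fun a => ∀ b < I.n, a ≠ b → I.α ≤ layerCount I.ℓ fun i => ¬ blk σ I.app m i a b]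
    refine forall_congr' fun a => ?_
    rw [← fa fun b => (a : ℕ) ≠ b → I.α ≤ layerCount I.ℓ fun i => ¬ blk σ I.app m i a b]
    refine forall_congr' fun b => ?_
    rw [hne]
    refine imp_congr_right fun _ => I.holdsInLayers_iff _ _ fun i => ?_
    rw [blocks_iff hs hr hm]
  | individualWeak =>
    simp only [Stable, nstable]
    rw [← fa fun a => ∀ b < I.n, a ≠ b → m a ≠ b →
      (I.α ≤ layerCount I.ℓ fun i => ¬ I.app i a b ∨ hap I.app m i a) ∨
      (I.α ≤ layerCount I.ℓ fun i => ¬ I.app i b a ∨ hap I.app m i b)]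
    refine forall_congr' fun a => ?_
    rw [← fa fun b => (a : ℕ) ≠ b → m a ≠ b →
      (I.α ≤ layerCount I.ℓ fun i => ¬ I.app i a b ∨ hap I.app m i a) ∨
      (I.α ≤ layerCount I.ℓ fun i => ¬ I.app i b a ∨ hap I.app m i b)]
    refine forall_congr' fun b => ?_
    rw [← hne]
    refine imp_congr_right fun hab => ?_
    rw [ne_eq, hr a b hab]
    refine imp_congr_right fun _ => or_congr ?_ ?_ <;>
      refine I.holdsInLayers_iff _ _ fun i => ?_ <;>
      rw [app_iff, happy_iff hr hm]
  | individualSuper =>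
    simp only [Stable, nstable]
    rw [← fa fun a => ∀ b < I.n, a ≠ b → m a ≠ b →
      (I.α ≤ layerCount I.ℓ fun i => ¬ I.app i a b ∧ hap I.app m i a) ∨
      (I.α ≤ layerCount I.ℓ fun i => ¬ I.app i b a ∧ hap I.app m i b)]
    refine forall_congr' fun a => ?_
    rw [← fa fun b => (a : ℕ) ≠ b → m a ≠ b →
      (I.α ≤ layerCount I.ℓ fun i => ¬ I.app i a b ∧ hap I.app m i a) ∨
      (I.α ≤ layerCount I.ℓ fun i => ¬ I.app i b a ∧ hap I.app m i b)]
    refine forall_congr' fun b => ?_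
    rw [← hne]
    refine imp_congr_right fun hab => ?_
    rw [ne_eq, hr a b hab]
    refine imp_congr_right fun _ => or_congr ?_ ?_ <;>
      refine I.holdsInLayers_iff _ _ fun i => ?_ <;>
      rw [app_iff, happy_iff hr hm]

theorem hasStableMatching_iff (hs : I.Symmetric) (N : Notion) :
    I.HasStableMatching N ↔ ∃ m, Invol I.n m ∧ nstable I.n I.ℓ I.α I.app m N := by
  constructor
  · rintro ⟨M, hM⟩
    obtain ⟨m, hm, hr⟩ := exists_involution M
    exact ⟨m, hm, (stable_iff hs hr hm N).1 hM⟩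
  · rintro ⟨m, hm, hst⟩
    obtain ⟨M, hr⟩ := exists_matching hm
    exact ⟨M, (stable_iff hs hr hm N).2 hst⟩

end Inst

/-! ### Checking stability -/

/-- Register `f` is a flag that rounds can only clear, each according to its own condition. -/
theorem forall_loop {x y f : ℕ} {p : Cmd} {s : Store} {P : ℕ → Prop}
    (h : ∀ i < s.reg y, ∀ t, Frame (.loop x y p) s t →
      ((p.den (t.setReg x i)).reg f ≠ 0 ↔ t.reg f ≠ 0 ∧ P i)) :
    ((Cmd.loop x y p).den s).reg f ≠ 0 ↔ s.reg f ≠ 0 ∧ ∀ i < s.reg y, P i := by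
  refine Cmd.loop_inv (x := x) (y := y) (p := p) (s₀ := s)
    (fun i t => t.reg f ≠ 0 ↔ s.reg f ≠ 0 ∧ ∀ j < i, P j) (by simp) ?_
  intro i hi t hF It
  rw [h i hi t hF, It, Nat.forall_lt_succ_right, and_assoc]

theorem count_loop {x y c : ℕ} {p : Cmd} {s : Store} {P : ℕ → Prop}
    (h : ∀ i < s.reg y, ∀ t, Frame (.loop x y p) s t →
      (P i → (p.den (t.setReg x i)).reg c = t.reg c + 1) ∧
      (¬ P i → (p.den (t.setReg x i)).reg c = t.reg c)) :
    ((Cmd.loop x y p).den s).reg c = s.reg c + layerCount (s.reg y) P := by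
  refine Cmd.loop_inv (x := x) (y := y) (p := p) (s₀ := s)
    (fun i t => t.reg c = s.reg c + layerCount i P) (by simp [layerCount_zero]) ?_
  intro i hi t hF It
  by_cases hP : P i
  · rw [(h i hi t hF).1 hP, It, layerCount_succ_of_pos hP, Nat.add_assoc]
  · rw [(h i hi t hF).2 hP, It, layerCount_succ_of_neg hP]

/-- The store holds the instance. -/
structure AppState (n ℓ α : ℕ) (app : ℕ → ℕ → ℕ → Prop) (s : Store) : Prop where
  agents : s.reg 1 = n
  layers : s.reg 2 = ℓ
  degree : s.reg 3 = α
  -- Array 1 will hold the multiples of `n`, so the nested look-up yields `(i * n + a) * n` without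
  -- a multiplication. The offset 3 skips the header of the input.
  approvals : ∀ i < ℓ, ∀ a < n, ∀ b < n, s.arr 0 (3 + (s.arr 1 (s.arr 1 i + a) + b)) ≠ 0 ↔ app i a b

theorem AppState.of_eq {n ℓ α : ℕ} {app : ℕ → ℕ → ℕ → Prop} {s s' : Store}
    (h : AppState n ℓ α app s) (h1 : s'.reg 1 = s.reg 1) (h2 : s'.reg 2 = s.reg 2)
    (h3 : s'.reg 3 = s.reg 3) (h4 : s'.arr 0 = s.arr 0) (h5 : s'.arr 1 = s.arr 1) :
    AppState n ℓ α app s' :=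
  ⟨h1.trans h.1, h2.trans h.2, h3.trans h.3, by rw [h4, h5]; exact h.4⟩

theorem AppState.of_frame {n ℓ α : ℕ} {app : ℕ → ℕ → ℕ → Prop} {s s' : Store} {c : Cmd}
    (h : AppState n ℓ α app s) (hF : Frame c s s') (h1 : 1 ∉ c.regs) (h2 : 2 ∉ c.regs)
    (h3 : 3 ∉ c.regs) (h4 : 0 ∉ c.arrs) (h5 : 1 ∉ c.arrs) : AppState n ℓ α app s' :=
  h.of_eq (hF.1 1 h1) (hF.1 2 h2) (hF.1 3 h3) (hF.2 0 h4) (hF.2 1 h5)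

/-- Agent `a` approves agent `b` in layer `i`. -/
def appE (i a b : Expr) : Expr := get 0 (add (lit 3) (add (get 1 (add (get 1 i) a)) b))

/-- Agent `a` is happy in layer `i`. -/
def hapE (i a : Expr) : Expr := and (ne (get 6 a) a) (appE i a (get 6 a))

theorem AppState.holds_appE {n ℓ α : ℕ} {app : ℕ → ℕ → ℕ → Prop} {s : Store}
    (h : AppState n ℓ α app s) {i a b : Expr} (hi : i.eval s < ℓ) (ha : a.eval s < n)
    (hb : b.eval s < n) : (appE i a b).holds s ↔ app (i.eval s) (a.eval s) (b.eval s) :=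
  h.approvals _ hi _ ha _ hb

theorem AppState.holds_hapE {n ℓ α : ℕ} {app : ℕ → ℕ → ℕ → Prop} {s : Store}
    (h : AppState n ℓ α app s) (hm : Invol n (s.arr 6)) {i a : Expr} (hi : i.eval s < ℓ)
    (ha : a.eval s < n) : (hapE i a).holds s ↔ hap app (s.arr 6) (i.eval s) (a.eval s) := by
  rw [hapE, holds_and, holds_ne, h.holds_appE (b := get 6 a) hi ha (hm _ ha).1]
  rfl

/-- The pair of the agents in registers 25 and 26 blocks in the layer in register 24. -/
def blkE (σ : Base) : Expr :=
  and (ne (var 25) (var 26)) (and (ne (get 6 (var 25)) (var 26))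
    (match σ with
    | Base.weak => and (appE (var 24) (var 25) (var 26))
        (and (not (hapE (var 24) (var 25))) (not (hapE (var 24) (var 26))))
    | Base.strong => and (appE (var 24) (var 25) (var 26))
        (not (and (hapE (var 24) (var 25)) (hapE (var 24) (var 26))))
    | Base.super => or (appE (var 24) (var 25) (var 26))
        (and (not (hapE (var 24) (var 25))) (not (hapE (var 24) (var 26))))))

theorem AppState.holds_blkE {n ℓ α : ℕ} {app : ℕ → ℕ → ℕ → Prop} {s : Store}
    (h : AppState n ℓ α app s) (hm : Invol n (s.arr 6)) (σ : Base) (hi : s.reg 24 < ℓ)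
    (ha : s.reg 25 < n) (hb : s.reg 26 < n) :
    (blkE σ).holds s ↔ blk σ app (s.arr 6) (s.reg 24) (s.reg 25) (s.reg 26) := by
  have h1 := h.holds_appE (i := var 24) (a := var 25) (b := var 26) hi ha hb
  have h2 := h.holds_hapE hm (i := var 24) (a := var 25) hi ha
  have h3 := h.holds_hapE hm (i := var 24) (a := var 26) hi hb
  simp only [eval_var] at h1 h2 h3
  cases σ <;> simp only [blkE, blk, holds_and, holds_or, holds_not, holds_ne, h1, h2, h3, eval_var,
    eval_get]

/-- Check that array 6 holds a matching. -/
def involCmd : Cmd :=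
  .loop 25 1 (ite (and (lt (get 6 (var 25)) (var 1)) (eq (get 6 (get 6 (var 25))) (var 25)))
    skip (assign 29 (lit 0)))

/-- Check that in enough layers no pair satisfies `e`. -/
def globalCmd (e : Expr) : Cmd :=
  assign 27 (lit 0) ;;
  .loop 24 2 (assign 31 (lit 1) ;;
    .loop 25 1 (.loop 26 1 (ite e (assign 31 (lit 0)) skip)) ;;
    ite (var 31) (assign 27 (add (var 27) (lit 1))) skip) ;;
  ite (lt (var 27) (var 3)) (assign 29 (lit 0)) skip

/-- Check that for each pair that satisfies `e₀` enough layers satisfy `e₁`, or enough layers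
satisfy `e₂`. -/
def pairCmd (e₀ e₁ e₂ : Expr) : Cmd :=
  .loop 25 1 (.loop 26 1 (ite e₀
    (assign 27 (lit 0) ;; assign 28 (lit 0) ;;
      .loop 24 2 (ite e₁ (assign 27 (add (var 27) (lit 1))) skip ;;
        ite e₂ (assign 28 (add (var 28) (lit 1))) skip) ;;
      ite (and (lt (var 27) (var 3)) (lt (var 28) (var 3))) (assign 29 (lit 0)) skip)
    skip))

/-- Check stability. -/
def stableCmd : Notion → Cmd
  | Notion.global σ => globalCmd (blkE σ)
  | Notion.pair σ => pairCmd (ne (var 25) (var 26)) (not (blkE σ)) (not (blkE σ))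
  | Notion.individualWeak => pairCmd (and (ne (var 25) (var 26)) (ne (get 6 (var 25)) (var 26)))
      (or (not (appE (var 24) (var 25) (var 26))) (hapE (var 24) (var 25)))
      (or (not (appE (var 24) (var 26) (var 25))) (hapE (var 24) (var 26)))
  | Notion.individualSuper => pairCmd (and (ne (var 25) (var 26)) (ne (get 6 (var 25)) (var 26)))
      (and (not (appE (var 24) (var 25) (var 26))) (hapE (var 24) (var 25)))
      (and (not (appE (var 24) (var 26) (var 25))) (hapE (var 24) (var 26)))

/-- Check that array 6 holds a stable matching. -/
def checkCmd (N : Notion) : Cmd :=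
  assign 29 (lit 1) ;; involCmd ;; ite (var 29) (stableCmd N) skip

theorem involCmd_spec {n : ℕ} {s : Store} (hn : s.reg 1 = n) :
    (involCmd.den s).reg 29 ≠ 0 ↔ s.reg 29 ≠ 0 ∧ Invol n (s.arr 6) := by
  unfold Invol
  rw [← hn]
  refine forall_loop fun i hi t hF => ?_
  have e6 := hF.2 6 (by decide)
  have e1 := hF.1 1 (by decide)
  have hiff : (and (lt (get 6 (var 25)) (var 1)) (eq (get 6 (get 6 (var 25))) (var 25))).holds
      (t.setReg 25 i) ↔ s.arr 6 i < s.reg 1 ∧ s.arr 6 (s.arr 6 i) = i := by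
    simp [e6, e1]
  by_cases h : s.arr 6 i < s.reg 1 ∧ s.arr 6 (s.arr 6 i) = i
  · rw [den_ite_pos _ (hiff.2 h)]; simp [h]
  · rw [den_ite_neg _ (fun h' => h (hiff.1 h'))]; simp [h]

theorem globalCmd_spec {n ℓ α : ℕ} {app : ℕ → ℕ → ℕ → Prop} {s : Store}
    (hs : AppState n ℓ α app s) {e : Expr} {Q : ℕ → ℕ → ℕ → Prop}
    (he : ∀ t : Store, AppState n ℓ α app t → t.arr 6 = s.arr 6 → t.reg 24 < ℓ → t.reg 25 < n →
      t.reg 26 < n → (e.holds t ↔ Q (t.reg 24) (t.reg 25) (t.reg 26))) (h29 : s.reg 29 ≠ 0) :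
    ((globalCmd e).den s).reg 29 ≠ 0 ↔
      α ≤ layerCount ℓ fun i => ∀ a < n, ∀ b < n, ¬ Q i a b := by
  set c := Cmd.loop 24 2 (assign 31 (lit 1) ;;
    .loop 25 1 (.loop 26 1 (ite e (assign 31 (lit 0)) skip)) ;;
    ite (var 31) (assign 27 (add (var 27) (lit 1))) skip) with hc
  have hregs : ∀ x, x ∉ [24, 31, 25, 26, 27] → x ∉ c.regs := by
    intro x hx; simp [hc, Cmd.regs] at hx ⊢; tauto
  have harrs : ∀ k, k ∉ c.arrs := by intro k; simp [hc, Cmd.arrs]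
  set s₁ := s.setReg 27 0 with hs₁
  have hs₁' : AppState n ℓ α app s₁ := hs.of_eq (by simp [hs₁]) (by simp [hs₁]) (by simp [hs₁])
    (by simp [hs₁]) (by simp [hs₁])
  have key : (c.den s₁).reg 27 = s₁.reg 27 + layerCount (s₁.reg 2)
      (fun i => ∀ a < n, ∀ b < n, ¬ Q i a b) := by
    refine count_loop fun i hi t hF => ?_
    have ht : AppState n ℓ α app t := hs₁'.of_frame hF (hregs _ (by decide)) (hregs _ (by decide))
      (hregs _ (by decide)) (harrs _) (harrs _)
    have ht6 : t.arr 6 = s.arr 6 := by rw [hF.2 6 (harrs _)]; simp [hs₁]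
    rw [hs₁'.layers] at hi
    set t₁ := (t.setReg 24 i).setReg 31 1 with ht₁
    have ht₁' : AppState n ℓ α app t₁ := ht.of_eq (by simp [ht₁]) (by simp [ht₁]) (by simp [ht₁])
      (by simp [ht₁]) (by simp [ht₁])
    set t₂ := (Cmd.loop 25 1 (.loop 26 1 (ite e (assign 31 (lit 0)) skip))).den t₁ with ht₂
    have f₂ : Frame (Cmd.loop 25 1 (.loop 26 1 (ite e (assign 31 (lit 0)) skip))) t₁ t₂ :=
      Cmd.frame _ _
    have key : t₂.reg 31 ≠ 0 ↔ t₁.reg 31 ≠ 0 ∧ ∀ a < t₁.reg 1, ∀ b < n, ¬ Q i a b := by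
      refine forall_loop fun a ha u hG => ?_
      have hu : AppState n ℓ α app (u.setReg 25 a) :=
        (ht₁'.of_frame hG (by simp [Cmd.regs]) (by simp [Cmd.regs]) (by simp [Cmd.regs])
          (by simp [Cmd.arrs]) (by simp [Cmd.arrs])).of_eq (by simp) (by simp) (by simp) rfl rfl
      rw [ht₁'.agents] at ha
      have := forall_loop (x := 26) (y := 1) (f := 31) (p := ite e (assign 31 (lit 0)) skip)
        (s := u.setReg 25 a) (P := fun b => ¬ Q i a b) (fun b hb v hH => ?_)
      · rw [this, hu.agents]; simp
      · have hv : AppState n ℓ α app (v.setReg 26 b) :=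
          (hu.of_frame hH (by simp [Cmd.regs]) (by simp [Cmd.regs]) (by simp [Cmd.regs])
            (by simp [Cmd.arrs]) (by simp [Cmd.arrs])).of_eq (by simp) (by simp) (by simp) rfl rfl
        rw [hu.agents] at hb
        have h24 : v.reg 24 = i := by
          rw [hH.1 24 (by simp [Cmd.regs]), setReg_reg, if_neg (by decide),
            hG.1 24 (by simp [Cmd.regs])]
          simp [ht₁]
        have h25 : v.reg 25 = a := by rw [hH.1 25 (by simp [Cmd.regs])]; simp
        have h6 : v.arr 6 = s.arr 6 := by
          rw [hH.2 6 (by simp [Cmd.arrs]), setReg_arr, hG.2 6 (by simp [Cmd.arrs]), ← ht6]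
          simp [ht₁]
        have hiff := he (v.setReg 26 b) hv (by simpa using h6) (by simpa [h24] using hi)
          (by simpa [h25] using ha) (by simpa using hb)
        simp only [setReg_reg, h24, h25, if_true, Nat.reduceEqDiff, if_false] at hiff
        by_cases hQ : Q i a b
        · rw [den_ite_pos _ (hiff.2 hQ)]; simp [hQ]
        · rw [den_ite_neg _ (fun h => hQ (hiff.1 h))]; simp [hQ]
    rw [ht₁'.agents] at key
    have h31 : t₁.reg 31 ≠ 0 := by simp [ht₁]
    have h27 : t₂.reg 27 = t.reg 27 := by rw [f₂.1 27 (by simp [Cmd.regs])]; simp [ht₁]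
    have e' : (assign 31 (lit 1) ;;
        .loop 25 1 (.loop 26 1 (ite e (assign 31 (lit 0)) skip)) ;;
        ite (var 31) (assign 27 (add (var 27) (lit 1))) skip).den (t.setReg 24 i)
        = (ite (var 31) (assign 27 (add (var 27) (lit 1))) skip).den t₂ := by
      simp only [den_seq, den_assign, eval_lit, ht₂, ht₁]
    rw [e']
    constructor
    · intro hP
      rw [den_ite_pos _ ((holds_var _ _).2 (key.2 ⟨h31, hP⟩))]; simp [h27]
    · intro hP
      rw [den_ite_neg _ (fun h => hP (key.1 ((holds_var _ _).1 h)).2)]; simp [h27]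
  rw [hs₁'.layers] at key
  have f : Frame c s₁ (c.den s₁) := Cmd.frame _ _
  have e3 : (c.den s₁).reg 3 = α := by rw [f.1 3 (hregs _ (by decide)), hs₁'.degree]
  have e29 : (c.den s₁).reg 29 ≠ 0 := by
    rw [f.1 29 (hregs _ (by decide))]; simpa [hs₁] using h29
  have e' : (globalCmd e).den s
      = (ite (lt (var 27) (var 3)) (assign 29 (lit 0)) skip).den (c.den s₁) := by
    simp only [globalCmd, den_seq, den_assign, eval_lit, hs₁, hc]
  have h27 : (c.den s₁).reg 27 = layerCount ℓ (fun i => ∀ a < n, ∀ b < n, ¬ Q i a b) := by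
    rw [key]; simp [hs₁]
  rw [e']
  by_cases hlt : layerCount ℓ (fun i => ∀ a < n, ∀ b < n, ¬ Q i a b) < α
  · rw [den_ite_pos _ (by simpa [h27, e3] using hlt)]
    simp only [den_assign, setReg_reg, if_true, eval_lit, ne_eq, not_true, false_iff, not_le]
    exact hlt
  · rw [den_ite_neg _ (by simpa [h27, e3] using hlt), den_skip]
    exact ⟨fun _ => not_lt.1 hlt, fun _ => e29⟩

theorem pairCmd_spec {n ℓ α : ℕ} {app : ℕ → ℕ → ℕ → Prop} {s : Store}
    (hs : AppState n ℓ α app s) {e₀ e₁ e₂ : Expr} {Q₀ : ℕ → ℕ → Prop} {Q₁ Q₂ : ℕ → ℕ → ℕ → Prop}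
    (he₀ : ∀ t : Store, AppState n ℓ α app t → t.arr 6 = s.arr 6 → t.reg 25 < n →
      t.reg 26 < n → (e₀.holds t ↔ Q₀ (t.reg 25) (t.reg 26)))
    (he₁ : ∀ t : Store, AppState n ℓ α app t → t.arr 6 = s.arr 6 → t.reg 24 < ℓ → t.reg 25 < n →
      t.reg 26 < n → (e₁.holds t ↔ Q₁ (t.reg 24) (t.reg 25) (t.reg 26)))
    (he₂ : ∀ t : Store, AppState n ℓ α app t → t.arr 6 = s.arr 6 → t.reg 24 < ℓ → t.reg 25 < n →
      t.reg 26 < n → (e₂.holds t ↔ Q₂ (t.reg 24) (t.reg 25) (t.reg 26))) :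
    ((pairCmd e₀ e₁ e₂).den s).reg 29 ≠ 0 ↔ s.reg 29 ≠ 0 ∧ ∀ a < n, ∀ b < n, Q₀ a b →
      (α ≤ layerCount ℓ fun i => Q₁ i a b) ∨ α ≤ layerCount ℓ fun i => Q₂ i a b := by
  have key := forall_loop (x := 25) (y := 1) (f := 29) (s := s)
    (P := fun a => ∀ b < n, Q₀ a b →
      (α ≤ layerCount ℓ fun i => Q₁ i a b) ∨ α ≤ layerCount ℓ fun i => Q₂ i a b)
    (p := .loop 26 1 (ite e₀
    (assign 27 (lit 0) ;; assign 28 (lit 0) ;;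
      .loop 24 2 (ite e₁ (assign 27 (add (var 27) (lit 1))) skip ;;
        ite e₂ (assign 28 (add (var 28) (lit 1))) skip) ;;
      ite (and (lt (var 27) (var 3)) (lt (var 28) (var 3))) (assign 29 (lit 0)) skip)
    skip)) (fun a ha u hG => ?_)
  · rw [hs.agents] at key
    exact key
  have hu : AppState n ℓ α app (u.setReg 25 a) :=
    (hs.of_frame hG (by simp [Cmd.regs]) (by simp [Cmd.regs]) (by simp [Cmd.regs])
      (by simp [Cmd.arrs]) (by simp [Cmd.arrs])).of_eq (by simp) (by simp) (by simp) rfl rfl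
  have u6 : u.arr 6 = s.arr 6 := hG.2 6 (by simp [Cmd.arrs])
  rw [hs.agents] at ha
  have key := forall_loop (x := 26) (y := 1) (f := 29) (s := u.setReg 25 a)
    (P := fun b => Q₀ a b →
      (α ≤ layerCount ℓ fun i => Q₁ i a b) ∨ α ≤ layerCount ℓ fun i => Q₂ i a b)
    (p := ite e₀
    (assign 27 (lit 0) ;; assign 28 (lit 0) ;;
      .loop 24 2 (ite e₁ (assign 27 (add (var 27) (lit 1))) skip ;;
        ite e₂ (assign 28 (add (var 28) (lit 1))) skip) ;;
      ite (and (lt (var 27) (var 3)) (lt (var 28) (var 3))) (assign 29 (lit 0)) skip)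
    skip) (fun b hb v hH => ?_)
  · rw [hu.agents] at key
    rw [key]; simp
  rw [hu.agents] at hb
  have hv : AppState n ℓ α app (v.setReg 26 b) :=
    (hu.of_frame hH (by simp [Cmd.regs]) (by simp [Cmd.regs]) (by simp [Cmd.regs])
      (by simp [Cmd.arrs]) (by simp [Cmd.arrs])).of_eq (by simp) (by simp) (by simp) rfl rfl
  have h25 : v.reg 25 = a := by rw [hH.1 25 (by simp [Cmd.regs])]; simp
  have v6 : v.arr 6 = s.arr 6 := by rw [hH.2 6 (by simp [Cmd.arrs]), setReg_arr, u6]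
  have hiff₀ := he₀ (v.setReg 26 b) hv v6 (by simpa [h25] using ha) (by simpa using hb)
  simp only [setReg_reg, h25, if_true, Nat.reduceEqDiff, if_false] at hiff₀
  by_cases h0 : Q₀ a b
  swap
  · rw [den_ite_neg _ (fun h => h0 (hiff₀.1 h))]; simp [h0]
  rw [den_ite_pos _ (hiff₀.2 h0)]
  set c := Cmd.loop 24 2 (ite e₁ (assign 27 (add (var 27) (lit 1))) skip ;;
        ite e₂ (assign 28 (add (var 28) (lit 1))) skip) with hc
  have hregs : ∀ x, x ∉ [24, 27, 28] → x ∉ c.regs := by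
    intro x hx; simpa [hc, Cmd.regs] using hx
  have harrs : ∀ k, k ∉ c.arrs := by intro k; simp [hc, Cmd.arrs]
  set w := (((v.setReg 26 b).setReg 27 0).setReg 28 0) with hw
  have hw' : AppState n ℓ α app w := hv.of_eq (by simp [hw]) (by simp [hw]) (by simp [hw])
    (by simp [hw]) (by simp [hw])
  have f : Frame c w (c.den w) := Cmd.frame _ _
  have body : ∀ i < ℓ, ∀ t, Frame c w t →
      ((Q₁ i a b → ((ite e₁ (assign 27 (add (var 27) (lit 1))) skip ;;
        ite e₂ (assign 28 (add (var 28) (lit 1))) skip).den (t.setReg 24 i)).reg 27 = t.reg 27 + 1) ∧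
      (¬ Q₁ i a b → ((ite e₁ (assign 27 (add (var 27) (lit 1))) skip ;;
        ite e₂ (assign 28 (add (var 28) (lit 1))) skip).den (t.setReg 24 i)).reg 27 = t.reg 27)) ∧
      ((Q₂ i a b → ((ite e₁ (assign 27 (add (var 27) (lit 1))) skip ;;
        ite e₂ (assign 28 (add (var 28) (lit 1))) skip).den (t.setReg 24 i)).reg 28 = t.reg 28 + 1) ∧
      (¬ Q₂ i a b → ((ite e₁ (assign 27 (add (var 27) (lit 1))) skip ;;
        ite e₂ (assign 28 (add (var 28) (lit 1))) skip).den (t.setReg 24 i)).reg 28 = t.reg 28)) := by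
    intro i hi t hF
    have ht : AppState n ℓ α app t := hw'.of_frame hF (hregs _ (by decide)) (hregs _ (by decide))
      (hregs _ (by decide)) (harrs _) (harrs _)
    have t6 : t.arr 6 = s.arr 6 := by rw [hF.2 6 (harrs _)]; simpa [hw] using v6
    have t25 : t.reg 25 = a := by rw [hF.1 25 (hregs _ (by decide))]; simpa [hw] using h25
    have t26 : t.reg 26 = b := by rw [hF.1 26 (hregs _ (by decide))]; simp [hw]
    have hq : ∀ (e : Expr) (Q : ℕ → ℕ → ℕ → Prop),
        (∀ t : Store, AppState n ℓ α app t → t.arr 6 = s.arr 6 → t.reg 24 < ℓ → t.reg 25 < n →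
          t.reg 26 < n → (e.holds t ↔ Q (t.reg 24) (t.reg 25) (t.reg 26))) →
        ∀ t' : Store, t'.arr = t.arr → t'.reg 1 = t.reg 1 → t'.reg 2 = t.reg 2 →
          t'.reg 3 = t.reg 3 → t'.reg 24 = i → t'.reg 25 = t.reg 25 → t'.reg 26 = t.reg 26 →
          (e.holds t' ↔ Q i a b) := by
      intro e Q he t' h0 h1 h2 h3 h4 h5 h6
      have := he t' (ht.of_eq h1 h2 h3 (by rw [h0]) (by rw [h0])) (by rw [h0, t6])
        (by rwa [h4]) (by rwa [h5, t25]) (by rwa [h6, t26])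
      rwa [h4, h5, h6, t25, t26] at this
    have q1 := hq e₁ Q₁ he₁ (t.setReg 24 i) rfl (by simp) (by simp) (by simp) (by simp) (by simp)
      (by simp)
    have q2 := hq e₂ Q₂ he₂ (t.setReg 24 i) rfl (by simp) (by simp) (by simp) (by simp) (by simp)
      (by simp)
    -- The second test runs after register 27 may have been incremented, so it is needed in that
    -- store too.
    have q2' := hq e₂ Q₂ he₂ ((t.setReg 24 i).setReg 27 (t.reg 27 + 1)) rfl (by simp) (by simp)
      (by simp) (by simp) (by simp) (by simp)
    by_cases h1 : Q₁ i a b <;> by_cases h2 : Q₂ i a b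
    · have e : (ite e₁ (assign 27 (add (var 27) (lit 1))) skip ;;
        ite e₂ (assign 28 (add (var 28) (lit 1))) skip).den (t.setReg 24 i) =
          ((t.setReg 24 i).setReg 27 (t.reg 27 + 1)).setReg 28 (t.reg 28 + 1) := by
        rw [den_seq, den_ite_pos _ (q1.2 h1)]
        simp only [den_assign, eval_add, eval_var, eval_lit, setReg_reg, Nat.reduceEqDiff, if_false]
        rw [den_ite_pos _ (q2'.2 h2)]; simp
      rw [e]; simp [h1, h2]
    · have e : (ite e₁ (assign 27 (add (var 27) (lit 1))) skip ;;
        ite e₂ (assign 28 (add (var 28) (lit 1))) skip).den (t.setReg 24 i) =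
          (t.setReg 24 i).setReg 27 (t.reg 27 + 1) := by
        rw [den_seq, den_ite_pos _ (q1.2 h1)]
        simp only [den_assign, eval_add, eval_var, eval_lit, setReg_reg, Nat.reduceEqDiff, if_false]
        rw [den_ite_neg _ (fun h => h2 (q2'.1 h))]; simp
      rw [e]; simp [h1, h2]
    · have e : (ite e₁ (assign 27 (add (var 27) (lit 1))) skip ;;
        ite e₂ (assign 28 (add (var 28) (lit 1))) skip).den (t.setReg 24 i) =
          (t.setReg 24 i).setReg 28 (t.reg 28 + 1) := by
        rw [den_seq, den_ite_neg _ (fun h => h1 (q1.1 h)), den_skip, den_ite_pos _ (q2.2 h2)]; simp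
      rw [e]; simp [h1, h2]
    · have e : (ite e₁ (assign 27 (add (var 27) (lit 1))) skip ;;
        ite e₂ (assign 28 (add (var 28) (lit 1))) skip).den (t.setReg 24 i) =
          (t.setReg 24 i) := by
        rw [den_seq, den_ite_neg _ (fun h => h1 (q1.1 h)), den_skip,
          den_ite_neg _ (fun h => h2 (q2.1 h)), den_skip]
      rw [e]; simp [h1, h2]
  have k1 : (c.den w).reg 27 = w.reg 27 + layerCount (w.reg 2) (fun i => Q₁ i a b) :=
    count_loop fun i hi t hF => (body i (by rwa [hw'.layers] at hi) t hF).1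
  have k2 : (c.den w).reg 28 = w.reg 28 + layerCount (w.reg 2) (fun i => Q₂ i a b) :=
    count_loop fun i hi t hF => (body i (by rwa [hw'.layers] at hi) t hF).2
  have w27 : w.reg 27 = 0 := by simp [hw]
  have w28 : w.reg 28 = 0 := by simp [hw]
  rw [hw'.layers, w27, Nat.zero_add] at k1
  rw [hw'.layers, w28, Nat.zero_add] at k2
  have e3 : (c.den w).reg 3 = α := by rw [f.1 3 (hregs _ (by decide)), hw'.degree]
  have e29 : (c.den w).reg 29 = v.reg 29 := by
    rw [f.1 29 (hregs _ (by decide))]; simp [hw]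
  have e' : (assign 27 (lit 0) ;; assign 28 (lit 0) ;; c ;;
      ite (and (lt (var 27) (var 3)) (lt (var 28) (var 3))) (assign 29 (lit 0)) skip).den
        (v.setReg 26 b)
      = (ite (and (lt (var 27) (var 3)) (lt (var 28) (var 3))) (assign 29 (lit 0)) skip).den
        (c.den w) := by
    simp only [den_seq, den_assign, eval_lit, hw]
  rw [e']
  by_cases hlt : layerCount ℓ (fun i => Q₁ i a b) < α ∧ layerCount ℓ (fun i => Q₂ i a b) < α
  · rw [den_ite_pos _ (by simpa [k1, k2, e3] using hlt)]
    simp only [den_assign, setReg_reg, if_true, eval_lit, ne_eq, not_true, false_iff, not_and]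
    intro _ h
    rcases h h0 with h | h <;> omega
  · rw [den_ite_neg _ (by simpa [k1, k2, e3] using hlt), den_skip, e29]
    refine ⟨fun h => ⟨h, fun _ => ?_⟩, fun h => h.1⟩
    omega

theorem stableCmd_spec {n ℓ α : ℕ} {app : ℕ → ℕ → ℕ → Prop} {s : Store}
    (hs : AppState n ℓ α app s) (hm : Invol n (s.arr 6)) (h29 : s.reg 29 ≠ 0) (N : Notion) :
    ((stableCmd N).den s).reg 29 ≠ 0 ↔ nstable n ℓ α app (s.arr 6) N := by
  have hb : ∀ σ : Base, ∀ t : Store, AppState n ℓ α app t → t.arr 6 = s.arr 6 → t.reg 24 < ℓ →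
      t.reg 25 < n → t.reg 26 < n →
      ((blkE σ).holds t ↔ blk σ app (s.arr 6) (t.reg 24) (t.reg 25) (t.reg 26)) := by
    intro σ t ht h6 h1 h2 h3
    have := ht.holds_blkE (h6 ▸ hm) σ h1 h2 h3
    rwa [h6] at this
  have ha : ∀ x y, ∀ t : Store, AppState n ℓ α app t → t.arr 6 = s.arr 6 → t.reg 24 < ℓ →
      t.reg x < n → t.reg y < n →
      ((appE (var 24) (var x) (var y)).holds t ↔ app (t.reg 24) (t.reg x) (t.reg y)) :=
    fun x y t ht _ h1 h2 h3 => ht.holds_appE (i := var 24) (a := var x) (b := var y) h1 h2 h3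
  have hh : ∀ x, ∀ t : Store, AppState n ℓ α app t → t.arr 6 = s.arr 6 → t.reg 24 < ℓ →
      t.reg x < n → ((hapE (var 24) (var x)).holds t ↔ hap app (s.arr 6) (t.reg 24) (t.reg x)) := by
    intro x t ht h6 h1 h2
    have := ht.holds_hapE (h6 ▸ hm) (i := var 24) (a := var x) h1 h2
    rwa [h6] at this
  cases N with
  | global σ => exact globalCmd_spec hs (hb σ) h29
  | pair σ =>
    rw [stableCmd, pairCmd_spec hs (Q₀ := fun a b => a ≠ b)
      (Q₁ := fun i a b => ¬ blk σ app (s.arr 6) i a b)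
      (Q₂ := fun i a b => ¬ blk σ app (s.arr 6) i a b)
      (fun t _ _ _ _ => by simp)
      (fun t ht h6 h1 h2 h3 => by rw [holds_not, hb σ t ht h6 h1 h2 h3])
      (fun t ht h6 h1 h2 h3 => by rw [holds_not, hb σ t ht h6 h1 h2 h3])]
    simp only [or_self, h29, true_and, ne_eq, not_false_eq_true, nstable]
  | individualWeak =>
    rw [stableCmd, pairCmd_spec hs (Q₀ := fun a b => a ≠ b ∧ s.arr 6 a ≠ b)
      (Q₁ := fun i a b => ¬ app i a b ∨ hap app (s.arr 6) i a)
      (Q₂ := fun i a b => ¬ app i b a ∨ hap app (s.arr 6) i b)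
      (fun t _ h6 _ _ => by simp [h6])
      (fun t ht h6 h1 h2 h3 => by
        rw [holds_or, holds_not, ha 25 26 t ht h6 h1 h2 h3, hh 25 t ht h6 h1 h2])
      (fun t ht h6 h1 h2 h3 => by
        rw [holds_or, holds_not, ha 26 25 t ht h6 h1 h3 h2, hh 26 t ht h6 h1 h3])]
    simp only [h29, true_and, ne_eq, not_false_eq_true, nstable, and_imp]
  | individualSuper =>
    rw [stableCmd, pairCmd_spec hs (Q₀ := fun a b => a ≠ b ∧ s.arr 6 a ≠ b)
      (Q₁ := fun i a b => ¬ app i a b ∧ hap app (s.arr 6) i a)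
      (Q₂ := fun i a b => ¬ app i b a ∧ hap app (s.arr 6) i b)
      (fun t _ h6 _ _ => by simp [h6])
      (fun t ht h6 h1 h2 h3 => by
        rw [holds_and, holds_not, ha 25 26 t ht h6 h1 h2 h3, hh 25 t ht h6 h1 h2])
      (fun t ht h6 h1 h2 h3 => by
        rw [holds_and, holds_not, ha 26 25 t ht h6 h1 h3 h2, hh 26 t ht h6 h1 h3])]
    simp only [h29, true_and, ne_eq, not_false_eq_true, nstable, and_imp]

/-- For a wrong guess array 6 may hold anything. That it holds an involution is tested before
stability, because the stability test is only known to be correct for matchings. -/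
theorem checkCmd_spec {n ℓ α : ℕ} {app : ℕ → ℕ → ℕ → Prop} {s : Store}
    (hs : AppState n ℓ α app s) (N : Notion) :
    ((checkCmd N).den s).reg 29 ≠ 0 ↔ Invol n (s.arr 6) ∧ nstable n ℓ α app (s.arr 6) N := by
  set s₁ := s.setReg 29 1 with hs₁
  set s₂ := involCmd.den s₁ with hs₂
  have f : Frame involCmd s₁ s₂ := Cmd.frame _ _
  have hs₁' : AppState n ℓ α app s₁ := hs.of_eq (by simp [hs₁]) (by simp [hs₁]) (by simp [hs₁])
    (by simp [hs₁]) (by simp [hs₁])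
  have hs₂' : AppState n ℓ α app s₂ := hs₁'.of_frame f (by decide) (by decide) (by decide)
    (by decide) (by decide)
  have e6 : s₂.arr 6 = s.arr 6 := by rw [f.2 6 (by decide)]; simp [hs₁]
  have key := involCmd_spec hs₁'.agents
  have e16 : s₁.arr 6 = s.arr 6 := by simp [hs₁]
  rw [← hs₂, e16] at key
  have e : (checkCmd N).den s = (ite (var 29) (stableCmd N) skip).den s₂ := by
    simp only [checkCmd, den_seq, den_assign, eval_lit, hs₂, hs₁]
  rw [e]
  by_cases h : Invol n (s.arr 6)
  · have h29 : s₂.reg 29 ≠ 0 := key.2 ⟨by simp [hs₁], h⟩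
    rw [den_ite_pos _ ((holds_var _ _).2 h29), stableCmd_spec hs₂' (by rwa [e6]) h29, e6]
    simp [h]
  · have h29 : ¬ s₂.reg 29 ≠ 0 := fun h' => h (key.1 h').2
    rw [den_ite_neg _ (mt (holds_var _ _).1 h29), den_skip]
    exact ⟨fun h' => absurd h' h29, fun h' => absurd h'.1 h⟩

/-! ### Reconstruction of a matching from a guess -/

/-- Agent `a` takes part in the matching problem. -/
def plays (app : ℕ → ℕ → ℕ → Prop) (chg : ℕ → Prop) (M : ℕ → ℕ) (a : ℕ) : Prop :=
  ¬ chg a ∨ isOut app chg M a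

/-- Agent `a` has to be covered. -/
def needs (n : ℕ) (app : ℕ → ℕ → ℕ → Prop) (chg : ℕ → Prop) (M : ℕ → ℕ) (a : ℕ) : Prop :=
  (chg a ∧ isOut app chg M a) ∨ (¬ chg a ∧ isNeeded n app chg M a)

/-- The pairs that may be matched. -/
def hedge (app : ℕ → ℕ → ℕ → Prop) (chg : ℕ → Prop) (M : ℕ → ℕ) (a b : ℕ) : Prop :=
  a ≠ b ∧ plays app chg M a ∧ plays app chg M b ∧ app 0 a b ∧ ¬ (chg a ∧ chg b)

/-- Two copies of the graph of the pairs that may be matched, with the two copies of `a` joined if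
`a` may stay uncovered. The perfect matchings of this graph restrict to the matchings that cover the
agents that have to be covered. -/
def doubled (n : ℕ) (app : ℕ → ℕ → ℕ → Prop) (chg : ℕ → Prop) (M : ℕ → ℕ) (x y : ℕ) : Prop :=
  (x < n ∧ y < n ∧ hedge app chg M x y) ∨
  ((n ≤ x ∧ x < n + n) ∧ (n ≤ y ∧ y < n + n) ∧ hedge app chg M (x - n) (y - n)) ∨
  (x < n ∧ y = x + n ∧ ¬ needs n app chg M x) ∨
  (y < n ∧ x = y + n ∧ ¬ needs n app chg M y)

namespace Sys

variable {n ℓ : ℕ} {app : ℕ → ℕ → ℕ → Prop} {chg : ℕ → Prop} {M : ℕ → ℕ}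

theorem hedge_symm (S : Sys n ℓ app chg) {a b : ℕ} (ha : a < n) (hb : b < n)
    (h : hedge app chg M a b) : hedge app chg M b a :=
  ⟨h.1.symm, h.2.2.1, h.2.1, S.symm 0 S.pos a ha b hb h.2.2.2.1, fun h' => h.2.2.2.2 h'.symm⟩

theorem doubled_symm (S : Sys n ℓ app chg) {x y : ℕ} (h : doubled n app chg M x y) :
    doubled n app chg M y x := by
  rcases h with ⟨h1, h2, h3⟩ | ⟨h1, h2, h3⟩ | h | h
  · exact Or.inl ⟨h2, h1, S.hedge_symm h1 h2 h3⟩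
  · exact Or.inr (Or.inl ⟨h2, h1, S.hedge_symm (by omega) (by omega) h3⟩)
  · exact Or.inr (Or.inr (Or.inr h))
  · exact Or.inr (Or.inr (Or.inl h))

theorem doubled_irrefl (x : ℕ) : ¬ doubled n app chg M x x := by
  rintro (⟨_, _, h⟩ | ⟨_, _, h⟩ | ⟨_, _, _⟩ | ⟨_, _, _⟩)
  · exact h.1 rfl
  · exact h.1 rfl
  · omega
  · omega

/-- Every agent that must be covered is matched by `M` itself along a permitted pair, which makes
the matching problem solvable for the right guess. -/
theorem hedge_mate (S : Sys n ℓ app chg) (hM : Invol n M) {a : ℕ} (ha : a < n)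
    (h : needs n app chg M a) : hedge app chg M a (M a) := by
  rcases h with ⟨hc, ho⟩ | ⟨hc, hn⟩
  · exact ⟨ho.2.1.symm, Or.inr ho, Or.inl ho.2.2.1, ho.2.2.2, fun h => ho.2.2.1 h.2⟩
  · obtain ⟨h1, h2⟩ := hap_of_isNeeded ha hc hn
    refine ⟨h1.symm, Or.inl hc, ?_, h2, fun h => hc h.1⟩
    by_cases hcm : chg (M a)
    · refine Or.inr ⟨hcm, ?_, ?_, ?_⟩
      · rw [(hM a ha).2]; exact h1.symm
      · rwa [(hM a ha).2]
      · rw [(hM a ha).2]; exact S.symm 0 S.pos a ha _ (hM a ha).1 h2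
    · exact Or.inl hcm

-- Use `M` in both copies wherever its pair is permitted, and join the two copies of every other
-- agent. By `hedge_mate` no agent that must be covered needs the latter.
open Classical in
theorem exists_perfect (S : Sys n ℓ app chg) (hM : Invol n M) :
    ∃ f, IsMat (n + n) (doubled n app chg M) f ∧ ∀ u < n + n, f u ≠ u := by
  set f : ℕ → ℕ := fun x => if x < n then (if hedge app chg M x (M x) then M x else x + n)
    else (if hedge app chg M (x - n) (M (x - n)) then M (x - n) + n else x - n) with hf
  have f1 : ∀ a < n, hedge app chg M a (M a) → f a = M a := fun a ha h => by simp [hf, ha, h]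
  have f2 : ∀ a < n, ¬ hedge app chg M a (M a) → f a = a + n := fun a ha h => by simp [hf, ha, h]
  have f3 : ∀ a < n, hedge app chg M a (M a) → f (a + n) = M a + n := fun a ha h => by simp [hf, h]
  have f4 : ∀ a < n, ¬ hedge app chg M a (M a) → f (a + n) = a := fun a ha h => by simp [hf, h]
  have hsym : ∀ a < n, hedge app chg M a (M a) → hedge app chg M (M a) (M (M a)) := by
    intro a ha h
    rw [(hM a ha).2]
    exact S.hedge_symm ha (hM a ha).1 h
  have key : ∀ u < n + n, f u < n + n ∧ f (f u) = u ∧ doubled n app chg M u (f u) := by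
    intro u hu
    rcases lt_or_ge u n with h | h
    · have hm := hM u h
      by_cases hh : hedge app chg M u (M u)
      · rw [f1 u h hh, f1 _ hm.1 (hsym u h hh)]
        exact ⟨by omega, hm.2, Or.inl ⟨h, hm.1, hh⟩⟩
      · rw [f2 u h hh, f4 u h hh]
        exact ⟨by omega, rfl, Or.inr (Or.inr (Or.inl ⟨h, rfl, fun h' => hh (S.hedge_mate hM h h')⟩))⟩
    · obtain ⟨a, rfl⟩ : ∃ a, u = a + n := ⟨u - n, by omega⟩
      have ha : a < n := by omega
      have hm := hM a ha
      by_cases hh : hedge app chg M a (M a)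
      · rw [f3 a ha hh, f3 _ hm.1 (hsym a ha hh)]
        exact ⟨by omega, by omega, Or.inr (Or.inl ⟨⟨h, hu⟩, ⟨by omega, by omega⟩, by simpa using hh⟩)⟩
      · rw [f4 a ha hh, f2 a ha hh]
        exact ⟨by omega, rfl,
          Or.inr (Or.inr (Or.inr ⟨ha, rfl, fun h' => hh (S.hedge_mate hM ha h')⟩))⟩
  refine ⟨f, fun u hu => ⟨(key u hu).1, (key u hu).2.1, fun _ => (key u hu).2.2⟩, fun u hu e => ?_⟩
  have := (key u hu).2.2
  rw [e] at this
  exact doubled_irrefl u this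

end Sys

/-- The matching `m` arises from `m₀` by adding pairs that satisfy `R`. -/
structure Grown (n : ℕ) (R : ℕ → ℕ → Prop) (m₀ m : ℕ → ℕ) : Prop where
  invol : Invol n m
  ext : ∀ a < n, m₀ a ≠ a → m a = m₀ a
  new : ∀ a < n, m₀ a = a → m a ≠ a → R a (m a) ∨ R (m a) a

/-- The matching before greedy extension. -/
def Seeded (n : ℕ) (app : ℕ → ℕ → ℕ → Prop) (chg : ℕ → Prop) (M pm m : ℕ → ℕ) : Prop :=
  ∀ a < n, (plays app chg M a → pm a < n → m a = pm a) ∧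
    (plays app chg M a → ¬ pm a < n → m a = a) ∧
    (¬ plays app chg M a → chg (M a) → m a = M a) ∧
    (¬ plays app chg M a → ¬ chg (M a) → m a = a)

namespace Sys

variable {n ℓ : ℕ} {app : ℕ → ℕ → ℕ → Prop} {chg : ℕ → Prop} {M pm m₁ : ℕ → ℕ}

/-- In the first copy, a perfect matching either stays inside along a permitted pair, or goes to the
twin, which is adjacent only if the agent may stay uncovered. -/
theorem pm_cases (hpm : IsMat (n + n) (doubled n app chg M) pm) (hne : ∀ u < n + n, pm u ≠ u) {a : ℕ}
    (ha : a < n) : (pm a < n ∧ pm (pm a) = a ∧ hedge app chg M a (pm a)) ∨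
      (¬ pm a < n ∧ ¬ needs n app chg M a) := by
  obtain ⟨h1, h2, h3⟩ := hpm a (by omega)
  rcases h3 (hne a (by omega)) with h | h | h | h
  · exact Or.inl ⟨h.2.1, h2, h.2.2⟩
  · omega
  · exact Or.inr ⟨by omega, h.2.2⟩
  · omega

theorem not_plays_mate (hM : Invol n M) {a : ℕ} (ha : a < n) (h : ¬ plays app chg M a)
    (hc : chg (M a)) : ¬ plays app chg M (M a) ∧ chg (M (M a)) := by
  rw [(hM a ha).2]
  unfold plays at h ⊢
  push Not at h ⊢
  refine ⟨⟨hc, fun ho => ho.2.2.1 ?_⟩, h.1⟩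
  rw [(hM a ha).2]
  exact h.1

theorem seeded_invol (hM : Invol n M) (hpm : IsMat (n + n) (doubled n app chg M) pm)
    (hne : ∀ u < n + n, pm u ≠ u) (h : Seeded n app chg M pm m₁) : Invol n m₁ := by
  intro a ha
  obtain ⟨h1, h2, h3, h4⟩ := h a ha
  by_cases hp : plays app chg M a
  · rcases pm_cases hpm hne ha with ⟨g1, g2, g3⟩ | ⟨g1, _⟩
    · rw [h1 hp g1, (h _ g1).1 g3.2.2.1 (by rwa [g2])]
      exact ⟨g1, g2⟩
    · rw [h2 hp g1, h2 hp g1]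
      exact ⟨ha, rfl⟩
  · by_cases hc : chg (M a)
    · obtain ⟨g1, g2⟩ := not_plays_mate hM ha hp hc
      rw [h3 hp hc, (h _ (hM a ha).1).2.2.1 g1 g2]
      exact hM a ha
    · rw [h4 hp hc, h4 hp hc]
      exact ⟨ha, rfl⟩

theorem seeded_of_needs (hpm : IsMat (n + n) (doubled n app chg M) pm)
    (hne : ∀ u < n + n, pm u ≠ u) (h : Seeded n app chg M pm m₁) {a : ℕ} (ha : a < n)
    (hn : needs n app chg M a) : m₁ a ≠ a := by
  have hp : plays app chg M a := by
    rcases hn with ⟨_, h'⟩ | ⟨h', _⟩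
    · exact Or.inr h'
    · exact Or.inl h'
  rcases pm_cases hpm hne ha with ⟨g1, _, g3⟩ | ⟨_, g⟩
  · rw [(h a ha).1 hp g1]; exact g3.1.symm
  · exact absurd hn g

/-- Greedy extension of the seed gives a reconstruction. -/
theorem rebuilt (S : Sys n ℓ app chg) {m₂ m : ℕ → ℕ}
    (hpm : IsMat (n + n) (doubled n app chg M) pm) (hne : ∀ u < n + n, pm u ≠ u)
    (h : Seeded n app chg M pm m₁)
    (h₂ : Grown n (fun a b => ¬ chg a ∧ ¬ chg b ∧ app 0 a b) m₁ m₂)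
    (hmax₂ : ∀ a < n, ∀ b < n, a ≠ b → (¬ chg a ∧ ¬ chg b ∧ app 0 a b) → m₂ a ≠ a ∨ m₂ b ≠ b)
    (h₃ : Grown n (fun _ _ => True) m₂ m)
    (hmax : ∀ a < n, ∀ b < n, a ≠ b → True → m a ≠ a ∨ m b ≠ b) :
    Rebuilt n app chg M m₂ m := by
  have hneed : ∀ a < n, needs n app chg M a → m₂ a ≠ a := by
    intro a ha hn
    have := seeded_of_needs hpm hne h ha hn
    rwa [h₂.ext a ha this]
  refine ⟨h₂.invol, h₃.invol, h₃.ext, fun a ha b hb hab => hmax a ha b hb hab trivial, ?_,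
    fun c hc ho => hneed c hc (Or.inl ⟨ho.1, ho⟩), ?_, fun u hu hc hn => hneed u hu (Or.inr ⟨hc, hn⟩),
    fun u hu v hv h1 h2 h3 h4 => hmax₂ u hu v hv h3 ⟨h1, h2, h4⟩⟩
  · intro a ha hma
    obtain ⟨h1, h2, h3, h4⟩ := h a ha
    by_cases hm1 : m₁ a = a
    · right
      rcases h₂.new a ha hm1 hma with g | g
      · exact ⟨g.2.2, fun h' => g.1 h'.1⟩
      · exact ⟨S.symm 0 S.pos _ (h₂.invol a ha).1 _ ha g.2.2, fun h' => g.1 h'.2⟩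
    · rw [h₂.ext a ha hm1]
      by_cases hp : plays app chg M a
      · rcases pm_cases hpm hne ha with ⟨g1, _, g3⟩ | ⟨g, _⟩
        · rw [h1 hp g1]; exact Or.inr g3.2.2.2
        · exact absurd (h2 hp g) hm1
      · by_cases hc : chg (M a)
        · left
          rw [h3 hp hc]
          exact ⟨not_not.1 fun h' => hp (Or.inl h'), hc, rfl⟩
        · exact absurd (h4 hp hc) hm1
  · intro c hc hcc hcm
    have hp : ¬ plays app chg M c := by
      rintro (h' | h')
      · exact h' hcc
      · exact h'.2.2.1 hcm
    have e := (h c hc).2.2.1 hp hcm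
    -- If the seed leaves `c` single, then `M c = c`: an unmatched changing agent counts as its own
    -- changing partner. The greedy step does not touch it, as it only pairs unchanging agents.
    by_cases hm1 : m₁ c = c
    · rw [← e, hm1]
      by_contra hne'
      rcases h₂.new c hc hm1 hne' with g | g
      · exact g.1 hcc
      · exact g.2.1 hcc
    · rw [h₂.ext c hc hm1, e]

end Sys

/-! ### Greedy extension -/

/-- Match unmatched agents that satisfy `e`, as long as there are any. -/
def greedyCmd (e : Expr) : Cmd :=
  .loop 25 1 (.loop 26 1 (ite
    (and (ne (var 25) (var 26)) (and (eq (get 6 (var 25)) (var 25))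
      (and (eq (get 6 (var 26)) (var 26)) e)))
    (put 6 (var 25) (var 26) ;; put 6 (var 26) (var 25)) skip))

theorem Grown.refl {n : ℕ} {R : ℕ → ℕ → Prop} {m : ℕ → ℕ} (h : Invol n m) : Grown n R m m :=
  ⟨h, fun _ _ _ => rfl, fun _ _ h h' => absurd h h'⟩

theorem Grown.update {n : ℕ} {R : ℕ → ℕ → Prop} {m₀ m : ℕ → ℕ} (h : Grown n R m₀ m) {a b : ℕ}
    (ha : a < n) (hb : b < n) (hab : a ≠ b) (hma : m a = a) (hmb : m b = b) (hR : R a b) :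
    Grown n R m₀ (Function.update (Function.update m a b) b a) := by
  have ea : Function.update (Function.update m a b) b a a = b := by simp [hab]
  have eb : Function.update (Function.update m a b) b a b = a := by simp
  have ex : ∀ x, x ≠ a → x ≠ b → Function.update (Function.update m a b) b a x = m x :=
    fun x h1 h2 => by simp [h1, h2]
  have hba : ∀ x < n, x ≠ a → x ≠ b → m x ≠ a ∧ m x ≠ b := by
    intro x hx h1 h2
    have := (h.invol x hx).2
    refine ⟨fun e => h1 ?_, fun e => h2 ?_⟩
    · rw [e, hma] at this; exact this.symm
    · rw [e, hmb] at this; exact this.symm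
  have h0 : ∀ x < n, m x = x → m₀ x = x := fun x hx e => by
    by_contra hne
    exact hne ((h.ext x hx hne).symm.trans e)
  refine ⟨fun x hx => ?_, fun x hx hne => ?_, fun x hx h1 h2 => ?_⟩
  · by_cases h1 : x = a
    · subst h1; rw [ea, eb]; exact ⟨hb, rfl⟩
    by_cases h2 : x = b
    · subst h2; rw [eb, ea]; exact ⟨ha, rfl⟩
    rw [ex x h1 h2, ex _ (hba x hx h1 h2).1 (hba x hx h1 h2).2]
    exact h.invol x hx
  · by_cases h1 : x = a
    · subst h1; exact absurd (h0 x hx hma) hne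
    by_cases h2 : x = b
    · subst h2; exact absurd (h0 x hx hmb) hne
    rw [ex x h1 h2]; exact h.ext x hx hne
  · by_cases h3 : x = a
    · subst h3; rw [ea]; exact Or.inl hR
    by_cases h4 : x = b
    · subst h4; rw [eb]; exact Or.inr hR
    rw [ex x h3 h4] at h2 ⊢
    exact h.new x hx h1 h2

/-- A single pass is maximal: after a pair has been considered it either fails `R` or has a matched
member, and matched agents stay matched. The hypothesis on `e` excludes any influence of the growing
matching on the test. -/
theorem greedyCmd_spec {n : ℕ} {e : Expr} {R : ℕ → ℕ → Prop} {s : Store} (hn : s.reg 1 = n)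
    (hm : Invol n (s.arr 6))
    (he : ∀ t : Store, Frame (greedyCmd e) s t → t.reg 25 < n → t.reg 26 < n →
      (e.holds t ↔ R (t.reg 25) (t.reg 26))) :
    Grown n R (s.arr 6) (((greedyCmd e).den s).arr 6) ∧
      ∀ a < n, ∀ b < n, a ≠ b → R a b →
        ((greedyCmd e).den s).arr 6 a ≠ a ∨ ((greedyCmd e).den s).arr 6 b ≠ b := by
  set p := ite (and (ne (var 25) (var 26)) (and (eq (get 6 (var 25)) (var 25))
      (and (eq (get 6 (var 26)) (var 26)) e)))
    (put 6 (var 25) (var 26) ;; put 6 (var 26) (var 25)) skip with hp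
  set Inv : (ℕ → ℕ → Prop) → Store → Prop := fun P t => Grown n R (s.arr 6) (t.arr 6) ∧
    ∀ a < n, ∀ b < n, P a b → a ≠ b → R a b → t.arr 6 a ≠ a ∨ t.arr 6 b ≠ b with hInv
  have congrI : ∀ {P Q : ℕ → ℕ → Prop} {t t' : Store}, Inv P t → t'.arr 6 = t.arr 6 →
      (∀ a < n, ∀ b < n, Q a b → P a b) → Inv Q t' := by
    rintro P Q t t' ⟨h1, h2⟩ h6 hPQ
    rw [hInv]; dsimp only
    rw [h6]
    exact ⟨h1, fun a ha b hb h => h2 a ha b hb (hPQ a ha b hb h)⟩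
  have hreg : ∀ x, x ∉ [25, 26] → x ∉ (greedyCmd e).regs := by
    intro x hx; simpa [greedyCmd, Cmd.regs] using hx
  have harr : ∀ x, x ∉ [6] → x ∉ (greedyCmd e).arrs := by
    intro x hx; simpa [greedyCmd, Cmd.arrs] using hx
  have step : ∀ {P : ℕ → ℕ → Prop} {t : Store} {a b : ℕ}, a < n → b < n →
      Frame (greedyCmd e) s t → t.reg 25 = a → t.reg 26 = b → Inv P t →
      Inv (fun x y => P x y ∨ (x = a ∧ y = b)) (p.den t) := by
    rintro P t a b ha hb hF h25 h26 ⟨h1, h2⟩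
    have hiff := he t hF (by rwa [h25]) (by rwa [h26])
    by_cases h : a ≠ b ∧ t.arr 6 a = a ∧ t.arr 6 b = b ∧ R a b
    · obtain ⟨h3, h4, h5, h6⟩ := h
      rw [hp, den_ite_pos _ (by simp [h25, h26, h3, h4, h5]; rw [hiff, h25, h26]; exact h6)]
      have e6 : ((put 6 (var 25) (var 26) ;; put 6 (var 26) (var 25)).den t).arr 6
          = Function.update (Function.update (t.arr 6) a b) b a := by
        simp [h25, h26]
      have g := h1.update ha hb h3 h4 h5 h6
      rw [hInv]; dsimp only
      rw [e6]
      refine ⟨g, ?_⟩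
      have mono : ∀ x, x ≠ a → x ≠ b → t.arr 6 x ≠ x →
          Function.update (Function.update (t.arr 6) a b) b a x ≠ x := by
        intro x hxa hxb hx; simpa [hxa, hxb] using hx
      have hA : Function.update (Function.update (t.arr 6) a b) b a a ≠ a := by
        simp [h3, h3.symm]
      have hB : Function.update (Function.update (t.arr 6) a b) b a b ≠ b := by
        simp [h3]
      rintro x hx y hy hxy hne hR
      by_cases hxa : x = a
      · left; rw [hxa]; exact hA
      by_cases hxb : x = b
      · left; rw [hxb]; exact hB
      by_cases hya : y = a
      · right; rw [hya]; exact hA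
      by_cases hyb : y = b
      · right; rw [hyb]; exact hB
      have hP : P x y := by
        rcases hxy with h | h
        · exact h
        · exact absurd h.1 hxa
      rcases h2 x hx y hy hP hne hR with h | h
      · exact Or.inl (mono x hxa hxb h)
      · exact Or.inr (mono y hya hyb h)
    · have hno : ¬ (and (ne (var 25) (var 26)) (and (eq (get 6 (var 25)) (var 25))
          (and (eq (get 6 (var 26)) (var 26)) e))).holds t := by
        simp only [holds_and, holds_ne, holds_eq, eval_var, eval_get, h25, h26, hiff]
        exact h
      rw [hp, den_ite_neg _ hno, den_skip]
      refine ⟨h1, fun x hx y hy hxy hne hR => ?_⟩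
      rcases hxy with h' | ⟨rfl, rfl⟩
      · exact h2 x hx y hy h' hne hR
      · by_contra hcon
        push Not at hcon
        exact h ⟨hne, hcon.1, hcon.2, hR⟩
  have key := Cmd.loop_inv (x := 25) (y := 1) (p := .loop 26 1 p) (s₀ := s)
    (fun i t => Inv (fun x _ => x < i) t) ⟨Grown.refl hm, by simp⟩ (by
      rintro i hi t hF It
      rw [hn] at hi
      have hF' : Frame (greedyCmd e) s t := hF
      have e1 : (t.setReg 25 i).reg 1 = n := by
        simp [hF'.1 1 (hreg 1 (by decide)), hn]
      have key := Cmd.loop_inv (x := 26) (y := 1) (p := p) (s₀ := t.setReg 25 i)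
        (fun j u => Inv (fun x y => x < i ∨ (x = i ∧ y < j)) u)
        (congrI It rfl (by simp)) (by
          rintro j hj u hG Iu
          rw [e1] at hj
          have hFu : Frame (greedyCmd e) s (u.setReg 26 j) := by
            refine ⟨fun x hx => ?_, fun k hk => ?_⟩
            · have hx' : x ≠ 25 ∧ x ≠ 26 := by
                simpa [greedyCmd, Cmd.regs] using hx
              rw [setReg_reg, if_neg hx'.2, hG.1 x (by simpa [hp, Cmd.regs] using hx'.2),
                setReg_reg, if_neg hx'.1, hF'.1 x hx]
            · have hk' : k ≠ 6 := by simpa [greedyCmd, Cmd.arrs] using hk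
              rw [setReg_arr, hG.2 k (by simpa [hp, Cmd.arrs] using hk'), setReg_arr, hF'.2 k hk]
          have h25 : u.reg 25 = i := by
            rw [hG.1 25 (by simp [hp, Cmd.regs])]; simp
          have := step (P := fun x y => x < i ∨ (x = i ∧ y < j)) (a := i) (b := j) hi hj hFu
            (by simp [h25]) (by simp) (congrI Iu rfl (fun _ _ _ _ h => h))
          exact congrI this rfl (fun a _ b _ h => by omega))
      rw [e1] at key
      exact congrI key rfl (fun a _ b hb h => by omega))
  rw [hn] at key
  exact ⟨key.1, fun a ha b hb hab hR => key.2 a ha b hb ha hab hR⟩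

/-! ### The matching for a guess -/

/-- The store lists the `β` agents that satisfy `chg`. -/
structure ListState (n β : ℕ) (chg : ℕ → Prop) (s : Store) : Prop where
  count : s.reg 5 = β
  mem_iff : ∀ a < n, (s.arr 4 a ≠ 0 ↔ chg a)
  index : ∀ a < n, chg a → s.arr 4 a - 1 < β ∧ s.arr 3 (s.arr 4 a - 1) = a

theorem ListState.of_eq {n β : ℕ} {chg : ℕ → Prop} {s s' : Store} (h : ListState n β chg s)
    (h1 : s'.reg 5 = s.reg 5) (h2 : s'.arr 3 = s.arr 3) (h3 : s'.arr 4 = s.arr 4) :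
    ListState n β chg s' := by
  obtain ⟨g1, g2, g3⟩ := h
  refine ⟨h1.trans g1, ?_, ?_⟩ <;> rw [h3]
  · exact g2
  · rw [h2]; exact g3

/-- The digits `d` describe how the matching `M` treats the listed agents. -/
structure Describes (n β : ℕ) (app : ℕ → ℕ → ℕ → Prop) (chg : ℕ → Prop) (M item idx d : ℕ → ℕ) :
    Prop where
  inside : ∀ a < n, chg a → chg (M a) → d (idx a - 1) < β ∧ item (d (idx a - 1)) = M a
  out : ∀ a < n, chg a → ¬ chg (M a) → isOut app chg M a → d (idx a - 1) = β
  alone : ∀ a < n, chg a → ¬ chg (M a) → ¬ isOut app chg M a → d (idx a - 1) = β + 1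
  nbrs : ∀ a < n, chg a → (d (β + (idx a - 1)) ≠ 0 ↔ nbrsHappy n app chg M a)
  all : d (β + β) ≠ 0 ↔ allHappy n app chg M

open Classical in
theorem ListState.exists_describes {n β : ℕ} {app : ℕ → ℕ → ℕ → Prop} {chg : ℕ → Prop} {s : Store}
    (h : ListState n β chg s) {M : ℕ → ℕ} (hM : Invol n M) :
    ∃ d : ℕ → ℕ, (∀ j, d j < β + 2) ∧ Describes n β app chg M (s.arr 3) (s.arr 4) d := by
  -- The minimum with `β` keeps every digit below the base, even at positions about whose list entry
  -- nothing is known. At the positions of changing agents it has no effect.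
  set d : ℕ → ℕ := fun j =>
    if j < β then
      if chg (M (s.arr 3 j)) then min (s.arr 4 (M (s.arr 3 j)) - 1) β
      else if isOut app chg M (s.arr 3 j) then β else β + 1
    else if j < β + β then if nbrsHappy n app chg M (s.arr 3 (j - β)) then 1 else 0
    else if allHappy n app chg M then 1 else 0 with hd
  refine ⟨d, fun j => ?_, fun a ha hc hcm => ?_, fun a ha hc hcm ho => ?_,
    fun a ha hc hcm ho => ?_, fun a ha hc => ?_, ?_⟩
  · simp only [hd]
    split_ifs <;> omega
  · obtain ⟨h1, h2⟩ := h.index a ha hc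
    obtain ⟨h3, h4⟩ := h.index _ (hM a ha).1 hcm
    have e : d (s.arr 4 a - 1) = s.arr 4 (M a) - 1 := by
      simp only [hd, if_pos h1, h2, if_pos hcm]; omega
    rw [e]
    exact ⟨h3, h4⟩
  · obtain ⟨h1, h2⟩ := h.index a ha hc
    simp only [hd, if_pos h1, h2, if_neg hcm, if_pos ho]
  · obtain ⟨h1, h2⟩ := h.index a ha hc
    simp only [hd, if_pos h1, h2, if_neg hcm, if_neg ho]
  · obtain ⟨h1, h2⟩ := h.index a ha hc
    have e1 : ¬ β + (s.arr 4 a - 1) < β := by omega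
    have e2 : β + (s.arr 4 a - 1) < β + β := by omega
    have e3 : β + (s.arr 4 a - 1) - β = s.arr 4 a - 1 := by omega
    simp only [hd, if_neg e1, if_pos e2, e3, h2]
    split_ifs with hq <;> simp [hq]
  · have e1 : ¬ β + β < β := by omega
    simp only [hd, if_neg e1, if_neg (lt_irrefl (β + β))]
    split_ifs with hq <;> simp [hq]

/-- The digit of the agent in register 25. -/
def digE : Expr := get 5 (sub (get 4 (var 25)) (lit 1))

/-- Read off from the digits who does not take part in the matching problem (array 17), the pairs
inside the list (array 6), and the marks that make neighbours covered (array 18). -/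
def decodeCmd : Cmd :=
  .loop 25 1
    (put 17 (var 25) (and (get 4 (var 25)) (ne digE (var 5))) ;;
      put 18 (var 25) (or (get 5 (add (var 5) (var 5)))
        (and (get 4 (var 25)) (get 5 (add (var 5) (sub (get 4 (var 25)) (lit 1)))))) ;;
      ite (and (get 4 (var 25)) (lt digE (var 5))) (put 6 (var 25) (get 3 digE))
        (put 6 (var 25) (var 25)))

/-- The result of decoding. -/
structure Decoded (n : ℕ) (app : ℕ → ℕ → ℕ → Prop) (chg : ℕ → Prop) (M : ℕ → ℕ) (s : Store) (a : ℕ) :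
    Prop where
  kind : s.arr 17 a ≠ 0 ↔ ¬ plays app chg M a
  mark : s.arr 18 a ≠ 0 ↔ allHappy n app chg M ∨ (chg a ∧ nbrsHappy n app chg M a)
  inside : ¬ plays app chg M a → chg (M a) → s.arr 6 a = M a
  alone : ¬ plays app chg M a → ¬ chg (M a) → s.arr 6 a = a

open Classical in
theorem decodeCmd_spec {n β : ℕ} {app : ℕ → ℕ → ℕ → Prop} {chg : ℕ → Prop} {M : ℕ → ℕ} {s : Store}
    (hn : s.reg 1 = n) (hL : ListState n β chg s)
    (hd : Describes n β app chg M (s.arr 3) (s.arr 4) (s.arr 5)) :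
    ∀ a < n, Decoded n app chg M (decodeCmd.den s) a := by
  suffices h : ∀ a < s.reg 1, Decoded n app chg M (decodeCmd.den s) a by rwa [hn] at h
  refine Cmd.loop_inv (fun i t => ∀ a < i, Decoded n app chg M t a) (by simp) ?_
  intro i hi t hF It
  rw [hn] at hi
  set q := (put 17 (var 25) (and (get 4 (var 25)) (ne digE (var 5))) ;;
      put 18 (var 25) (or (get 5 (add (var 5) (var 5)))
        (and (get 4 (var 25)) (get 5 (add (var 5) (sub (get 4 (var 25)) (lit 1)))))) ;;
      ite (and (get 4 (var 25)) (lt digE (var 5))) (put 6 (var 25) (get 3 digE))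
        (put 6 (var 25) (var 25))).den (t.setReg 25 i) with hq
  have r5 : t.reg 5 = β := (hF.1 5 (by decide)).trans hL.count
  have a3 := hF.2 3 (by decide)
  have a4 := hF.2 4 (by decide)
  have a5 := hF.2 5 (by decide)
  have hchg := hL.mem_iff i hi
  set v := and (get 4 (var 25)) (ne digE (var 5)) with hv
  set w := or (get 5 (add (var 5) (var 5)))
        (and (get 4 (var 25)) (get 5 (add (var 5) (sub (get 4 (var 25)) (lit 1))))) with hw
  set t₁ := (t.setReg 25 i).setArr 17 i (v.eval (t.setReg 25 i)) with ht₁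
  set t₂ := t₁.setArr 18 i (w.eval t₁) with ht₂
  have eq₂ : q = (ite (and (get 4 (var 25)) (lt digE (var 5))) (put 6 (var 25) (get 3 digE))
        (put 6 (var 25) (var 25))).den t₂ := by
    simp [hq, ht₂, ht₁]
  have hvi : v.eval (t.setReg 25 i) ≠ 0 ↔ chg i ∧ s.arr 5 (s.arr 4 i - 1) ≠ β := by
    have : v.holds (t.setReg 25 i) ↔ chg i ∧ s.arr 5 (s.arr 4 i - 1) ≠ β := by
      simp only [hv, holds_and, holds_get, holds_ne, digE, eval_get, eval_var, eval_sub, eval_lit,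
        setReg_reg, setReg_arr, a4, a5, if_true, Nat.reduceEqDiff, if_false, r5, hchg]
    exact this
  have hwi : w.eval t₁ ≠ 0 ↔ s.arr 5 (β + β) ≠ 0 ∨ (chg i ∧ s.arr 5 (β + (s.arr 4 i - 1)) ≠ 0) := by
    have : w.holds t₁ ↔ s.arr 5 (β + β) ≠ 0 ∨ (chg i ∧ s.arr 5 (β + (s.arr 4 i - 1)) ≠ 0) := by
      simp only [hw, holds_and, holds_or, holds_get, eval_get, eval_var, eval_sub, eval_lit,
        eval_add, ht₁, setArr_reg, setArr_arr,
        setReg_reg, setReg_arr, a4, a5, if_true, Nat.reduceEqDiff, if_false, r5, hchg]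
    exact this
  have hci : (and (get 4 (var 25)) (lt digE (var 5))).holds t₂ ↔
      chg i ∧ s.arr 5 (s.arr 4 i - 1) < β := by
    simp only [ht₂, ht₁, holds_and, holds_get, holds_lt, digE, eval_get, eval_var, eval_sub,
      eval_lit, setArr_reg, setArr_arr, setReg_reg, setReg_arr, a4, a5, if_true, Nat.reduceEqDiff,
      if_false, r5, hchg]
  have q17 : q.arr 17 = Function.update (t.arr 17) i (v.eval (t.setReg 25 i)) := by
    rw [eq₂, (Cmd.frame _ _).2 17 (by decide)]
    simp [ht₂, ht₁]
  have q18 : q.arr 18 = Function.update (t.arr 18) i (w.eval t₁) := by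
    rw [eq₂, (Cmd.frame _ _).2 18 (by decide)]
    simp [ht₂, ht₁]
  have q6 : q.arr 6 = Function.update (t.arr 6) i
      (if chg i ∧ s.arr 5 (s.arr 4 i - 1) < β then s.arr 3 (s.arr 5 (s.arr 4 i - 1)) else i) := by
    rw [eq₂]
    by_cases h : chg i ∧ s.arr 5 (s.arr 4 i - 1) < β
    · rw [den_ite_pos _ (hci.2 h), if_pos h]
      simp [ht₂, ht₁, digE, a3, a4, a5]
    · rw [den_ite_neg _ (fun h' => h (hci.1 h')), if_neg h]
      simp [ht₂, ht₁]
  intro a ha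
  by_cases hai : a = i
  · subst hai
    refine ⟨?_, ?_, fun hp hc => ?_, fun hp hc => ?_⟩
    · rw [q17, Function.update_self, hvi]
      unfold plays
      push Not
      refine and_congr_right fun hc => ?_
      by_cases hcm : chg (M a)
      · exact iff_of_true (ne_of_lt (hd.inside a hi hc hcm).1) fun ho => ho.2.2.1 hcm
      · by_cases ho : isOut app chg M a
        · exact iff_of_false (not_not.2 (hd.out a hi hc hcm ho)) (not_not.2 ho)
        · refine iff_of_true ?_ ho
          rw [hd.alone a hi hc hcm ho]; omega
    · rw [q18, Function.update_self, hwi, hd.all]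
      exact or_congr_right (and_congr_right fun hc => hd.nbrs a hi hc)
    · have hca : chg a := not_not.1 fun h => hp (Or.inl h)
      obtain ⟨h1, h2⟩ := hd.inside a hi hca hc
      rw [q6, Function.update_self, if_pos ⟨hca, h1⟩, h2]
    · rw [q6, Function.update_self, if_neg]
      rintro ⟨hca, hlt⟩
      by_cases ho : isOut app chg M a
      · exact hp (Or.inr ho)
      · rw [hd.alone a hi hca hc ho] at hlt; omega
  · have := It a (by omega)
    refine ⟨?_, ?_, ?_, ?_⟩
    · rw [q17, Function.update_of_ne hai]; exact this.kind
    · rw [q18, Function.update_of_ne hai]; exact this.mark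
    · rw [q6, Function.update_of_ne hai]; exact this.inside
    · rw [q6, Function.update_of_ne hai]; exact this.alone

/-- Mark in array 16 the agents that have to be covered. -/
def needCmd : Cmd :=
  .loop 25 1 (ite (get 4 (var 25)) (put 16 (var 25) (not (get 17 (var 25))))
    (put 16 (var 25) (lit 0) ;;
      .loop 26 1 (ite (and (ne (var 26) (var 25)) (and (appE (lit 0) (var 25) (var 26))
        (get 18 (var 26)))) (put 16 (var 25) (lit 1)) skip)))

theorem needCmd_spec {n ℓ α β : ℕ} {app : ℕ → ℕ → ℕ → Prop} {chg : ℕ → Prop} {M : ℕ → ℕ} {s : Store}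
    (hℓ : 0 < ℓ) (hs : AppState n ℓ α app s) (hL : ListState n β chg s)
    (hd : ∀ a < n, Decoded n app chg M s a) :
    ∀ a < n, (needCmd.den s).arr 16 a ≠ 0 ↔ needs n app chg M a := by
  suffices h : ∀ a < s.reg 1, (needCmd.den s).arr 16 a ≠ 0 ↔ needs n app chg M a by
    rwa [hs.agents] at h
  refine Cmd.loop_inv (fun i t => ∀ a < i, t.arr 16 a ≠ 0 ↔ needs n app chg M a) (by simp) ?_
  intro i hi t hF It
  rw [hs.agents] at hi
  have ht : AppState n ℓ α app (t.setReg 25 i) :=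
    (hs.of_frame hF (by decide) (by decide) (by decide) (by decide) (by decide)).of_eq
      (by simp) (by simp) (by simp) rfl rfl
  have a4 := hF.2 4 (by decide)
  have a17 := hF.2 17 (by decide)
  have a18 := hF.2 18 (by decide)
  have hchg := hL.mem_iff i hi
  by_cases hc : chg i
  · rw [den_ite_pos _ (by simpa [a4] using hchg.2 hc)]
    intro a ha
    by_cases hai : a = i
    · subst hai
      have e : (not (get 17 (var 25))).holds (t.setReg 25 a) ↔ plays app chg M a := by
        rw [holds_not]
        simp only [holds_get, eval_var, setReg_reg, setReg_arr, if_true, a17, (hd a hi).kind,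
          not_not]
      simp only [den_put, setArr_arr, if_true, eval_var, setReg_reg, setReg_arr,
        Function.update_self]
      refine e.trans ?_
      simp [plays, needs, hc]
    · simp only [den_put, setArr_arr, if_true, eval_var, setReg_reg, setReg_arr,
        Function.update_of_ne hai]
      exact It a (by omega)
  · rw [den_ite_neg _ (by simpa [a4] using mt hchg.1 hc)]
    set t₁ := (t.setReg 25 i).setArr 16 i 0 with ht₁
    have ht₁' : AppState n ℓ α app t₁ := ht.of_eq rfl rfl rfl (by simp [ht₁]) (by simp [ht₁])
    have key := Cmd.loop_inv (x := 26) (y := 1) (p := ite (and (ne (var 26) (var 25))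
        (and (appE (lit 0) (var 25) (var 26)) (get 18 (var 26)))) (put 16 (var 25) (lit 1)) skip)
      (s₀ := t₁) (fun j u => (u.arr 16 i ≠ 0 ↔ ∃ b < j, b ≠ i ∧ app 0 i b ∧ s.arr 18 b ≠ 0) ∧
        ∀ a, a ≠ i → u.arr 16 a = t.arr 16 a)
      ⟨by simp [ht₁], fun a ha => by simp [ht₁, ha]⟩ (by
        rintro j hj u hG ⟨Iu, Iu'⟩
        rw [ht₁'.agents] at hj
        have hu : AppState n ℓ α app (u.setReg 26 j) :=
          (ht₁'.of_frame hG (by decide) (by decide) (by decide) (by decide) (by decide)).of_eq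
            (by simp) (by simp) (by simp) rfl rfl
        have h25 : u.reg 25 = i := by rw [hG.1 25 (by decide)]; simp [ht₁]
        have h18 : u.arr 18 = s.arr 18 := by rw [hG.2 18 (by decide), ← a18]; simp [ht₁]
        have hA := hu.holds_appE (i := lit 0) (a := var 25) (b := var 26) hℓ
          (by simpa [h25] using hi) (by simpa using hj)
        have hiff : (and (ne (var 26) (var 25)) (and (appE (lit 0) (var 25) (var 26))
            (get 18 (var 26)))).holds (u.setReg 26 j) ↔ j ≠ i ∧ app 0 i j ∧ s.arr 18 j ≠ 0 := by
          rw [holds_and, holds_and, hA]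
          simp [h25, h18]
        by_cases h : j ≠ i ∧ app 0 i j ∧ s.arr 18 j ≠ 0
        · rw [den_ite_pos _ (hiff.2 h)]
          constructor
          · simp only [den_put, setArr_arr, if_true, eval_var, setReg_reg, setReg_arr, h25,
              Nat.reduceEqDiff, if_false, Function.update_self, eval_lit]
            exact iff_of_true (by simp) ⟨j, by omega, h⟩
          · intro a ha
            simp [h25, ha, Iu' a ha]
        · rw [den_ite_neg _ (fun h' => h (hiff.1 h')), den_skip]
          refine ⟨?_, Iu'⟩
          rw [setReg_arr, Iu]
          constructor
          · rintro ⟨b, hb, h'⟩; exact ⟨b, by omega, h'⟩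
          · rintro ⟨b, hb, h'⟩
            refine ⟨b, ?_, h'⟩
            by_contra hb'
            have : b = j := by omega
            exact h (this ▸ h'))
    rw [ht₁'.agents] at key
    have e : (put 16 (var 25) (lit 0) ;;
      .loop 26 1 (ite (and (ne (var 26) (var 25)) (and (appE (lit 0) (var 25) (var 26))
        (get 18 (var 26)))) (put 16 (var 25) (lit 1)) skip)).den (t.setReg 25 i)
        = (Cmd.loop 26 1 (ite (and (ne (var 26) (var 25)) (and (appE (lit 0) (var 25) (var 26))
        (get 18 (var 26)))) (put 16 (var 25) (lit 1)) skip)).den t₁ := by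
      simp [ht₁]
    rw [e]
    intro a ha
    by_cases hai : a = i
    · rw [hai, key.1]
      simp only [needs, hc, false_and, false_or, not_false_eq_true, true_and, isNeeded]
      constructor
      · rintro ⟨b, hb, h1, h2, h3⟩; exact ⟨b, hb, h1, h2, (hd b hb).mark.1 h3⟩
      · rintro ⟨b, hb, h1, h2, h3⟩; exact ⟨b, hb, h1, h2, (hd b hb).mark.2 h3⟩
    · rw [key.2 a hai]; exact It a (by omega)

theorem table_loop {x y k r N : ℕ} {e : Expr} {P : ℕ → ℕ → Prop} {s : Store} (hN : s.reg 4 = N)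
    (hr : ∀ u < N, s.arr r u = u * N) (hx4 : x ≠ 4) (hy4 : y ≠ 4) (hxy : x ≠ y) (hkr : k ≠ r)
    (he : ∀ t : Store, Frame (.loop x 4 (.loop y 4 (put k (add (get r (var x)) (var y)) e))) s t →
      t.reg x < N → t.reg y < N → (e.holds t ↔ P (t.reg x) (t.reg y))) :
    ∀ u < N, ∀ v < N,
      (((Cmd.loop x 4 (.loop y 4 (put k (add (get r (var x)) (var y)) e))).den s).arr k (u * N + v) ≠ 0
        ↔ P u v) := by
  set p := put k (add (get r (var x)) (var y)) e with hp
  have key := Cmd.loop_inv (x := x) (y := 4) (p := .loop y 4 p) (s₀ := s)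
    (fun i t => ∀ u < i, ∀ v < N, (t.arr k (u * N + v) ≠ 0 ↔ P u v)) (by simp) (by
      intro i hi t hF It
      rw [hN] at hi
      have r4 : (t.setReg x i).reg 4 = N := by
        rw [setReg_reg, if_neg (Ne.symm hx4),
          hF.1 4 (by simp [hp, Cmd.regs, Ne.symm hx4, Ne.symm hy4]), hN]
      have key := Cmd.loop_inv (x := y) (y := 4) (p := p) (s₀ := t.setReg x i)
        (fun j q => ∀ u < N, ∀ v < N, (u < i ∨ (u = i ∧ v < j)) →
          (q.arr k (u * N + v) ≠ 0 ↔ P u v)) (fun u hu v hv h => It u (by omega) v hv) (by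
          intro j hj q hG Iq
          rw [r4] at hj
          have hxq : (q.setReg y j).reg x = i := by
            rw [setReg_reg, if_neg hxy, hG.1 x (by simp [hp, Cmd.regs, hxy]), setReg_reg, if_pos rfl]
          have hyq : (q.setReg y j).reg y = j := by simp
          have hFq : Frame (.loop x 4 (.loop y 4 p)) s (q.setReg y j) := by
            refine ⟨fun z hz => ?_, fun z hz => ?_⟩
            · have hz' : z ≠ x ∧ z ≠ y := by simpa [hp, Cmd.regs] using hz
              rw [setReg_reg, if_neg hz'.2, hG.1 z (by simpa [hp, Cmd.regs] using hz'.2),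
                setReg_reg, if_neg hz'.1, hF.1 z hz]
            · rw [setReg_arr, hG.2 z hz, setReg_arr, hF.2 z hz]
          have hiff := he _ hFq (by rwa [hxq]) (by rwa [hyq])
          rw [hxq, hyq] at hiff
          have hrow : (q.setReg y j).arr r i = i * N := by
            rw [hFq.2 r (by simpa [hp, Cmd.arrs] using Ne.symm hkr), hr i hi]
          have e1 : (p.den (q.setReg y j)).arr k
              = Function.update (q.arr k) (i * N + j) (e.eval (q.setReg y j)) := by
            rw [hp, den_put, setArr_arr, if_pos rfl]
            simp only [eval_add, eval_get, eval_var, hxq, hyq, hrow, setReg_arr]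
          intro u hu v hv h
          rw [e1]
          by_cases huv : u = i ∧ v = j
          · obtain ⟨rfl, rfl⟩ := huv
            rw [Function.update_self]
            exact hiff
          · rw [Function.update_of_ne]
            · exact Iq u hu v hv (by omega)
            · exact fun h' => huv (index_inj hv hj h'))
      rw [r4] at key
      exact fun u hu v hv => key u (by omega) v hv (by omega))
  rw [hN] at key
  exact key

/-- The pair `{a, b}` may be matched. -/
def hedgeE (a b : Expr) : Expr :=
  and (ne a b) (and (not (get 17 a)) (and (not (get 17 b)) (and (appE (lit 0) a b)
    (not (and (get 4 a) (get 4 b))))))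

/-- Adjacency in the doubled graph. -/
def doubledE : Expr :=
  or (and (lt (var 25) (var 1)) (and (lt (var 26) (var 1)) (hedgeE (var 25) (var 26))))
    (or (and (not (lt (var 25) (var 1))) (and (not (lt (var 26) (var 1)))
        (hedgeE (sub (var 25) (var 1)) (sub (var 26) (var 1)))))
      (or (and (lt (var 25) (var 1)) (and (eq (var 26) (add (var 25) (var 1)))
          (not (get 16 (var 25)))))
        (and (lt (var 26) (var 1)) (and (eq (var 25) (add (var 26) (var 1)))
          (not (get 16 (var 26)))))))

/-- Write the doubled graph to array 7. -/
def graphCmd : Cmd :=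
  .loop 25 4 (.loop 26 4 (put 7 (add (get 2 (var 25)) (var 26)) doubledE))

theorem graphCmd_spec {n ℓ α β : ℕ} {app : ℕ → ℕ → ℕ → Prop} {chg : ℕ → Prop} {M : ℕ → ℕ}
    {s : Store} (hℓ : 0 < ℓ) (hs : AppState n ℓ α app s) (hL : ListState n β chg s)
    (h4 : s.reg 4 = n + n) (h2 : ∀ u < n + n, s.arr 2 u = u * (n + n))
    (h17 : ∀ a < n, s.arr 17 a ≠ 0 ↔ ¬ plays app chg M a)
    (h16 : ∀ a < n, s.arr 16 a ≠ 0 ↔ needs n app chg M a) (u v : ℕ) :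
    edgeRel (n + n) ((graphCmd.den s).arr 7) u v ↔ doubled n app chg M u v := by
  have key := table_loop (x := 25) (y := 26) (k := 7) (r := 2) (e := doubledE)
    (P := doubled n app chg M) h4 h2 (by decide) (by decide) (by decide) (by decide) (by
      intro t hF hx hy
      have ht : AppState n ℓ α app t :=
        hs.of_frame hF (by decide) (by decide) (by decide) (by decide) (by decide)
      have a16 := hF.2 16 (by decide)
      have a17 := hF.2 17 (by decide)
      have a4 := hF.2 4 (by decide)
      have hh : ∀ a b : Expr, a.eval t < n → b.eval t < n →
          ((hedgeE a b).holds t ↔ hedge app chg M (a.eval t) (b.eval t)) := by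
        intro a b ha hb
        have hA := ht.holds_appE (i := lit 0) (a := a) (b := b) hℓ ha hb
        simp only [hedgeE, holds_and, holds_ne, holds_not, hA, holds_get, a17, a4, h17 _ ha,
          h17 _ hb, hL.mem_iff _ ha, hL.mem_iff _ hb, not_not, hedge, eval_lit]
      simp only [doubledE, doubled, holds_or, holds_and, holds_lt, holds_not, holds_eq, eval_var,
        eval_add, ht.agents, holds_get, a16]
      refine or_congr (and_congr_right fun g1 => and_congr_right fun g2 => ?_)
        (or_congr ?_ (or_congr (and_congr_right fun g1 => and_congr_right fun _ => ?_)
          (and_congr_right fun g1 => and_congr_right fun _ => ?_)))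
      · exact hh _ _ g1 g2
      · have h := hh (sub (var 25) (var 1)) (sub (var 26) (var 1))
        simp only [eval_sub, eval_var, ht.agents] at h
        constructor
        · rintro ⟨g1, g2, g3⟩
          exact ⟨⟨by omega, hx⟩, ⟨by omega, hy⟩, (h (by omega) (by omega)).1 g3⟩
        · rintro ⟨g1, g2, g3⟩
          exact ⟨by omega, by omega, (h (by omega) (by omega)).2 g3⟩
      · exact not_congr (h16 _ g1)
      · exact not_congr (h16 _ g1))
  constructor
  · rintro ⟨hu, hv, h⟩
    exact (key u hu v hv).1 h
  · intro h
    have : u < n + n ∧ v < n + n := by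
      rcases h with h | h | h | h
      · omega
      · omega
      · omega
      · omega
    exact ⟨this.1, this.2, (key u this.1 v this.2).2 h⟩

/-- Read off the matching from the perfect matching of the doubled graph. -/
def seedCmd : Cmd :=
  .loop 25 1 (ite (get 17 (var 25)) skip
    (ite (lt (get 9 (var 25)) (var 1)) (put 6 (var 25) (get 9 (var 25)))
      (put 6 (var 25) (var 25))))

theorem seedCmd_spec {n : ℕ} {app : ℕ → ℕ → ℕ → Prop} {chg : ℕ → Prop} {M : ℕ → ℕ} {s : Store}
    (hn : s.reg 1 = n) (h17 : ∀ a < n, s.arr 17 a ≠ 0 ↔ ¬ plays app chg M a)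
    (h6 : ∀ a < n, ¬ plays app chg M a →
      (chg (M a) → s.arr 6 a = M a) ∧ (¬ chg (M a) → s.arr 6 a = a)) :
    Seeded n app chg M (s.arr 9) ((seedCmd.den s).arr 6) := by
  have key := Cmd.loop_inv (x := 25) (y := 1) (s₀ := s) (p := ite (get 17 (var 25)) skip
    (ite (lt (get 9 (var 25)) (var 1)) (put 6 (var 25) (get 9 (var 25)))
      (put 6 (var 25) (var 25))))
    (fun i t => (∀ a < i, plays app chg M a → (s.arr 9 a < n → t.arr 6 a = s.arr 9 a) ∧
      (¬ s.arr 9 a < n → t.arr 6 a = a)) ∧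
      ∀ a < n, ¬ plays app chg M a → t.arr 6 a = s.arr 6 a) ⟨by simp, fun _ _ _ => rfl⟩ (by
      rintro i hi t hF ⟨I1, I2⟩
      rw [hn] at hi
      have a9 := hF.2 9 (by decide)
      have a17 := hF.2 17 (by decide)
      have r1 := (hF.1 1 (by decide)).trans hn
      have hi17 := h17 i hi
      by_cases hp : plays app chg M i
      · rw [den_ite_neg _ (by simpa [a17] using mt hi17.1 (not_not.2 hp))]
        by_cases hlt : s.arr 9 i < n
        · rw [den_ite_pos _ (by simpa [a9, r1] using hlt)]
          refine ⟨fun a ha hpa => ?_, fun a ha hpa => ?_⟩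
          · by_cases hai : a = i
            · subst hai; simp [a9, hlt]
            · simpa [hai] using I1 a (by omega) hpa
          · have hai : a ≠ i := fun h => hpa (h ▸ hp)
            simpa [hai] using I2 a ha hpa
        · rw [den_ite_neg _ (by simpa [a9, r1] using hlt)]
          refine ⟨fun a ha hpa => ?_, fun a ha hpa => ?_⟩
          · by_cases hai : a = i
            · subst hai; simp [hlt]
            · simpa [hai] using I1 a (by omega) hpa
          · have hai : a ≠ i := fun h => hpa (h ▸ hp)
            simpa [hai] using I2 a ha hpa
      · rw [den_ite_pos _ (by simpa [a17] using hi17.2 hp), den_skip]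
        refine ⟨fun a ha hpa => ?_, I2⟩
        have hai : a ≠ i := fun h => hp (h ▸ hpa)
        exact I1 a (by omega) hpa)
  rw [hn] at key
  intro a ha
  refine ⟨fun hp => (key.1 a ha hp).1, fun hp => (key.1 a ha hp).2, fun hp hc => ?_,
    fun hp hc => ?_⟩
  · exact (key.2 a ha hp).trans ((h6 a ha hp).1 hc)
  · exact (key.2 a ha hp).trans ((h6 a ha hp).2 hc)

/-- Compute the matching for the digits in array 5. -/
def buildCmd : Cmd :=
  decodeCmd ;; needCmd ;; graphCmd ;; matchCmd ;; seedCmd ;;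
    greedyCmd (and (not (get 4 (var 25))) (and (not (get 4 (var 26)))
      (appE (lit 0) (var 25) (var 26)))) ;;
    greedyCmd (lit 1)

/-- Something is claimed only for digits that describe an actual matching `M`. For all other guesses
the stability check decides. -/
theorem buildCmd_spec {n ℓ α β : ℕ} {app : ℕ → ℕ → ℕ → Prop} {chg : ℕ → Prop} {M : ℕ → ℕ}
    {s : Store} (S : Sys n ℓ app chg) (hM : Invol n M) (hs : AppState n ℓ α app s)
    (hL : ListState n β chg s) (h4 : s.reg 4 = n + n)
    (h2 : ∀ u < n + n, s.arr 2 u = u * (n + n))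
    (hd : Describes n β app chg M (s.arr 3) (s.arr 4) (s.arr 5)) :
    ∃ m₂, Rebuilt n app chg M m₂ ((buildCmd.den s).arr 6) := by
  have hdec := decodeCmd_spec hs.agents hL hd
  set s₁ := decodeCmd.den s with hs₁
  have f₁ : Frame decodeCmd s s₁ := Cmd.frame _ _
  have A₁ : AppState n ℓ α app s₁ := hs.of_frame f₁ (by decide) (by decide) (by decide)
    (by decide) (by decide)
  have L₁ : ListState n β chg s₁ :=
    hL.of_eq (f₁.1 5 (by decide)) (f₁.2 3 (by decide)) (f₁.2 4 (by decide))
  have hneed := needCmd_spec S.pos A₁ L₁ hdec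
  set s₂ := needCmd.den s₁ with hs₂
  have f₂ : Frame needCmd s₁ s₂ := Cmd.frame _ _
  have A₂ : AppState n ℓ α app s₂ := A₁.of_frame f₂ (by decide) (by decide) (by decide)
    (by decide) (by decide)
  have L₂ : ListState n β chg s₂ :=
    L₁.of_eq (f₂.1 5 (by decide)) (f₂.2 3 (by decide)) (f₂.2 4 (by decide))
  have h17 : ∀ a < n, s₂.arr 17 a ≠ 0 ↔ ¬ plays app chg M a := by
    rw [f₂.2 17 (by decide)]; exact fun a ha => (hdec a ha).kind
  have h24 : s₂.reg 4 = n + n := by rw [f₂.1 4 (by decide), f₁.1 4 (by decide), h4]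
  have h22 : ∀ u < n + n, s₂.arr 2 u = u * (n + n) := by
    rw [f₂.2 2 (by decide), f₁.2 2 (by decide)]; exact h2
  have hgr := graphCmd_spec S.pos A₂ L₂ h24 h22 h17 hneed
  set s₃ := graphCmd.den s₂ with hs₃
  have f₃ : Frame graphCmd s₂ s₃ := Cmd.frame _ _
  have hrel : edgeRel (n + n) (s₃.arr 7) = doubled n app chg M := by
    funext u v; exact propext (hgr u v)
  have hmat := matchCmd_spec (s := s₃) (A := s₃.arr 7) (N := n + n)
    ⟨by rw [f₃.1 4 (by decide), h24], by rw [f₃.2 2 (by decide)]; exact h22, rfl⟩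
    (by rw [hrel]; exact fun u v h => S.doubled_symm h)
    (by rw [hrel]; exact fun u => Sys.doubled_irrefl u)
    (by rw [hrel]; exact S.exists_perfect hM)
  rw [hrel] at hmat
  set s₄ := matchCmd.den s₃ with hs₄
  have f₄ : Frame matchCmd s₃ s₄ := Cmd.frame _ _
  have A₄ : AppState n ℓ α app s₄ :=
    (A₂.of_frame f₃ (by decide) (by decide) (by decide) (by decide) (by decide)).of_frame f₄
      (by decide) (by decide) (by decide) (by decide) (by decide)
  have L₄ : ListState n β chg s₄ :=
    (L₂.of_eq (f₃.1 5 (by decide)) (f₃.2 3 (by decide)) (f₃.2 4 (by decide))).of_eq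
      (f₄.1 5 (by decide)) (f₄.2 3 (by decide)) (f₄.2 4 (by decide))
  have h417 : ∀ a < n, s₄.arr 17 a ≠ 0 ↔ ¬ plays app chg M a := by
    rw [f₄.2 17 (by decide), f₃.2 17 (by decide)]; exact h17
  have h46 : s₄.arr 6 = s₁.arr 6 := by
    rw [f₄.2 6 (by decide), f₃.2 6 (by decide), f₂.2 6 (by decide)]
  have hseed := seedCmd_spec (M := M) (app := app) (chg := chg) A₄.agents h417 (by
    rw [h46]; exact fun a ha hp => ⟨(hdec a ha).inside hp, (hdec a ha).alone hp⟩)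
  set s₅ := seedCmd.den s₄ with hs₅
  have f₅ : Frame seedCmd s₄ s₅ := Cmd.frame _ _
  have A₅ : AppState n ℓ α app s₅ := A₄.of_frame f₅ (by decide) (by decide) (by decide)
    (by decide) (by decide)
  have L₅ : ListState n β chg s₅ :=
    L₄.of_eq (f₅.1 5 (by decide)) (f₅.2 3 (by decide)) (f₅.2 4 (by decide))
  obtain ⟨g1, g2⟩ := greedyCmd_spec (e := and (not (get 4 (var 25))) (and (not (get 4 (var 26)))
      (appE (lit 0) (var 25) (var 26)))) (R := fun a b => ¬ chg a ∧ ¬ chg b ∧ app 0 a b)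
    A₅.agents (Sys.seeded_invol hM hmat.1 hmat.2 hseed) (by
      intro t hF ha hb
      have ht : AppState n ℓ α app t := A₅.of_frame hF (by decide) (by decide) (by decide)
        (by decide) (by decide)
      have hA := ht.holds_appE (i := lit 0) (a := var 25) (b := var 26) S.pos ha hb
      have a4 := hF.2 4 (by decide)
      simp only [holds_and, holds_not, hA, holds_get, eval_var, eval_lit, a4, L₅.mem_iff _ ha,
        L₅.mem_iff _ hb])
  set s₆ := (greedyCmd (and (not (get 4 (var 25))) (and (not (get 4 (var 26)))
      (appE (lit 0) (var 25) (var 26))))).den s₅ with hs₆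
  have f₆ : s₆.reg 1 = s₅.reg 1 := (Cmd.frame (greedyCmd _) s₅).1 1 (by decide)
  obtain ⟨k1, k2⟩ := greedyCmd_spec (e := lit 1) (R := fun _ _ => True) (s := s₆)
    (f₆.trans A₅.agents) g1.invol (fun t _ _ _ => by simp [holds])
  exact ⟨s₆.arr 6, S.rebuilt hmat.1 hmat.2 hseed g1 g2 k1 k2⟩

/-! ### Enumeration of the guesses -/

/-- Add one to the number with the digits in array 5. -/
def incrCmd : Cmd :=
  assign 30 (lit 1) ;;
  .loop 24 7 (ite (var 30)
    (ite (lt (add (get 5 (var 24)) (lit 1)) (var 6))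
      (put 5 (var 24) (add (get 5 (var 24)) (lit 1)) ;; assign 30 (lit 0))
      (put 5 (var 24) (lit 0)))
    skip)

/-- Digit `j` of `g` in base `B`. -/
def digit (B g j : ℕ) : ℕ := g / B ^ j % B

/-- Divisibility of `g + 1` by `B ^ j` says that adding one to `g` carries into digit `j`. -/
theorem digit_succ_of_not_dvd {B g j : ℕ} (h : ¬ B ^ j ∣ g + 1) : digit B (g + 1) j = digit B g j := by
  rw [digit, digit, Nat.succ_div_of_not_dvd h]

theorem digit_succ_of_lt {B g j : ℕ} (h : B ^ j ∣ g + 1) (hlt : digit B g j + 1 < B) :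
    digit B (g + 1) j = digit B g j + 1 ∧ ¬ B ^ (j + 1) ∣ g + 1 := by
  have e : digit B (g + 1) j = digit B g j + 1 := by
    rw [digit, Nat.succ_div_of_dvd h, Nat.add_mod, ← digit, Nat.mod_eq_of_lt (a := 1) (by omega),
      Nat.mod_eq_of_lt hlt]
  refine ⟨e, fun hd => ?_⟩
  obtain ⟨c, hc⟩ := hd
  have : digit B (g + 1) j = 0 := by
    rw [digit, hc, pow_succ, mul_assoc, Nat.mul_div_cancel_left _ (pow_pos (by omega) _),
      Nat.mul_mod_right]
  omega

theorem digit_succ_of_not_lt {B g j : ℕ} (hB : 0 < B) (h : B ^ j ∣ g + 1)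
    (hlt : ¬ digit B g j + 1 < B) : digit B (g + 1) j = 0 ∧ B ^ (j + 1) ∣ g + 1 := by
  have hd : digit B g j < B := Nat.mod_lt _ hB
  have e : B ∣ g / B ^ j + 1 := by
    refine ⟨g / B ^ j / B + 1, ?_⟩
    have h1 := Nat.div_add_mod (g / B ^ j) B
    have h2 : g / B ^ j % B = digit B g j := rfl
    rw [Nat.mul_add, Nat.mul_one]
    omega
  rw [← Nat.succ_div_of_dvd h] at e
  refine ⟨by rw [digit]; exact Nat.mod_eq_zero_of_dvd e, ?_⟩
  obtain ⟨c, hc⟩ := h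
  rw [hc, Nat.mul_div_cancel_left _ (pow_pos hB _)] at e
  rw [hc, pow_succ]
  exact Nat.mul_dvd_mul_left _ e

theorem exists_digits {B : ℕ} (D : ℕ) : ∀ d : ℕ → ℕ, (∀ j, d j < B) →
    ∃ g < B ^ D, ∀ j < D, digit B g j = d j := by
  induction D with
  | zero => exact fun d _ => ⟨0, by simp, by simp⟩
  | succ D ih =>
    intro d hd
    have hB : 0 < B := (Nat.zero_le _).trans_lt (hd 0)
    obtain ⟨g, hg, h⟩ := ih (fun j => d (j + 1)) fun j => hd _
    have e : (B * g + d 0) / B = g := by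
      rw [Nat.mul_add_div hB, Nat.div_eq_of_lt (hd 0), Nat.add_zero]
    refine ⟨B * g + d 0, ?_, fun j hj => ?_⟩
    · have := hd 0
      have := Nat.mul_le_mul_left B (Nat.succ_le_of_lt hg)
      rw [pow_succ, Nat.mul_comm (B ^ D)]
      simp only [Nat.succ_eq_add_one, Nat.mul_add, Nat.mul_one] at this
      omega
    · cases j with
      | zero => simp [digit, Nat.mod_eq_of_lt (hd 0)]
      | succ j =>
        rw [digit, pow_succ', ← Nat.div_div_eq_div_mul, e]
        exact h j (by omega)

/-- Register 30 is the carry: when digit `i` is reached, it is set exactly if `B ^ i` divides `g +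
1`. -/
theorem incrCmd_spec {B D g : ℕ} {s : Store} (hB : 1 < B) (h6 : s.reg 6 = B) (h7 : s.reg 7 = D)
    (h5 : ∀ j < D, s.arr 5 j = digit B g j) :
    ∀ j < D, (incrCmd.den s).arr 5 j = digit B (g + 1) j := by
  set s₁ := s.setReg 30 1 with hs₁
  have r7 : s₁.reg 7 = D := by simp [hs₁, h7]
  have key := Cmd.loop_inv (x := 24) (y := 7) (s₀ := s₁) (p := ite (var 30)
    (ite (lt (add (get 5 (var 24)) (lit 1)) (var 6))
      (put 5 (var 24) (add (get 5 (var 24)) (lit 1)) ;; assign 30 (lit 0))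
      (put 5 (var 24) (lit 0)))
    skip) (fun i t => (∀ j < i, t.arr 5 j = digit B (g + 1) j) ∧
      (∀ j < D, i ≤ j → t.arr 5 j = digit B g j) ∧ (t.reg 30 ≠ 0 ↔ B ^ i ∣ g + 1))
    ⟨by simp, fun j hj _ => by simpa [hs₁] using h5 j hj, by simp [hs₁]⟩ (by
      rintro i hi t hF ⟨I1, I2, I3⟩
      rw [r7] at hi
      have r6 : t.reg 6 = B := by rw [hF.1 6 (by decide)]; simp [hs₁, h6]
      have hdi := I2 i hi le_rfl
      by_cases hc : B ^ i ∣ g + 1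
      · rw [den_ite_pos _ (by simpa using I3.2 hc)]
        by_cases hlt : digit B g i + 1 < B
        · obtain ⟨e1, e2⟩ := digit_succ_of_lt hc hlt
          rw [den_ite_pos _ (by simpa [hdi, r6] using hlt)]
          refine ⟨fun j hj => ?_, fun j hj hij => ?_, ?_⟩
          · by_cases hji : j = i
            · subst hji; simp [hdi, e1]
            · simpa [hji] using I1 j (by omega)
          · have hji : j ≠ i := by omega
            simpa [hji] using I2 j hj (by omega)
          · simpa using e2
        · obtain ⟨e1, e2⟩ := digit_succ_of_not_lt (by omega) hc hlt
          rw [den_ite_neg _ (by simpa [hdi, r6] using hlt)]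
          refine ⟨fun j hj => ?_, fun j hj hij => ?_, ?_⟩
          · by_cases hji : j = i
            · subst hji; simp [e1]
            · simpa [hji] using I1 j (by omega)
          · have hji : j ≠ i := by omega
            simpa [hji] using I2 j hj (by omega)
          · refine iff_of_true ?_ e2
            simpa using I3.2 hc
      · rw [den_ite_neg _ (by simpa using mt I3.1 hc), den_skip]
        refine ⟨fun j hj => ?_, fun j hj hij => I2 j hj (by omega), ?_⟩
        · by_cases hji : j = i
          · subst hji
            rw [setReg_arr, hdi, digit_succ_of_not_dvd hc]
          · exact I1 j (by omega)
        · refine iff_of_false ?_ fun h => hc ((pow_dvd_pow B (by omega)).trans h)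
          simpa using mt I3.1 hc)
  rw [r7] at key
  exact key.1

/-! ### Preparation -/

/-- Write tables of row offsets to the arrays 1 and 2. -/
def tableCmd : Cmd :=
  assign 27 (lit 0) ;; assign 28 (lit 0) ;;
  .loop 24 2 (.loop 25 1 (put 1 (var 27) (var 28) ;; assign 27 (add (var 27) (lit 1)) ;;
    assign 28 (add (var 28) (var 1)))) ;;
  assign 27 (lit 0) ;;
  .loop 25 4 (put 2 (var 25) (var 27) ;; assign 27 (add (var 27) (var 4)))

/-- The machine cannot multiply, so offsets are tabulated by repeated addition. Array 1 extends to
`ℓ * n` because it is also looked up at `i * n + a`. -/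
theorem tableCmd_spec {n ℓ N : ℕ} {s : Store} (h1 : s.reg 1 = n) (h2 : s.reg 2 = ℓ)
    (h4 : s.reg 4 = N) : (∀ j < ℓ * n, (tableCmd.den s).arr 1 j = j * n) ∧
      ∀ u < N, (tableCmd.den s).arr 2 u = u * N := by
  set s₁ := (s.setReg 27 0).setReg 28 0 with hs₁
  set p := put 1 (var 27) (var 28) ;; assign 27 (add (var 27) (lit 1)) ;;
    assign 28 (add (var 28) (var 1)) with hp
  set s₂ := (Cmd.loop 24 2 (.loop 25 1 p)).den s₁ with hs₂
  have f₂ : Frame (Cmd.loop 24 2 (.loop 25 1 p)) s₁ s₂ := Cmd.frame _ _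
  set Inv : ℕ → Store → Prop := fun k t => t.reg 27 = k ∧ t.reg 28 = k * n ∧
    ∀ j < k, t.arr 1 j = j * n with hInv
  have key := Cmd.loop_inv (x := 24) (y := 2) (s₀ := s₁) (p := .loop 25 1 p)
    (fun i t => Inv (i * n) t) (by simp [hInv, hs₁]) (by
      rintro i hi t hF It
      have r1 : (t.setReg 24 i).reg 1 = n := by
        rw [setReg_reg, if_neg (by decide), hF.1 1 (by decide)]; simp [hs₁, h1]
      have key := Cmd.loop_inv (x := 25) (y := 1) (s₀ := t.setReg 24 i) (p := p)
        (fun a u => Inv (i * n + a) u) (by simpa [hInv] using It) (by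
          rintro a ha u hG ⟨g1, g2, g3⟩
          have u1 : u.reg 1 = n := by rw [hG.1 1 (by decide), r1]
          refine ⟨by simp [hp, g1]; ring, by simp [hp, g2, u1]; ring, fun j hj => ?_⟩
          by_cases hji : j = i * n + a
          · subst hji; simp [hp, g1, g2]
          · simpa [hp, g1, hji] using g3 j (by omega))
      rw [r1] at key
      have e : (i + 1) * n = i * n + n := by ring
      rw [e]
      exact key)
  have r2 : s₁.reg 2 = ℓ := by simp [hs₁, h2]
  rw [r2, ← hs₂] at key
  have r4 : (s₂.setReg 27 0).reg 4 = N := by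
    rw [setReg_reg, if_neg (by decide), f₂.1 4 (by decide)]; simp [hs₁, h4]
  have key' := Cmd.loop_inv (x := 25) (y := 4) (s₀ := s₂.setReg 27 0)
    (p := put 2 (var 25) (var 27) ;; assign 27 (add (var 27) (var 4)))
    (fun k t => t.reg 27 = k * N ∧ ∀ j < k, t.arr 2 j = j * N) (by simp) (by
      rintro a ha u hG ⟨g1, g2⟩
      have u4 : u.reg 4 = N := by rw [hG.1 4 (by decide), r4]
      refine ⟨by simp [g1, u4]; ring, fun j hj => ?_⟩
      by_cases hja : j = a
      · subst hja; simp [g1]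
      · simpa [hja] using g2 j (by omega))
  rw [r4] at key'
  have e : tableCmd.den s = (Cmd.loop 25 4 (put 2 (var 25) (var 27) ;;
      assign 27 (add (var 27) (var 4)))).den (s₂.setReg 27 0) := by
    simp [tableCmd, hs₂, hs₁, hp]
  rw [e]
  refine ⟨fun j hj => ?_, key'.2⟩
  rw [(Cmd.frame _ _).2 1 (by decide), setReg_arr]
  exact key.2.2 j hj

/-- The approvals of agent `a` are not the same in all layers. -/
def changes (n ℓ : ℕ) (app : ℕ → ℕ → ℕ → Prop) (a : ℕ) : Prop :=
  ¬ ∀ i < ℓ, ∀ b < n, (app i a b ↔ app 0 a b)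

/-- The approvals of the agents in registers 25 and 26 are the same in layer 0 and in the layer in
register 24. -/
def sameE : Expr :=
  or (and (appE (var 24) (var 25) (var 26)) (appE (lit 0) (var 25) (var 26)))
    (and (not (appE (var 24) (var 25) (var 26))) (not (appE (lit 0) (var 25) (var 26))))

/-- List the agents whose approvals are not the same in all layers. -/
def listCmd : Cmd :=
  assign 5 (lit 0) ;;
  .loop 25 1 (assign 31 (lit 1) ;;
    .loop 24 2 (.loop 26 1 (ite sameE skip (assign 31 (lit 0)))) ;;
    ite (var 31) (put 4 (var 25) (lit 0))
      (put 3 (var 5) (var 25) ;; assign 5 (add (var 5) (lit 1)) ;; put 4 (var 25) (var 5)))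

theorem changesFlag_spec {n ℓ α a : ℕ} {app : ℕ → ℕ → ℕ → Prop} {s : Store} (hℓ : 0 < ℓ)
    (hs : AppState n ℓ α app s) (ha : a < n) (h25 : s.reg 25 = a) (h31 : s.reg 31 ≠ 0) :
    ((Cmd.loop 24 2 (.loop 26 1 (ite sameE skip (assign 31 (lit 0))))).den s).reg 31 ≠ 0 ↔
      ¬ changes n ℓ app a := by
  have key := forall_loop (x := 24) (y := 2) (f := 31) (s := s)
    (p := .loop 26 1 (ite sameE skip (assign 31 (lit 0))))
    (P := fun i => ∀ b < n, (app i a b ↔ app 0 a b)) (fun i hi t hF => by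
      rw [hs.layers] at hi
      have ht : AppState n ℓ α app (t.setReg 24 i) :=
        (hs.of_frame hF (by decide) (by decide) (by decide) (by decide) (by decide)).of_eq
          (by simp) (by simp) (by simp) rfl rfl
      have key := forall_loop (x := 26) (y := 1) (f := 31) (s := t.setReg 24 i)
        (p := ite sameE skip (assign 31 (lit 0)))
        (P := fun b => (app i a b ↔ app 0 a b)) (fun b hb u hG => by
          rw [ht.agents] at hb
          have hu : AppState n ℓ α app (u.setReg 26 b) :=
            (ht.of_frame hG (by decide) (by decide) (by decide) (by decide) (by decide)).of_eq
              (by simp) (by simp) (by simp) rfl rfl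
          have r24 : u.reg 24 = i := by rw [hG.1 24 (by decide)]; simp
          have r25 : u.reg 25 = a := by
            rw [hG.1 25 (by decide), setReg_reg, if_neg (by decide), hF.1 25 (by decide), h25]
          have g1 := hu.holds_appE (i := var 24) (a := var 25) (b := var 26) (by simpa [r24] using hi)
            (by simpa [r25] using ha) (by simpa using hb)
          have g2 := hu.holds_appE (i := lit 0) (a := var 25) (b := var 26) hℓ
            (by simpa [r25] using ha) (by simpa using hb)
          simp only [eval_var, eval_lit, setReg_reg, r24, r25, if_true, Nat.reduceEqDiff,
            if_false] at g1 g2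
          have hiff : sameE.holds (u.setReg 26 b) ↔ (app i a b ↔ app 0 a b) := by
            rw [sameE, holds_or, holds_and, holds_and, holds_not, holds_not, g1, g2]
            tauto
          by_cases h : (app i a b ↔ app 0 a b)
          · rw [den_ite_pos _ (hiff.2 h)]; simp [h]
          · rw [den_ite_neg _ (fun h' => h (hiff.1 h'))]; simp [h])
      rw [key, ht.agents]
      simp)
  rw [key, hs.layers]
  simp [changes, h31]

/-- Array 4 stores the position in the list plus one, so that 0 can mean that the agent is not
listed. -/
theorem ListState.cons_pos {n β : ℕ} {chg : ℕ → Prop} {s s' : Store} (h : ListState n β chg s)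
    (hc : chg n) (h5 : s'.reg 5 = β + 1) (h3 : s'.arr 3 = Function.update (s.arr 3) β n)
    (h4 : s'.arr 4 = Function.update (s.arr 4) n (β + 1)) : ListState (n + 1) (β + 1) chg s' := by
  obtain ⟨_, g2, g3⟩ := h
  refine ⟨h5, fun a ha => ?_, fun a ha hca => ?_⟩ <;> rw [h4]
  · by_cases han : a = n
    · subst han; simp [hc]
    · rw [Function.update_of_ne han]; exact g2 a (by omega)
  · rw [h3]
    by_cases han : a = n
    · subst han; simp
    · rw [Function.update_of_ne han]
      obtain ⟨k1, k2⟩ := g3 a (by omega) hca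
      exact ⟨by omega, by rw [Function.update_of_ne (by omega)]; exact k2⟩

theorem ListState.cons_neg {n β : ℕ} {chg : ℕ → Prop} {s s' : Store} (h : ListState n β chg s)
    (hc : ¬ chg n) (h5 : s'.reg 5 = β) (h3 : s'.arr 3 = s.arr 3)
    (h4 : s'.arr 4 = Function.update (s.arr 4) n 0) : ListState (n + 1) β chg s' := by
  obtain ⟨_, g2, g3⟩ := h
  refine ⟨h5, fun a ha => ?_, fun a ha hca => ?_⟩ <;> rw [h4]
  · by_cases han : a = n
    · subst han; simp [hc]
    · rw [Function.update_of_ne han]; exact g2 a (by omega)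
  · have han : a ≠ n := fun e => hc (e ▸ hca)
    rw [h3, Function.update_of_ne han]
    exact g3 a (by omega) hca

theorem listCmd_spec {n ℓ α : ℕ} {app : ℕ → ℕ → ℕ → Prop} {s : Store} (hℓ : 0 < ℓ)
    (hs : AppState n ℓ α app s) :
    ListState n (layerCount n (changes n ℓ app)) (changes n ℓ app) (listCmd.den s) := by
  set chg := changes n ℓ app with hchg
  have hs₁ : AppState n ℓ α app (s.setReg 5 0) := hs.of_eq (by simp) (by simp) (by simp) rfl rfl
  have key := Cmd.loop_inv (x := 25) (y := 1) (s₀ := s.setReg 5 0) (p := assign 31 (lit 1) ;;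
    .loop 24 2 (.loop 26 1 (ite sameE skip (assign 31 (lit 0)))) ;;
    ite (var 31) (put 4 (var 25) (lit 0))
      (put 3 (var 5) (var 25) ;; assign 5 (add (var 5) (lit 1)) ;; put 4 (var 25) (var 5)))
    (fun i t => ListState i (layerCount i chg) chg t)
    ⟨by simp [layerCount_zero], by simp, by simp⟩ (by
      intro i hi t hF It
      rw [hs₁.agents] at hi
      have ht : AppState n ℓ α app ((t.setReg 25 i).setReg 31 1) :=
        (hs₁.of_frame hF (by decide) (by decide) (by decide) (by decide) (by decide)).of_eq
          (by simp) (by simp) (by simp) rfl rfl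
      have hflag := changesFlag_spec hℓ ht hi (by simp) (by simp)
      set c := Cmd.loop 24 2 (.loop 26 1 (ite sameE skip (assign 31 (lit 0)))) with hc
      set u := c.den ((t.setReg 25 i).setReg 31 1) with hu
      have f : Frame c ((t.setReg 25 i).setReg 31 1) u := Cmd.frame _ _
      have u25 : u.reg 25 = i := by rw [f.1 25 (by decide)]; simp
      have u5 : u.reg 5 = layerCount i chg := by
        rw [f.1 5 (by decide)]; simpa using It.count
      have u3 : u.arr 3 = t.arr 3 := by rw [f.2 3 (by decide)]; simp
      have u4 : u.arr 4 = t.arr 4 := by rw [f.2 4 (by decide)]; simp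
      rw [den_seq, den_seq, den_assign, eval_lit, ← hu]
      by_cases h : chg i
      · rw [layerCount_succ_of_pos h, den_ite_neg _ (by
          rw [holds_var, hflag]; exact not_not.2 h)]
        exact It.cons_pos h (by simp [u5]) (by simp [u5, u25, u3]) (by simp [u5, u25, u4])
      · rw [layerCount_succ_of_neg h, den_ite_pos _ ((holds_var _ _).2 (hflag.2 h))]
        exact It.cons_neg h (by simp [u5]) (by simp [u3]) (by simp [u25, u4]))
  rw [hs₁.agents] at key
  exact key

/-- Compute the number of guesses in register 8. -/
def countCmd : Cmd :=
  .loop 24 7 (assign 27 (lit 0) ;; .loop 25 6 (assign 27 (add (var 27) (var 8))) ;; assign 8 (var 27))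

/-- Each factor `B` costs `B` additions. So the count takes polynomially many steps although its
value is not polynomially bounded. -/
theorem countCmd_spec {B D : ℕ} {s : Store} (h6 : s.reg 6 = B) (h7 : s.reg 7 = D)
    (h8 : s.reg 8 = 1) : (countCmd.den s).reg 8 = B ^ D := by
  have key := Cmd.loop_inv (x := 24) (y := 7) (s₀ := s)
    (p := assign 27 (lit 0) ;; .loop 25 6 (assign 27 (add (var 27) (var 8))) ;; assign 8 (var 27))
    (fun i t => t.reg 8 = B ^ i) (by simp [h8]) (by
      intro i hi t hF It
      set t₁ := (t.setReg 24 i).setReg 27 0 with ht₁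
      have r6 : t₁.reg 6 = B := by rw [← h6, ← hF.1 6 (by decide)]; simp [ht₁]
      have r8 : t₁.reg 8 = B ^ i := by simp [ht₁, It]
      have key := Cmd.loop_inv (x := 25) (y := 6) (s₀ := t₁) (p := assign 27 (add (var 27) (var 8)))
        (fun k u => u.reg 27 = k * B ^ i) (by simp [ht₁]) (by
          intro k hk u hG Iu
          have u8 : u.reg 8 = B ^ i := by rw [hG.1 8 (by decide), r8]
          simp [Iu, u8]; ring)
      rw [r6] at key
      rw [den_seq, den_seq, den_assign, den_assign, eval_lit, eval_var, setReg_reg, if_pos rfl, key]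
      ring)
  rw [h7] at key
  exact key

/-! ### The search over all guesses -/

/-- The store after the preparation. -/
structure ReadyState (n ℓ α β : ℕ) (app : ℕ → ℕ → ℕ → Prop) (chg : ℕ → Prop) (s : Store) : Prop where
  inst : AppState n ℓ α app s
  list : ListState n β chg s
  size : s.reg 4 = n + n
  rows : ∀ u < n + n, s.arr 2 u = u * (n + n)
  base : s.reg 6 = β + 2
  length : s.reg 7 = β + β + 1

theorem ReadyState.of_frame {n ℓ α β : ℕ} {app : ℕ → ℕ → ℕ → Prop} {chg : ℕ → Prop} {s s' : Store}
    {c : Cmd} (h : ReadyState n ℓ α β app chg s) (hF : Frame c s s')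
    (hr : ∀ x ∈ [1, 2, 3, 4, 5, 6, 7], x ∉ c.regs) (ha : ∀ k ∈ [0, 1, 2, 3, 4], k ∉ c.arrs) :
    ReadyState n ℓ α β app chg s' := by
  refine ⟨h.inst.of_frame hF (hr 1 (by simp)) (hr 2 (by simp)) (hr 3 (by simp)) (ha 0 (by simp))
    (ha 1 (by simp)), h.list.of_eq (hF.1 5 (hr 5 (by simp))) (hF.2 3 (ha 3 (by simp)))
    (hF.2 4 (ha 4 (by simp))), (hF.1 4 (hr 4 (by simp))).trans h.size, ?_,
    (hF.1 6 (hr 6 (by simp))).trans h.base, (hF.1 7 (hr 7 (by simp))).trans h.length⟩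
  rw [hF.2 2 (ha 2 (by simp))]
  exact h.rows

/-- Only the first `2β + 1` digits are ever read, so an infinite sequence of digits may be replaced
by the current guess. -/
theorem Describes.congr {n β : ℕ} {app : ℕ → ℕ → ℕ → Prop} {chg : ℕ → Prop} {M d d' : ℕ → ℕ}
    {s : Store} (hL : ListState n β chg s) (h : Describes n β app chg M (s.arr 3) (s.arr 4) d)
    (e : ∀ j < β + β + 1, d' j = d j) : Describes n β app chg M (s.arr 3) (s.arr 4) d' := by
  have e1 : ∀ a < n, chg a → d' (s.arr 4 a - 1) = d (s.arr 4 a - 1) := fun a ha hc =>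
    e _ (by have := (hL.index a ha hc).1; omega)
  have e2 : ∀ a < n, chg a → d' (β + (s.arr 4 a - 1)) = d (β + (s.arr 4 a - 1)) := fun a ha hc =>
    e _ (by have := (hL.index a ha hc).1; omega)
  refine ⟨fun a ha hc hcm => ?_, fun a ha hc hcm ho => ?_, fun a ha hc hcm ho => ?_,
    fun a ha hc => ?_, ?_⟩
  · rw [e1 a ha hc]; exact h.inside a ha hc hcm
  · rw [e1 a ha hc]; exact h.out a ha hc hcm ho
  · rw [e1 a ha hc]; exact h.alone a ha hc hcm ho
  · rw [e2 a ha hc]; exact h.nbrs a ha hc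
  · rw [e _ (by omega)]; exact h.all

/-- Try the guess in array 5, and go on to the next one. -/
def tryCmd (N : Notion) : Cmd :=
  buildCmd ;; checkCmd N ;; ite (var 29) (assign 0 (lit 1)) skip ;; incrCmd

theorem tryCmd_frame (N : Notion) : (∀ x ∈ [1, 2, 3, 4, 5, 6, 7, 9], x ∉ (tryCmd N).regs) ∧
    ∀ k ∈ [0, 1, 2, 3, 4], k ∉ (tryCmd N).arrs := by
  rcases N with σ | σ | _ | _
  · cases σ <;> decide
  · cases σ <;> decide
  · decide
  · decide

theorem build_check_frame (N : Notion) :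
    (∀ x ∈ [0, 1, 2, 3, 4, 5, 6, 7, 9], x ∉ (buildCmd ;; checkCmd N).regs) ∧
    ∀ k ∈ [0, 1, 2, 3, 4, 5], k ∉ (buildCmd ;; checkCmd N).arrs := by
  rcases N with σ | σ | _ | _
  · cases σ <;> decide
  · cases σ <;> decide
  · decide
  · decide

/-- Acceptance is sound because the check has seen a stable matching. It is complete because the
digits describing a given stable `M` occur among the guesses, and at that guess the rebuilt matching
is stable. -/
theorem tryLoop_spec {n ℓ α β : ℕ} {app : ℕ → ℕ → ℕ → Prop} {chg : ℕ → Prop} {s : Store}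
    (S : Sys n ℓ app chg) (hα : α ≤ ℓ) (hα1 : 1 ≤ α) (hs : ReadyState n ℓ α β app chg s)
    (h8 : s.reg 8 = (β + 2) ^ (β + β + 1)) (h5 : ∀ j, s.arr 5 j = 0) (h0 : s.reg 0 = 0)
    (N : Notion) :
    ((Cmd.loop 9 8 (tryCmd N)).den s).reg 0 ≠ 0 ↔ ∃ m, Invol n m ∧ nstable n ℓ α app m N := by
  have key := Cmd.loop_inv (x := 9) (y := 8) (s₀ := s) (p := tryCmd N)
    (fun g t => (∀ j < β + β + 1, t.arr 5 j = digit (β + 2) g j) ∧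
      (t.reg 0 ≠ 0 → ∃ m, Invol n m ∧ nstable n ℓ α app m N) ∧
      ∀ M, Invol n M → nstable n ℓ α app M N → ∀ g' < g,
        Describes n β app chg M (s.arr 3) (s.arr 4) (digit (β + 2) g') → t.reg 0 ≠ 0)
    ⟨fun j _ => by simp [h5, digit], fun h => absurd h0 h, by simp⟩ (by
      rintro g hg t hF ⟨I1, I2, I3⟩
      have ht : ReadyState n ℓ α β app chg t := hs.of_frame hF
        (fun x hx => by
          have h1 := (tryCmd_frame N).1 x (by simp at hx ⊢; omega)
          have h2 : x ≠ 9 := by simp at hx; omega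
          simp [Cmd.regs, h1, h2])
        (fun k hk => (tryCmd_frame N).2 k hk)
      set u₀ := t.setReg 9 g with hu₀
      have hu₀' : ReadyState n ℓ α β app chg u₀ :=
        ⟨ht.inst.of_eq (by simp [hu₀]) (by simp [hu₀]) (by simp [hu₀]) rfl rfl,
          ht.list.of_eq (by simp [hu₀]) rfl rfl, by simp [hu₀, ht.size], ht.rows,
          by simp [hu₀, ht.base], by simp [hu₀, ht.length]⟩
      set u₁ := buildCmd.den u₀ with hu₁
      have hu₁' : ReadyState n ℓ α β app chg u₁ :=
        hu₀'.of_frame (Cmd.frame buildCmd u₀) (by decide) (by decide)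
      have hcheck := checkCmd_spec hu₁'.inst N
      set u₂ := (checkCmd N).den u₁ with hu₂
      have f₂ : Frame (buildCmd ;; checkCmd N) u₀ u₂ := Cmd.frame _ _
      have b := build_check_frame N
      set u₃ := (ite (var 29) (assign 0 (lit 1)) skip).den u₂ with hu₃
      have f₃ : Frame (ite (var 29) (assign 0 (lit 1)) skip) u₂ u₃ := Cmd.frame _ _
      have e : (tryCmd N).den u₀ = incrCmd.den u₃ := by
        simp only [tryCmd, den_seq, hu₃, hu₂, hu₁]
      rw [e]
      have hinc := incrCmd_spec (s := u₃) (B := β + 2) (D := β + β + 1) (g := g) (by omega)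
        (by rw [f₃.1 6 (by decide), f₂.1 6 (b.1 6 (by simp)), hu₀'.base])
        (by rw [f₃.1 7 (by decide), f₂.1 7 (b.1 7 (by simp)), hu₀'.length])
        (by rw [f₃.2 5 (by decide), f₂.2 5 (b.2 5 (by simp))]; exact I1)
      have r0 : (incrCmd.den u₃).reg 0 = u₃.reg 0 := (Cmd.frame incrCmd u₃).1 0 (by decide)
      have u20 : u₂.reg 0 = t.reg 0 := by rw [f₂.1 0 (b.1 0 (by simp))]; simp [hu₀]
      have hu30 : u₃.reg 0 ≠ 0 ↔
          t.reg 0 ≠ 0 ∨ (Invol n (u₁.arr 6) ∧ nstable n ℓ α app (u₁.arr 6) N) := by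
        rw [← hcheck]
        by_cases h : u₂.reg 29 ≠ 0
        · rw [hu₃, den_ite_pos _ ((holds_var _ _).2 h)]; simp [h]
        · rw [hu₃, den_ite_neg _ (mt (holds_var _ _).1 h), den_skip, u20]; simp [h]
      refine ⟨hinc, ?_, ?_⟩
      · rw [r0, hu30]
        rintro (h | h)
        · exact I2 h
        · exact ⟨_, h⟩
      · intro M hM hst g' hg' hd
        rw [r0, hu30]
        by_cases hgg : g' = g
        · right
          subst hgg
          have e3 : u₀.arr 3 = s.arr 3 := hF.2 3 ((tryCmd_frame N).2 3 (by simp))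
          have e4 : u₀.arr 4 = s.arr 4 := hF.2 4 ((tryCmd_frame N).2 4 (by simp))
          rw [← e3, ← e4] at hd
          obtain ⟨m₂, R⟩ := buildCmd_spec S hM hu₀'.inst hu₀'.list hu₀'.size hu₀'.rows
            (hd.congr hu₀'.list I1)
          exact ⟨R.invol, S.nstable_of_rebuilt hα hα1 hM R hst⟩
        · exact Or.inl (I3 M hM hst g' (by omega) hd))
  rw [h8] at key
  refine ⟨key.2.1, ?_⟩
  rintro ⟨M, hM, hst⟩
  obtain ⟨d, hd, hD⟩ := hs.list.exists_describes (app := app) hM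
  obtain ⟨g, hg, hgd⟩ := exists_digits (β + β + 1) d hd
  exact key.2.2 M hM hst g hg (hD.congr hs.list hgd)

/-! ### The input -/

theorem getD_flatMap_finRange {m L : ℕ} : ∀ (f : Fin m → List ℕ), (∀ i, (f i).length = L) →
    ∀ (i : Fin m) (j : ℕ), j < L →
      ((List.finRange m).flatMap f).getD (i * L + j) 0 = (f i).getD j 0 := by
  induction m with
  | zero => exact fun _ _ i => i.elim0
  | succ m ih =>
    intro f hf i j hj
    rw [List.finRange_succ, List.flatMap_cons]
    refine Fin.cases ?_ (fun i => ?_) i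
    · rw [List.getD_append _ _ _ _ (by simpa [hf] using hj)]
      simp
    · rw [List.getD_append_right _ _ _ _ (by simp [hf, Nat.add_mul]; omega), hf,
        List.flatMap_map]
      have e : (i.succ : ℕ) * L + j - L = i * L + j := by
        simp only [Fin.val_succ, Nat.add_mul, Nat.one_mul]; omega
      rw [e]
      exact ih (fun i => f i.succ) (fun i => hf _) i j hj

theorem length_flatMap_finRange {m L : ℕ} (f : Fin m → List ℕ) (hf : ∀ i, (f i).length = L) :
    ((List.finRange m).flatMap f).length = m * L := by
  simp [List.length_flatMap, hf]

namespace Inst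

variable (I : Inst)

theorem length_encode : I.encode.length = 3 + I.ℓ * (I.n * I.n) := by
  rw [encode, List.length_append, length_flatMap_finRange (L := I.n * I.n)]
  · rfl
  · exact fun i => length_flatMap_finRange _ fun a => by simp

theorem encode_getD {i a b : ℕ} (hi : i < I.ℓ) (ha : a < I.n) (hb : b < I.n) :
    I.encode.getD (3 + ((i * I.n + a) * I.n + b)) 0 ≠ 0 ↔ I.app i a b := by
  have hlen : ∀ (i : Fin I.ℓ) (a : Fin I.n),
      ((List.finRange I.n).map fun b => if b ∈ I.T i a then 1 else 0).length = I.n := by simp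
  have hidx : a * I.n + b < I.n * I.n := by
    have := Nat.mul_le_mul_right I.n (Nat.succ_le_of_lt ha)
    simp only [Nat.succ_eq_add_one, Nat.add_mul, Nat.one_mul] at this
    omega
  have e : 3 + ((i * I.n + a) * I.n + b) = [I.n, I.ℓ, I.α].length + (i * (I.n * I.n) + (a * I.n + b)) := by
    simp; ring
  rw [encode, List.getD_append_right _ _ _ _ (by rw [e]; omega), e, Nat.add_sub_cancel_left]
  rw [getD_flatMap_finRange (L := I.n * I.n) _
    (fun i => length_flatMap_finRange _ fun a => hlen i a) ⟨i, hi⟩ _ hidx]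
  rw [getD_flatMap_finRange (L := I.n) _ (hlen ⟨i, hi⟩) ⟨a, ha⟩ b hb]
  rw [I.app_iff ⟨i, hi⟩ ⟨a, ha⟩ ⟨b, hb⟩]
  simp [List.getD_eq_getElem?_getD, hb]

theorem length_le_inputSize (w : List ℕ) : w.length ≤ inputSize w := by
  induction w with
  | nil => simp
  | cons x w ih =>
    simp only [inputSize, List.map_cons, List.sum_cons, List.length_cons] at ih ⊢
    omega

theorem three_le_size : 3 ≤ inputSize I.encode :=
  le_trans (by rw [length_encode]; omega) (length_le_inputSize _)

theorem agents_le_size : I.n ≤ inputSize I.encode := by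
  refine le_trans ?_ (length_le_inputSize _)
  rw [length_encode]
  have h1 : I.n ≤ I.n * I.n := Nat.le_mul_self _
  have h2 : I.n * I.n ≤ I.ℓ * (I.n * I.n) :=
    Nat.le_mul_of_pos_left _ (I.one_le_α.trans I.α_le_ℓ)
  omega

/-- Without agents the matrices are empty and `ℓ` occurs in the input only in binary, so it need not
be bounded by the input size. This is why `solveCmd` treats that case separately. -/
theorem layers_le_size (hn : I.n ≠ 0) : I.ℓ ≤ inputSize I.encode := by
  refine le_trans ?_ (length_le_inputSize _)
  rw [length_encode]
  have h2 : I.ℓ ≤ I.ℓ * (I.n * I.n) :=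
    Nat.le_mul_of_pos_right _ (Nat.mul_pos (Nat.pos_of_ne_zero hn) (Nat.pos_of_ne_zero hn))
  omega

/-- Agreement of all layers amounts to agreement with layer 0, which exists since `1 ≤ α ≤ ℓ`. -/
theorem changing_eq : I.changing = layerCount I.n (changes I.n I.ℓ I.app) := by
  classical
  rw [changing, layerCount, ← Finset.card_map Fin.valEmbedding]
  congr 1
  ext a
  simp only [Finset.mem_map, Finset.mem_filter, Finset.mem_univ, true_and, Finset.mem_range,
    Fin.valEmbedding_apply]
  have hℓ : 0 < I.ℓ := I.one_le_α.trans I.α_le_ℓ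
  have key : ∀ a : Fin I.n, (¬ ∀ i j : Fin I.ℓ, I.T i a = I.T j a) ↔ changes I.n I.ℓ I.app a := by
    intro a
    refine not_congr ⟨fun h i hi b hb => ?_, fun h => ?_⟩
    · rw [I.app_iff ⟨i, hi⟩ a ⟨b, hb⟩, I.app_iff ⟨0, hℓ⟩ a ⟨b, hb⟩, h]
    · have h0 : ∀ i : Fin I.ℓ, I.T i a = I.T ⟨0, hℓ⟩ a := by
        intro i
        ext b
        rw [← I.app_iff i a b, ← I.app_iff ⟨0, hℓ⟩ a b]
        exact h i i.2 b b.2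
      exact fun i j => (h0 i).trans (h0 j).symm
  constructor
  · rintro ⟨b, hb, rfl⟩
    exact ⟨b.2, (key b).1 hb⟩
  · rintro ⟨ha, h⟩
    exact ⟨⟨a, ha⟩, (key ⟨a, ha⟩).2 h, rfl⟩

theorem sys (hs : I.Symmetric) : Sys I.n I.ℓ I.app (changes I.n I.ℓ I.app) where
  pos := I.one_le_α.trans I.α_le_ℓ
  symm := fun _ _ _ _ _ _ h => I.app_symm hs h
  const := fun _ _ hc i hi b hb => not_not.1 hc i hi b hb

end Inst

theorem layerCount_le (n : ℕ) (p : ℕ → Prop) : layerCount n p ≤ n := by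
  classical
  exact (Finset.card_filter_le _ _).trans (Finset.card_range n).le

/-! ### The algorithm -/

/-- Read the header of the input. -/
def headerCmd : Cmd :=
  assign 1 (get 0 (lit 0)) ;; assign 2 (get 0 (lit 1)) ;; assign 3 (get 0 (lit 2)) ;;
    assign 4 (add (var 1) (var 1))

/-- Set up the numbers that determine the number of guesses. -/
def boundsCmd : Cmd :=
  assign 6 (add (var 5) (lit 2)) ;; assign 7 (add (add (var 5) (var 5)) (lit 1)) ;; assign 8 (lit 1)

/-- The whole algorithm. -/
def solveCmd (N : Notion) : Cmd :=
  headerCmd ;; ite (var 1)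
    ((tableCmd ;; listCmd) ;; boundsCmd ;; countCmd ;; .loop 9 8 (tryCmd N))
    (assign 0 (lit 1))

/-- A command without the loop over the guesses that bounds the cost of the algorithm. -/
def roundCmd (N : Notion) : Cmd :=
  headerCmd ;; (tableCmd ;; listCmd) ;; boundsCmd ;; countCmd ;; tryCmd N

theorem Cmd.cost_ite_pos (s : Store) {e : Expr} {p q : Cmd} (h : e.holds s) :
    (ite e p q).cost s = 1 + e.cost + 1 + p.cost s :=
  congrArg (1 + e.cost + 1 + ·) (if_pos h)

theorem Cmd.cost_ite_neg (s : Store) {e : Expr} {p q : Cmd} (h : ¬ e.holds s) :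
    (ite e p q).cost s = 1 + e.cost + 1 + q.cost s :=
  congrArg (1 + e.cost + 1 + ·) (if_neg h)

theorem tryCmd_boundedBy (N : Notion) : (tryCmd N).boundedBy [1, 2, 4, 7] = true := by
  rcases N with σ | σ | _ | _
  · cases σ <;> decide
  · cases σ <;> decide
  · decide
  · decide

theorem solveCmd_spec (I : Inst) (hI : I.Symmetric) (N : Notion) :
    (((solveCmd N).den (initStore I.encode)).reg 0 ≠ 0 ↔ I.HasStableMatching N) ∧
    (solveCmd N).cost (initStore I.encode) ≤
      (I.changing + 2) ^ (I.changing + I.changing + 1) *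
        ((roundCmd N).bound (3 * inputSize I.encode) + 30) := by
  set s := initStore I.encode with hs
  set sz := inputSize I.encode with hsz
  set β := I.changing with hβ
  have hK : 1 ≤ (β + 2) ^ (β + β + 1) := Nat.one_le_pow _ _ (by omega)
  have hK' := Nat.mul_le_mul_right ((roundCmd N).bound (3 * sz) + 30) hK
  have c₁ := headerCmd.cost_le_bound (ys := []) (N := 3 * sz) (by decide) s (by simp)
  set s₁ := headerCmd.den s with hs₁
  have r1 : s₁.reg 1 = I.n := by simp [hs₁, headerCmd, hs, initStore, Inst.encode]
  have r2 : s₁.reg 2 = I.ℓ := by simp [hs₁, headerCmd, hs, initStore, Inst.encode]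
  have r3 : s₁.reg 3 = I.α := by simp [hs₁, headerCmd, hs, initStore, Inst.encode]
  have r4 : s₁.reg 4 = I.n + I.n := by simp [hs₁, headerCmd, hs, initStore, Inst.encode]
  have f₁ : Frame headerCmd s s₁ := Cmd.frame _ _
  have hr : (roundCmd N).bound (3 * sz) = 1 + headerCmd.bound (3 * sz) +
      (1 + (tableCmd ;; listCmd).bound (3 * sz) + (1 + boundsCmd.bound (3 * sz) +
        (1 + countCmd.bound (3 * sz) + (tryCmd N).bound (3 * sz)))) := rfl
  rw [I.hasStableMatching_iff hI]
  by_cases hn : I.n = 0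
  -- With no agents every matching is vacuously stable in all layers, and the algorithm accepts at
  -- once.
  · have hv : ¬ (var 1).holds s₁ := by simp [r1, hn]
    constructor
    · have e : (solveCmd N).den s = s₁.setReg 0 1 := by
        rw [solveCmd, den_seq, ← hs₁, den_ite_neg _ hv]; rfl
      rw [e]
      refine iff_of_true (by simp) ⟨id, fun a ha => by omega, ?_⟩
      rcases N with σ | σ | _ | _
      · rw [nstable, layerCount_of_forall fun i _ a ha => by omega]
        exact I.α_le_ℓ
      all_goals exact fun a ha => by omega
    · have e : (solveCmd N).cost s = 1 + headerCmd.cost s + (1 + 1 + 1 + (1 + 1 + 1)) :=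
        congrArg (1 + headerCmd.cost s + ·) (cost_ite_neg s₁ hv)
      omega
  · have hℓ : 0 < I.ℓ := I.one_le_α.trans I.α_le_ℓ
    have h3 := I.three_le_size
    have hnsz := I.agents_le_size
    have hℓsz := I.layers_le_size hn
    have hv : (var 1).holds s₁ := by simp [r1, hn]
    -- Together with `3 ≤ sz` and `n ≤ sz` this keeps `2n`, `β + 2` and `2β + 1` at most `3 * sz`,
    -- the bound for all loops except the one over the guesses.
    have hβn : β ≤ I.n := by rw [hβ, I.changing_eq]; exact layerCount_le _ _
    set s₂ := tableCmd.den s₁ with hs₂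
    have f₂ : Frame tableCmd s₁ s₂ := Cmd.frame _ _
    obtain ⟨t1, t2⟩ := tableCmd_spec r1 r2 r4
    rw [← hs₂] at t1 t2
    have a0 : s₂.arr 0 = fun j => I.encode.getD j 0 := by
      rw [f₂.2 0 (by decide), f₁.2 0 (by decide)]
      simp [hs, initStore]
    have A₂ : AppState I.n I.ℓ I.α I.app s₂ := by
      refine ⟨by rw [f₂.1 1 (by decide), r1], by rw [f₂.1 2 (by decide), r2],
        by rw [f₂.1 3 (by decide), r3], fun i hi a ha b hb => ?_⟩
      have h1 : i < I.ℓ * I.n := hi.trans_le (Nat.le_mul_of_pos_right _ (by omega))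
      have h2 : i * I.n + a < I.ℓ * I.n := by
        have := Nat.mul_le_mul_right I.n (Nat.succ_le_of_lt hi)
        simp only [Nat.succ_eq_add_one, Nat.add_mul, Nat.one_mul] at this
        omega
      rw [t1 i h1, t1 _ h2, a0]
      exact I.encode_getD hi ha hb
    set s₃ := listCmd.den s₂ with hs₃
    have f₃ : Frame listCmd s₂ s₃ := Cmd.frame _ _
    have L₃ := listCmd_spec hℓ A₂
    rw [← I.changing_eq, ← hβ, ← hs₃] at L₃
    have A₃ : AppState I.n I.ℓ I.α I.app s₃ := A₂.of_frame f₃ (by decide) (by decide) (by decide)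
      (by decide) (by decide)
    have c₂ := (tableCmd ;; listCmd).cost_le_bound (ys := [1, 2, 4]) (N := 3 * sz) (by decide) s₁
      (by
        intro y hy
        simp only [List.mem_cons, List.not_mem_nil, or_false] at hy
        rcases hy with rfl | rfl | rfl <;> omega)
    set s₄ := boundsCmd.den s₃ with hs₄
    have f₄ : Frame boundsCmd s₃ s₄ := Cmd.frame _ _
    have c₃ := boundsCmd.cost_le_bound (ys := []) (N := 3 * sz) (by decide) s₃ (by simp)
    have r6 : s₄.reg 6 = β + 2 := by simp [hs₄, boundsCmd, L₃.count]
    have r7 : s₄.reg 7 = β + β + 1 := by simp [hs₄, boundsCmd, L₃.count]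
    have r8 : s₄.reg 8 = 1 := by simp [hs₄, boundsCmd]
    have c₄ := countCmd.cost_le_bound (ys := [6, 7]) (N := 3 * sz) (by decide) s₄
      (by
        intro y hy
        simp only [List.mem_cons, List.not_mem_nil, or_false] at hy
        rcases hy with rfl | rfl <;> omega)
    set s₅ := countCmd.den s₄ with hs₅
    have f₅ : Frame countCmd s₄ s₅ := Cmd.frame _ _
    have r58 : s₅.reg 8 = (β + 2) ^ (β + β + 1) := countCmd_spec r6 r7 r8
    have R₄ : ReadyState I.n I.ℓ I.α β I.app (changes I.n I.ℓ I.app) s₄ := by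
      refine ⟨A₃.of_frame f₄ (by decide) (by decide) (by decide) (by decide) (by decide),
        L₃.of_eq (f₄.1 5 (by decide)) (f₄.2 3 (by decide)) (f₄.2 4 (by decide)), ?_, ?_, r6, r7⟩
      · rw [f₄.1 4 (by decide), f₃.1 4 (by decide), f₂.1 4 (by decide), r4]
      · rw [f₄.2 2 (by decide), f₃.2 2 (by decide)]; exact t2
    have R₅ := R₄.of_frame f₅ (by decide) (by decide)
    have h05 : ∀ j, s₅.arr 5 j = 0 := by
      intro j
      rw [f₅.2 5 (by decide), f₄.2 5 (by decide), f₃.2 5 (by decide), f₂.2 5 (by decide),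
        f₁.2 5 (by decide)]
      simp [hs, initStore]
    have h00 : s₅.reg 0 = 0 := by
      rw [f₅.1 0 (by decide), f₄.1 0 (by decide), f₃.1 0 (by decide), f₂.1 0 (by decide),
        f₁.1 0 (by decide)]
      simp [hs, initStore]
    have c₅ := Cmd.loop_cost_le (x := 9) (z := 8) (N := 3 * sz) (by decide) (tryCmd_boundedBy N)
      ((tryCmd N).cost_le_bound (tryCmd_boundedBy N)) s₅ (by
        intro y hy
        have q1 := R₅.inst.agents
        have q2 := R₅.inst.layers
        have q4 := R₅.size
        have q7 := R₅.length
        simp only [List.mem_cons, List.not_mem_nil, or_false] at hy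
        rcases hy with rfl | rfl | rfl | rfl <;> omega)
    rw [r58] at c₅
    constructor
    · have e : (solveCmd N).den s = (Cmd.loop 9 8 (tryCmd N)).den s₅ := by
        rw [solveCmd, den_seq, ← hs₁, den_ite_pos _ hv]
        simp only [den_seq, hs₅, hs₄, hs₃, hs₂]
      rw [e]
      exact tryLoop_spec (I.sys hI) I.α_le_ℓ I.one_le_α R₅ r58 h05 h00 N
    · have e : (solveCmd N).cost s = 1 + headerCmd.cost s + (1 + 1 + 1 +
          (1 + (tableCmd ;; listCmd).cost s₁ + (1 + boundsCmd.cost s₃ + (1 + countCmd.cost s₄ +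
            (Cmd.loop 9 8 (tryCmd N)).cost s₅)))) := by
        have e' := cost_ite_pos s₁ (p := (tableCmd ;; listCmd) ;; boundsCmd ;; countCmd ;;
          .loop 9 8 (tryCmd N)) (q := assign 0 (lit 1)) hv
        exact congrArg (1 + headerCmd.cost s + ·) e'
      rw [e]
      -- What runs only once is charged to every guess, since there is at least one. The constants
      -- match because 25 + 9 = 30 + 4: the 9 is the overhead of a loop round and the 4 are the
      -- sequencing steps inside the bound of `roundCmd`.
      have hK₂ := Nat.mul_le_mul_right (headerCmd.bound (3 * sz) +
        (tableCmd ;; listCmd).bound (3 * sz) + boundsCmd.bound (3 * sz) +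
        countCmd.bound (3 * sz) + 25) hK
      rw [hr]
      simp only [Nat.mul_add, Nat.one_mul] at hK₂ c₅ ⊢
      omega

theorem computable_guesses (A : ℕ) :
    Computable fun β : ℕ => A * (β + 2) ^ (β + β + 1) := by
  have hpow : Primrec₂ fun a b : ℕ => a ^ b := by
    refine (Primrec.nat_rec' (f := fun p : ℕ × ℕ => p.2) (g := fun _ => 1)
      (h := fun p q => q.2 * p.1) Primrec.snd (Primrec.const 1)
      (Primrec.nat_mul.comp (Primrec.snd.comp Primrec.snd)
        (Primrec.fst.comp Primrec.fst)).to₂).of_eq ?_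
    rintro ⟨a, b⟩
    induction b with
    | zero => rfl
    | succ b ih => exact (congrArg (· * a) ih).trans (pow_succ a b).symm
  have h1 : Primrec fun β : ℕ => β + 2 := Primrec.nat_add.comp Primrec.id (Primrec.const 2)
  have h2 : Primrec fun β : ℕ => β + β + 1 :=
    Primrec.nat_add.comp (Primrec.nat_add.comp Primrec.id Primrec.id) (Primrec.const 1)
  exact (Primrec.nat_mul.comp (Primrec.const A) (hpow.comp h1 h2)).to_comp

end MultilayerMatching

theorem mainTheorem12 (N : MultilayerMatching.Notion) :
    MultilayerMatching.IsFPT MultilayerMatching.Inst.encode MultilayerMatching.Inst.Symmetric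
      (fun I => I.HasStableMatching N) MultilayerMatching.Inst.changing := by
  open MultilayerMatching in
  obtain ⟨A, d, hA⟩ := (roundCmd N).exists_bound_le
  refine ⟨(solveCmd N).compile 0, fun β => ((A + 30) * 4 ^ d) * (β + 2) ^ (β + β + 1), d,
    computable_guesses _, fun I hI => ?_⟩
  obtain ⟨hres, hcost⟩ := solveCmd_spec I hI N
  -- All registers are 0 initially, so the initial store represents itself in spite of the
  -- renumbering of registers.
  obtain ⟨m, hrun, hsim, -⟩ := (solveCmd N).compile_spec 0 (initStore I.encode)
    (initStore I.encode) ⟨fun _ => rfl, rfl⟩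
  refine ⟨m, ⟨_, hcost.trans ?_, hrun []⟩, ?_⟩
  · have h3 := I.three_le_size
    set sz := inputSize I.encode
    -- The summand in `3 * sz + 1` is absorbed by `4 * sz`, and the additive 30 by the factor `A +
    -- 30`. This leaves a constant times `sz ^ d`.
    have h1 : (roundCmd N).bound (3 * sz) + 30 ≤ (A + 30) * (4 * sz) ^ d := by
      have h2 : (3 * sz + 1) ^ d ≤ (4 * sz) ^ d := Nat.pow_le_pow_left (by omega) d
      have h4 : 1 ≤ (4 * sz) ^ d := Nat.one_le_pow _ _ (by omega)
      have h5 := (hA (3 * sz)).trans (Nat.mul_le_mul_left A h2)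
      rw [Nat.add_mul]
      omega
    calc _ ≤ (I.changing + 2) ^ (I.changing + I.changing + 1) * ((A + 30) * (4 * sz) ^ d) :=
          Nat.mul_le_mul_left _ h1
      _ = _ := by rw [mul_pow]; ring
  -- Register 0 of the command is register `2 * 0` of the machine, so the answer appears where it is
  -- expected.
  · have := hsim.1 0
    rw [Nat.mul_zero] at this
    rw [this]
    exact hres
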